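/- Let $k$ be an algebraically closed field of characteristic $0$. A finite-dimensional representation $\rho:\mathfrak g\to\operatorname{End}_k(V)$ of a semisimple Lie algebra $\mathfrak g$ over $k$ is called *asymmetrical* if for every non-inner automorphism $\alpha$ of $\mathfrak g$ there is a sub-representation $\sigma$ of $\rho$ that is not equivalent to $\sigma\circ\alpha$. Let $G_0$ be a (connected) semisimple algebraic group over $k$ with Lie algebra $\mathfrak g_0$, let $\rho_0:G_0\to\operatorname{GL}(U_0/k)$ be a finite-dimensional linear representation, and let $\rho_0'=\rho_0\oplus\operatorname{Ad}$ on $U_0'=U_0\oplus\mathfrak g_0$. Assume that $\rho_0'$ is faithful and that its derived representation $\rho_0'^{\mathrm{der}}:\mathfrak g_0\to\operatorname{End}_k(U_0')$ is asymmetrical. Let $U$ be the trivial one-dimensional representation of $G_0$, let $0\neq e\in U$, and put $U'=U\oplus\mathfrak g_0$. Define endomorphisms $a$ of $U\otimes_kU'\otimes_kU_0'$ and $a'$ of $U'$ by $$a\bigl(x_1\otimes(x+x')\otimes(x_0+x_0')\bigr)=x_1\otimes\bigl(x_0'\otimes x'+e\otimes\rho_0'^{\mathrm{der}}(x')(x_0+x_0')\bigr),\qquad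 a'(x+x')=x,$$ for $x_0\in U_0$, $x,x_1\in U$, $x',x_0'\in\mathfrak g_0$ (in the term $x_0'\otimes x'$ one regards $x_0'\in\mathfrak g_0\subset U'$ and $x'\in\mathfrak g_0\subset U_0'$). Let $G^0$ be the pointwise stabilizer of $k[a]$, $k[a']$ and $\operatorname{End}_{G_0}(U_0')$ in $\operatorname{GL}(U/k)\times\operatorname{GL}(U'/k)\times\operatorname{GL}(U_0'/k)$, i.e. the group of all triples $(g,g',g_0')$ such that $g\otimes g'\otimes g_0'$ commutes with $k[a]$, $g'$ commutes with $k[a']$, and $g_0'$ commutes with $\operatorname{End}_{G_0}(U_0')$. Let $T^0$ be the center of $G^0$, let $T_0'$ be the center of $\operatorname{End}_{G_0}(U_0')^\times$, and let $T'\subset T_0'$ be the subgroup of the elements that act on $\mathfrak g_0$ by a scalar. Regard $G_0$ as a subgroup of $\operatorname{GL}(U/k)\times\operatorname{GL}(U'/k)\times\operatorname{GL}(U_0'/k)$ through its actions on $U$, $U'$ and $U_0'$. Then $T^0G_0=G^0$. The group $T'$ is a torus, and $T^0=\mathbb G_m\times\mathbb G_m\times T'$, where the two copies of $\mathbb G_m$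 act as scalars on $U$ and on $U'$, respectively, and $T'$ acts on $U_0'$. In particular $T^0$ is a torus and is connected. If moreover $G_0\neq1$, then the rank of $T^0$ is $$3+\#\{\text{isotypic components of }U_0'\}-\#\{\text{simple factors of }\mathfrak g_0\}.$$ -/

import Mathlib

open scoped TensorProduct Pointwise

namespace AlgGrp

noncomputable section

attribute [local instance 100] LieRing.ofAssociativeRing

/-! ### Algebras of regular functions

Throughout, `k` is a field (algebraically closed of characteristic zero in the application). A
variety is a set `X` (of `k`-points) together with its algebra of regular functions, a subalgebra
of the algebra of all functions `X → k`. -/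

section Coord

variable {k : Type*} [Field k] {X Y : Type*}

/-- Regular functions on `X × Y`: the algebra generated by the regular functions of either factor. -/
def prodCoord (A : Subalgebra k (X → k)) (B : Subalgebra k (Y → k)) : Subalgebra k (X × Y → k) :=
  Algebra.adjoin k
    ({F | ∃ f ∈ A, F = fun p => f p.1} ∪ {F | ∃ f ∈ B, F = fun p => f p.2})

/-- Regular functions on a closed subset: restrictions of regular functions. -/
def restrictCoord (A : Subalgebra k (X → k)) (S : Set X) : Subalgebra k (S → k) :=
  A.map (AlgHom.pi fun s : S => Pi.evalAlgHom k (fun _ : X => k) (s : X))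

/-- A map is a morphism of varieties if it pulls back regular functions to regular functions. -/
def IsRegularMap (A : Subalgebra k (X → k)) (B : Subalgebra k (Y → k)) (φ : X → Y) : Prop :=
  ∀ f ∈ B, (fun x => f (φ x)) ∈ A

/-- The Zariski topology, with the basic open sets `{f ≠ 0}`. -/
@[reducible] def zariski (A : Subalgebra k (X → k)) : TopologicalSpace X :=
  TopologicalSpace.generateFrom {U | ∃ f ∈ A, U = {x | f x ≠ 0}}

/-- Closedness in the Zariski topology. -/
def IsZariskiClosed (A : Subalgebra k (X → k)) (S : Set X) : Prop :=
  @IsClosed X (zariski A) S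

/-- Connectedness in the Zariski topology. -/
def IsZariskiConnected (A : Subalgebra k (X → k)) (S : Set X) : Prop :=
  @IsConnected X (zariski A) S

/-- The regular functions on `GL(V)`: generated by the matrix coefficients of `g` and of `g⁻¹`. -/
def glCoord (k : Type*) [Field k] (V : Type*) [AddCommGroup V] [Module k V] :
    Subalgebra k (LinearMap.GeneralLinearGroup k V → k) :=
  Algebra.adjoin k
    ({F | ∃ (l : Module.Dual k V) (v : V), F = fun g => l (g.1 v)} ∪
     {F | ∃ (l : Module.Dual k V) (v : V), F = fun g => l ((g⁻¹).1 v)})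

/-- The regular functions on the split torus of rank `r`: Laurent polynomials in the coordinates. -/
def torusCoord (k : Type*) [Field k] (r : ℕ) : Subalgebra k ((Fin r → kˣ) → k) :=
  Algebra.adjoin k
    (Set.range (fun (i : Fin r) (t : Fin r → kˣ) => (t i : k)) ∪
     Set.range (fun (i : Fin r) (t : Fin r → kˣ) => (((t i)⁻¹ : kˣ) : k)))

/-- The subgroup `H` of an algebraic group with regular functions `A` is a torus of rank `r`: it is
isomorphic, as an algebraic group, to the `r`-th power of the multiplicative group. -/
def IsTorusOfRank {G : Type*} [Group G] (A : Subalgebra k (G → k)) (H : Subgroup G) (r : ℕ) :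
    Prop :=
  ∃ φ : H ≃* (Fin r → kˣ),
    IsRegularMap (restrictCoord A (H : Set G)) (torusCoord k r) φ ∧
    IsRegularMap (torusCoord k r) (restrictCoord A (H : Set G)) φ.symm

end Coord

/-! ### Affine algebraic groups -/

/-- An affine algebraic group over an algebraically closed field `k`, in the language of varieties:
`G` is the group of `k`-points and `coord` its algebra of regular functions. -/
class AffineAlgGroup (k : Type*) [Field k] (G : Type*) [Group G] where
  /-- the coordinate ring -/
  coord : Subalgebra k (G → k)
  fg : coord.FG
  /-- regular functions separate points -/
  separates : ∀ g h : G, (∀ f ∈ coord, f g = f h) → g = h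
  /-- every `k`-valued character of the coordinate ring is the evaluation at a point -/
  exists_point : ∀ χ : coord →ₐ[k] k, ∃ g : G, ∀ f : coord, χ f = (f : G → k) g
  mul_regular : IsRegularMap (prodCoord coord coord) coord (fun p : G × G => p.1 * p.2)
  inv_regular : IsRegularMap coord coord (fun g : G => g⁻¹)

/-- The coordinate ring of an affine algebraic group. -/
abbrev coordRing (k : Type*) [Field k] (G : Type*) [Group G] [AffineAlgGroup k G] :
    Subalgebra k (G → k) :=
  AffineAlgGroup.coord

/-- A semisimple algebraic group: connected, with trivial radical, that is, without non-trivial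
closed connected solvable normal subgroups. -/
structure IsSemisimple (k : Type*) [Field k] (G : Type*) [Group G] [AffineAlgGroup k G] :
    Prop where
  connected : IsZariskiConnected (coordRing k G) (Set.univ : Set G)
  radical_trivial : ∀ N : Subgroup G, N.Normal → IsZariskiClosed (coordRing k G) (N : Set G) →
    IsZariskiConnected (coordRing k G) (N : Set G) → Group.IsSolvable N → N = ⊥

section Lie

variable {k : Type*} [Field k] {G : Type*} [Group G]

theorem prodCoord_sum {X Y : Type*} {A : Subalgebra k (X → k)} {B : Subalgebra k (Y → k)}
    {F : X × Y → k} (hF : F ∈ prodCoord A B) :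
    ∃ (n : ℕ) (a : Fin n → A) (b : Fin n → B),
      ∀ x y, F (x, y) = ∑ i, (a i : X → k) x * (b i : Y → k) y := by
  rw [prodCoord, ← Subalgebra.mem_toSubmodule, Algebra.adjoin_eq_span] at hF
  obtain ⟨n, c, m, rfl⟩ := Submodule.mem_span_set'.1 hF
  have key : ∀ i, ∃ (a : A) (b : B),
      ∀ x y, (m i : X × Y → k) (x, y) = (a : X → k) x * (b : Y → k) y := by
    intro i
    refine Submonoid.closure_induction
      (motive := fun (M : X × Y → k) _ => ∃ (a : A) (b : B),
        ∀ x y, M (x, y) = (a : X → k) x * (b : Y → k) y) ?_ ?_ ?_ (m i).2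
    · rintro _ (⟨f, hf, rfl⟩ | ⟨f, hf, rfl⟩)
      · exact ⟨⟨f, hf⟩, 1, by simp⟩
      · exact ⟨1, ⟨f, hf⟩, by simp⟩
    · exact ⟨1, 1, by simp⟩
    · rintro M N - - ⟨a, b, h⟩ ⟨a', b', h'⟩
      refine ⟨a * a', b * b', fun x y => ?_⟩
      simp only [Pi.mul_apply, MulMemClass.coe_mul, h, h']
      ring
  choose a b hab using key
  refine ⟨n, fun i => c i • a i, b, fun x y => ?_⟩
  simp [Finset.sum_apply, hab, mul_assoc]

variable [AffineAlgGroup k G]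

theorem mul_sum {f : G → k} (hf : f ∈ coordRing k G) :
    ∃ (n : ℕ) (a b : Fin n → coordRing k G),
      ∀ x y, f (x * y) = ∑ i, (a i : G → k) x * (b i : G → k) y :=
  prodCoord_sum (AffineAlgGroup.mul_regular f hf)

theorem mul_left_mem (h : G) {f : G → k} (hf : f ∈ coordRing k G) :
    (fun x => f (h * x)) ∈ coordRing k G := by
  obtain ⟨n, a, b, hab⟩ := mul_sum hf
  have : (fun x => f (h * x)) = ∑ i, (a i : G → k) h • (b i : G → k) := by
    funext x
    simpa using hab h x
  rw [this]
  exact Subalgebra.sum_mem _ fun i _ => Subalgebra.smul_mem _ (b i).2 _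

theorem mul_right_mem (h : G) {f : G → k} (hf : f ∈ coordRing k G) :
    (fun x => f (x * h)) ∈ coordRing k G := by
  obtain ⟨n, a, b, hab⟩ := mul_sum hf
  have : (fun x => f (x * h)) = ∑ i, (b i : G → k) h • (a i : G → k) := by
    funext x
    simpa [mul_comm] using hab x h
  rw [this]
  exact Subalgebra.sum_mem _ fun i _ => Subalgebra.smul_mem _ (a i).2 _

variable (k)

/-- Left translation on regular functions: `f ↦ (x ↦ f (h x))`. -/
def leftTrans (h : G) : coordRing k G →ₐ[k] coordRing k G where
  toFun f := ⟨fun x => (f : G → k) (h * x), mul_left_mem h f.2⟩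
  map_one' := rfl
  map_mul' _ _ := rfl
  map_zero' := rfl
  map_add' _ _ := rfl
  commutes' _ := rfl

/-- Right translation on regular functions: `f ↦ (x ↦ f (x h))`. -/
def rightTrans (h : G) : coordRing k G →ₐ[k] coordRing k G where
  toFun f := ⟨fun x => (f : G → k) (x * h), mul_right_mem h f.2⟩
  map_one' := rfl
  map_mul' _ _ := rfl
  map_zero' := rfl
  map_add' _ _ := rfl
  commutes' _ := rfl

theorem leftTrans_apply (h : G) (f : coordRing k G) (x : G) :
    (leftTrans k h f : G → k) x = (f : G → k) (h * x) := rfl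

theorem rightTrans_apply (h : G) (f : coordRing k G) (x : G) :
    (rightTrans k h f : G → k) x = (f : G → k) (x * h) := rfl

theorem rightTrans_one (f : coordRing k G) : rightTrans k (1 : G) f = f := by
  ext x; simp [rightTrans_apply]

theorem rightTrans_mul (g h : G) (f : coordRing k G) :
    rightTrans k (g * h) f = rightTrans k g (rightTrans k h f) := by
  ext x; simp [rightTrans_apply, mul_assoc]

theorem rightTrans_inv (g : G) (f : coordRing k G) :
    rightTrans k g (rightTrans k g⁻¹ f) = f := by
  rw [← rightTrans_mul, mul_inv_cancel, rightTrans_one]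

theorem left_right (g h : G) (f : coordRing k G) :
    leftTrans k g (rightTrans k h f) = rightTrans k h (leftTrans k g f) := by
  ext x; simp [rightTrans_apply, leftTrans_apply, mul_assoc]

variable (G)

/-- The Lie subalgebra of those derivations of the coordinate ring that commute with all left
translations. -/
def leftInvDer : LieSubalgebra k (Derivation k (coordRing k G) (coordRing k G)) where
  carrier := {D | ∀ (h : G) (f : coordRing k G), D (leftTrans k h f) = leftTrans k h (D f)}
  add_mem' {D E} hD hE h f := by simp [hD h f, hE h f]
  zero_mem' h f := by simp
  smul_mem' c D hD h f := by simp [hD h f]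
  lie_mem' {D E} hD hE h f := by
    simp [Derivation.commutator_apply, hE h, hD h]

/-- The Lie algebra of `G`: the left-invariant derivations of the coordinate ring. -/
def LieAlg : Type _ := leftInvDer k G

instance : LieRing (LieAlg k G) := inferInstanceAs (LieRing (leftInvDer k G))

instance : LieAlgebra k (LieAlg k G) := inferInstanceAs (LieAlgebra k (leftInvDer k G))

instance : AddCommGroup (LieAlg k G) := LieRing.toAddCommGroup

instance : Module k (LieAlg k G) := LieAlgebra.toModule

/-- The inclusion of the Lie algebra into all derivations. -/
def toDer : LieAlg k G →ₗ⁅k⁆ Derivation k (coordRing k G) (coordRing k G) :=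
  (leftInvDer k G).incl

variable {G}

theorem toDer_left (D : LieAlg k G) (h : G) (f : coordRing k G) :
    toDer k G D (leftTrans k h f) = leftTrans k h (toDer k G D f) :=
  D.2 h f

/-- A left-invariant derivation as an element of the Lie algebra. -/
def ofDer (D : Derivation k (coordRing k G) (coordRing k G))
    (hD : ∀ (h : G) (f : coordRing k G), D (leftTrans k h f) = leftTrans k h (D f)) :
    LieAlg k G :=
  ⟨D, hD⟩

theorem toDer_ofDer (D : Derivation k (coordRing k G) (coordRing k G))
    (hD : ∀ (h : G) (f : coordRing k G), D (leftTrans k h f) = leftTrans k h (D f)) :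
    toDer k G (ofDer k D hD) = D := rfl

theorem lieAlg_ext' {D E : LieAlg k G} (h : ∀ f, toDer k G D f = toDer k G E f) : D = E :=
  Subtype.ext (Derivation.ext h)

/-- The tangent vector at the identity of an element of the Lie algebra: `f ↦ (D f)(1)`. -/
def tangent (D : LieAlg k G) : coordRing k G →ₗ[k] k where
  toFun f := (toDer k G D f : G → k) 1
  map_add' f g := by simp
  map_smul' c f := by simp

theorem tangent_apply (D : LieAlg k G) (f : coordRing k G) :
    tangent k D f = (toDer k G D f : G → k) 1 := rfl

theorem tangent_add (D E : LieAlg k G) (f : coordRing k G) :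
    tangent k (D + E) f = tangent k D f + tangent k E f := by
  simp [tangent_apply]

theorem tangent_smul (c : k) (D : LieAlg k G) (f : coordRing k G) :
    tangent k (c • D) f = c * tangent k D f := by
  simp [tangent_apply]

theorem apply_eq_tangent (D : LieAlg k G) (f : coordRing k G) (g : G) :
    (toDer k G D f : G → k) g = tangent k D (leftTrans k g f) := by
  rw [tangent_apply, toDer_left, leftTrans_apply, mul_one]

theorem lieAlg_ext {D E : LieAlg k G} (h : ∀ f, tangent k D f = tangent k E f) : D = E := by
  apply lieAlg_ext'
  intro f
  ext g
  rw [apply_eq_tangent, apply_eq_tangent, h]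

/-- Finitely many regular functions suffice to distinguish tangent vectors at the identity. -/
theorem exists_coordinates : ∃ (s : Finset (coordRing k G)) (T : LieAlg k G →ₗ[k] (s → k)),
    (∀ D f, T D f = tangent k D f) ∧ Function.Injective T := by
  obtain ⟨t, ht⟩ := (Subalgebra.fg_iff_finiteType _).1 (AffineAlgGroup.fg (k := k) (G := G))
  refine ⟨t, { toFun := fun D f => tangent k D f,
               map_add' := fun D E => funext fun f => tangent_add k D E f,
               map_smul' := fun c D => funext fun f => tangent_smul k c D f },
    fun _ _ => rfl, ?_⟩
  rw [injective_iff_map_eq_zero]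
  intro D hD
  apply lieAlg_ext
  intro f
  have hf : f ∈ Algebra.adjoin k (t : Set (coordRing k G)) := by rw [ht]; trivial
  have h0 : tangent k (0 : LieAlg k G) f = 0 := by simp [tangent_apply]
  rw [h0]
  induction hf using Algebra.adjoin_induction with
  | mem x hx => exact congrFun hD ⟨x, hx⟩
  | algebraMap r => simp [tangent_apply]
  | add x y _ _ hx hy => rw [map_add, hx (by simp [tangent_apply]), hy (by simp [tangent_apply]),
      add_zero]
  | mul x y _ _ hx hy =>
    have hx' : (toDer k G D x : G → k) 1 = 0 := hx (by simp [tangent_apply])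
    have hy' : (toDer k G D y : G → k) 1 = 0 := hy (by simp [tangent_apply])
    simp [tangent_apply, hx', hy']

instance : FiniteDimensional k (LieAlg k G) := by
  obtain ⟨s, T, -, hT⟩ := exists_coordinates k (G := G)
  exact FiniteDimensional.of_injective T hT

/-- The derivation `Ad(g) D = R_g ∘ D ∘ R_g⁻¹`, where `(R_g f)(x) = f (x g)`. -/
def adElem (g : G) (D : LieAlg k G) : LieAlg k G :=
  ofDer k
    (Derivation.mk'
      ((rightTrans k g).toLinearMap ∘ₗ (toDer k G D).toLinearMap ∘ₗ
        (rightTrans k g⁻¹).toLinearMap)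
      (fun a b => by
        change rightTrans k g (toDer k G D (rightTrans k g⁻¹ (a * b))) =
          a * rightTrans k g (toDer k G D (rightTrans k g⁻¹ b)) +
            b * rightTrans k g (toDer k G D (rightTrans k g⁻¹ a))
        rw [map_mul, Derivation.leibniz, map_add, smul_eq_mul, smul_eq_mul, map_mul, map_mul,
          rightTrans_inv, rightTrans_inv]))
    (fun h f => by
      change rightTrans k g (toDer k G D (rightTrans k g⁻¹ (leftTrans k h f))) =
        leftTrans k h (rightTrans k g (toDer k G D (rightTrans k g⁻¹ f)))
      rw [← left_right, toDer_left, ← left_right])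

theorem adElem_apply (g : G) (D : LieAlg k G) (f : coordRing k G) :
    toDer k G (adElem k g D) f = rightTrans k g (toDer k G D (rightTrans k g⁻¹ f)) := rfl

/-- The adjoint representation of `G` on its Lie algebra. -/
def Ad : Representation k G (LieAlg k G) where
  toFun g :=
    { toFun := adElem k g
      map_add' := fun D E => lieAlg_ext' k fun f => by simp [adElem_apply]
      map_smul' := fun c D => lieAlg_ext' k fun f => by simp [adElem_apply] }
  map_one' := LinearMap.ext fun D => lieAlg_ext' k fun f => by
    simp [adElem_apply, rightTrans_one]
  map_mul' g h := LinearMap.ext fun D => lieAlg_ext' k fun f => by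
    simp [adElem_apply, rightTrans_mul]

theorem Ad_apply (g : G) (D : LieAlg k G) (f : coordRing k G) :
    toDer k G (Ad k g D) f = rightTrans k g (toDer k G D (rightTrans k g⁻¹ f)) := rfl

/-- A representation on a finite-dimensional space is regular (a homomorphism of algebraic groups
`G → GL(V)`) if its matrix coefficients are regular functions. -/
def IsRegularRep {V : Type*} [AddCommGroup V] [Module k V] (ρ : Representation k G V) : Prop :=
  ∀ (l : Module.Dual k V) (v : V), (fun g => l (ρ g v)) ∈ coordRing k G

theorem isRegularRep_Ad : IsRegularRep k (Ad k (G := G)) := by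
  classical
  obtain ⟨s, T, hT, hinj⟩ := exists_coordinates k (G := G)
  obtain ⟨S, hS⟩ := LinearMap.exists_leftInverse_of_injective T (LinearMap.ker_eq_bot.2 hinj)
  have hmain : ∀ (f : coordRing k G) (D : LieAlg k G),
      (fun g => tangent k (Ad k g D) f) ∈ coordRing k G := by
    intro f D
    obtain ⟨n, a, b, hab⟩ := mul_sum f.2
    choose m c d hcd using fun i => mul_sum (b i).2
    have h1 : (fun g => tangent k (Ad k g D) f) =
        ∑ i, ∑ j, (tangent k D (c i j)) • ((a i : G → k) * fun g => (d i j : G → k) g⁻¹) := by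
      funext g
      have h2 : tangent k (Ad k g D) f = tangent k D (leftTrans k g (rightTrans k g⁻¹ f)) := by
        rw [← apply_eq_tangent, tangent_apply, Ad_apply, rightTrans_apply, one_mul]
      have h3 : leftTrans k g (rightTrans k g⁻¹ f) =
          ∑ i, ∑ j, ((a i : G → k) g * (d i j : G → k) g⁻¹) • c i j := by
        apply Subtype.ext
        funext x
        rw [leftTrans_apply, rightTrans_apply, mul_assoc, hab]
        simp only [hcd, Finset.mul_sum, AddSubmonoidClass.coe_finsetSum, Finset.sum_apply,
          Subalgebra.coe_smul, Pi.smul_apply, smul_eq_mul]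
        exact Finset.sum_congr rfl fun i _ => Finset.sum_congr rfl fun j _ => by ring
      rw [h2, h3]
      simp only [map_sum, map_smul, Finset.sum_apply, Pi.smul_apply, Pi.mul_apply, smul_eq_mul]
      exact Finset.sum_congr rfl fun i _ => Finset.sum_congr rfl fun j _ => by ring
    rw [h1]
    exact Subalgebra.sum_mem _ fun i _ => Subalgebra.sum_mem _ fun j _ =>
      Subalgebra.smul_mem _ (Subalgebra.mul_mem _ (a i).2
        (AffineAlgGroup.inv_regular _ (d i j).2)) _
  intro l D
  have h1 : (fun g => l (Ad k g D)) =
      ∑ i : s, l (S (Pi.single i 1)) • fun g => tangent k (Ad k g D) (i : coordRing k G) := by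
    funext g
    have h2 : S (T (Ad k g D)) = Ad k g D := LinearMap.congr_fun hS _
    conv_lhs => rw [← h2, ← LinearMap.comp_apply, LinearMap.pi_apply_eq_sum_univ (l ∘ₗ S)]
    simp only [hT, Finset.sum_apply, Pi.smul_apply, smul_eq_mul, LinearMap.comp_apply]
    refine Finset.sum_congr rfl fun i _ => ?_
    rw [mul_comm]
    congr 3
    funext j
    simp [Pi.single_apply, eq_comm]
  rw [h1]
  exact Subalgebra.sum_mem _ fun i _ => Subalgebra.smul_mem _ (hmain _ _) _

theorem IsRegularRep.prod {V W : Type*} [AddCommGroup V] [Module k V] [AddCommGroup W]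
    [Module k W] {ρ : Representation k G V} {σ : Representation k G W}
    (hρ : IsRegularRep k ρ) (hσ : IsRegularRep k σ) : IsRegularRep k (ρ.prod σ) := by
  intro l v
  have : (fun g => l ((ρ.prod σ) g v)) =
      (fun g => (l ∘ₗ LinearMap.inl k V W) (ρ g v.1)) +
        fun g => (l ∘ₗ LinearMap.inr k V W) (σ g v.2) := by
    funext g
    simp [← map_add]
  rw [this]
  exact Subalgebra.add_mem _ (hρ _ _) (hσ _ _)

section Derived

variable {V : Type*} [AddCommGroup V] [Module k V] {ρ : Representation k G V}

/-- The matrix coefficient `g ↦ l (ρ(g) v)`, as a regular function. -/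
def coeff (hρ : IsRegularRep k ρ) (l : Module.Dual k V) (v : V) : coordRing k G :=
  ⟨fun g => l (ρ g v), hρ l v⟩

variable [FiniteDimensional k V]

/-- The underlying linear map of the derived representation; `derivedFun hρ D v` is the vector
with `l (derivedFun hρ D v) = (D c)(1)`, where `c(g) = l (ρ(g) v)`, for all linear forms `l`. -/
def derivedFun (hρ : IsRegularRep k ρ) (D : LieAlg k G) (v : V) : V :=
  (Module.evalEquiv k V).symm
    { toFun := fun l => tangent k D (coeff k hρ l v)
      map_add' := fun l m => by rw [← map_add]; rfl
      map_smul' := fun c l => by rw [RingHom.id_apply, ← map_smul]; rfl }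

theorem dual_derivedFun (hρ : IsRegularRep k ρ) (D : LieAlg k G) (v : V) (l : Module.Dual k V) :
    l (derivedFun k hρ D v) = tangent k D (coeff k hρ l v) := by
  simp [derivedFun]

theorem dual_ext {v w : V} (h : ∀ l : Module.Dual k V, l v = l w) : v = w := by
  rw [← sub_eq_zero, ← Module.forall_dual_apply_eq_zero_iff k]
  intro l; rw [map_sub, h, sub_self]

theorem apply_coeff (hρ : IsRegularRep k ρ) (D : LieAlg k G) (v : V) (l : Module.Dual k V) :
    toDer k G D (coeff k hρ l v) = coeff k hρ l (derivedFun k hρ D v) := by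
  ext g
  have : leftTrans k g (coeff k hρ l v) = coeff k hρ (l ∘ₗ ρ g) v := by
    ext x; simp [leftTrans_apply, coeff]
  rw [apply_eq_tangent, this, ← dual_derivedFun]
  rfl

/-- The derived representation `dρ : Lie(G) → End(V)` of a regular representation `ρ`. -/
def derived (hρ : IsRegularRep k ρ) : LieAlg k G →ₗ⁅k⁆ Module.End k V where
  toFun D :=
    { toFun := derivedFun k hρ D
      map_add' := fun v w => dual_ext k fun l => by
        rw [map_add, dual_derivedFun, dual_derivedFun, dual_derivedFun, ← map_add]
        congr 1
        ext g; simp [coeff]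
      map_smul' := fun c v => dual_ext k fun l => by
        simp only [RingHom.id_apply, map_smul, dual_derivedFun]
        rw [← map_smul]
        congr 1
        ext g; simp [coeff] }
  map_add' D E := LinearMap.ext fun v => dual_ext k fun l => by
    simp only [LinearMap.coe_mk, AddHom.coe_mk, LinearMap.add_apply, map_add, dual_derivedFun,
      tangent_add]
  map_smul' c D := LinearMap.ext fun v => dual_ext k fun l => by
    simp only [LinearMap.coe_mk, AddHom.coe_mk, LinearMap.smul_apply, map_smul, dual_derivedFun,
      tangent_smul, RingHom.id_apply, smul_eq_mul]
  map_lie' {D E} := LinearMap.ext fun v => dual_ext k fun l => by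
    simp only [LinearMap.coe_mk, AddHom.coe_mk, Ring.lie_def, LinearMap.sub_apply,
      Module.End.mul_apply, map_sub, dual_derivedFun]
    rw [← apply_coeff, ← apply_coeff]
    simp only [tangent_apply, LieHom.map_lie,
      Derivation.commutator_apply, AddSubgroupClass.coe_sub, Pi.sub_apply]

end Derived

end Lie

/-! ### Asymmetrical representations of Lie algebras -/

section Asymmetrical

variable {k : Type*} [Field k] {L : Type*} [LieRing L] [LieAlgebra k L]

/-- The exponential of a nilpotent endomorphism (a finite sum). -/
def nilExp {V : Type*} [AddCommGroup V] [Module k V] (f : Module.End k V) : Module.End k V :=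
  ∑ n ∈ Finset.range (nilpotencyClass f), ((n.factorial : k)⁻¹) • f ^ n

/-- An automorphism of a semisimple Lie algebra (over an algebraically closed field of
characteristic zero) is inner if it is a product of exponentials `exp (ad x)` with `ad x`
nilpotent. -/
def IsInnerAut (α : L ≃ₗ⁅k⁆ L) : Prop :=
  (α : L →ₗ[k] L) ∈ Submonoid.closure
    {φ : Module.End k L | ∃ x : L, IsNilpotent (LieAlgebra.ad k L x) ∧
      φ = nilExp (LieAlgebra.ad k L x)}

/-- `ρ` is asymmetrical if for every non-inner automorphism `α` there is a sub-representation `W`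
of `ρ` that is not equivalent to its twist by `α`. -/
def IsAsymmetrical {V : Type*} [AddCommGroup V] [Module k V] (ρ : L →ₗ⁅k⁆ Module.End k V) : Prop :=
  ∀ α : L ≃ₗ⁅k⁆ L, ¬ IsInnerAut α →
    ∃ (W : Submodule k V) (hW : ∀ x, ∀ w ∈ W, ρ x w ∈ W),
      ¬ ∃ φ : W ≃ₗ[k] W, ∀ (x : L) (w : W),
        φ ⟨ρ x w, hW x w w.2⟩ = ⟨ρ (α x) (φ w), hW (α x) (φ w) (φ w).2⟩

end Asymmetrical

/-! ### The stabilizer of the three algebras -/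

section Stabilizer

variable (k : Type*) [Field k] {G₀ : Type*} [Group G₀] [AffineAlgGroup k G₀]
variable (U : Type*) [AddCommGroup U] [Module k U]
variable {U₀ : Type*} [AddCommGroup U₀] [Module k U₀]

/-- The representation `ρ₀' = ρ₀ ⊕ Ad` on `U₀' = U₀ ⊕ 𝔤₀`. -/
def rho0' (ρ₀ : Representation k G₀ U₀) : Representation k G₀ (U₀ × LieAlg k G₀) :=
  ρ₀.prod (Ad k)

/-- The representation on `U' = U ⊕ 𝔤₀`, where `G₀` acts trivially on `U`. -/
def rhoU' : Representation k G₀ (U × LieAlg k G₀) :=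
  (Representation.trivial k G₀ U).prod (Ad k)

/-- The derived representation of `ρ₀'`. -/
def rho0'der [FiniteDimensional k U₀] {ρ₀ : Representation k G₀ U₀} (hρ₀ : IsRegularRep k ρ₀) :
    LieAlg k G₀ →ₗ⁅k⁆ Module.End k (U₀ × LieAlg k G₀) :=
  derived k (ρ := rho0' k ρ₀) (hρ₀.prod k (isRegularRep_Ad k))

/-- The endomorphism `a` of `U ⊗ U' ⊗ U₀'`,
`x₁ ⊗ (x + x') ⊗ (x₀ + x₀') ↦ x₁ ⊗ (x₀' ⊗ x' + e ⊗ dρ₀'(x') (x₀ + x₀'))`. -/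
def endoA [FiniteDimensional k U₀] {ρ₀ : Representation k G₀ U₀} (hρ₀ : IsRegularRep k ρ₀)
    (e : U) :
    Module.End k (U ⊗[k] ((U × LieAlg k G₀) ⊗[k] (U₀ × LieAlg k G₀))) :=
  LinearMap.lTensor U <| TensorProduct.lift <|
    LinearMap.mk₂ k
      (fun (u : U × LieAlg k G₀) (v : U₀ × LieAlg k G₀) =>
        ((0, v.2) : U × LieAlg k G₀) ⊗ₜ[k] ((0, u.2) : U₀ × LieAlg k G₀) +
          ((e, 0) : U × LieAlg k G₀) ⊗ₜ[k] rho0'der k hρ₀ u.2 v)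
      (fun u₁ u₂ v => by
        have : ((0, u₁.2 + u₂.2) : U₀ × LieAlg k G₀) = (0, u₁.2) + (0, u₂.2) := by simp
        simp only [Prod.snd_add, this, map_add, LinearMap.add_apply, TensorProduct.tmul_add]
        abel)
      (fun c u v => by
        have : ((0, c • u.2) : U₀ × LieAlg k G₀) = c • (0, u.2) := by simp
        simp only [Prod.smul_snd, this, map_smul, LinearMap.smul_apply, TensorProduct.tmul_smul,
          smul_add])
      (fun u v₁ v₂ => by
        have : ((0, v₁.2 + v₂.2) : U × LieAlg k G₀) = (0, v₁.2) + (0, v₂.2) := by simp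
        simp only [Prod.snd_add, this, map_add, TensorProduct.tmul_add, TensorProduct.add_tmul]
        abel)
      (fun c u v => by
        have : ((0, c • v.2) : U × LieAlg k G₀) = c • (0, v.2) := by simp
        simp only [Prod.smul_snd, this, map_smul, TensorProduct.tmul_smul, smul_add,
          TensorProduct.smul_tmul'])

/-- The endomorphism `a'` of `U' = U ⊕ 𝔤₀`, `x + x' ↦ x`. -/
def endoA' : Module.End k (U × LieAlg k G₀) :=
  LinearMap.inl k U (LieAlg k G₀) ∘ₗ LinearMap.fst k U (LieAlg k G₀)

/-- The algebra `End_G(V)` of endomorphisms of a representation. -/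
def endAlg {G V : Type*} [Group G] [AddCommGroup V] [Module k V] (ρ : Representation k G V) :
    Subalgebra k (Module.End k V) :=
  Subalgebra.centralizer k (Set.range ρ)

variable (G₀ U₀) in
/-- The ambient group `GL(U) × GL(U') × GL(U₀')`. -/
abbrev Ambient : Type _ :=
  LinearMap.GeneralLinearGroup k U × LinearMap.GeneralLinearGroup k (U × LieAlg k G₀) ×
    LinearMap.GeneralLinearGroup k (U₀ × LieAlg k G₀)

variable (G₀ U₀) in
/-- Regular functions on `GL(U) × GL(U') × GL(U₀')`. -/
def ambientCoord : Subalgebra k (Ambient k G₀ U U₀ → k) :=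
  prodCoord (glCoord k U) (prodCoord (glCoord k (U × LieAlg k G₀)) (glCoord k (U₀ × LieAlg k G₀)))

variable (G₀ U₀) in
/-- The action of `GL(U) × GL(U') × GL(U₀')` on `U ⊗ U' ⊗ U₀'`. -/
def tensorAct (g : Ambient k G₀ U U₀) :
    Module.End k (U ⊗[k] ((U × LieAlg k G₀) ⊗[k] (U₀ × LieAlg k G₀))) :=
  TensorProduct.map g.1.1 (TensorProduct.map g.2.1.1 g.2.2.1)

theorem tensorAct_one : tensorAct k G₀ U U₀ 1 = 1 := by
  simp only [tensorAct, Prod.fst_one, Prod.snd_one, Units.val_one, TensorProduct.map_one]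

theorem tensorAct_mul (g h : Ambient k G₀ U U₀) :
    tensorAct k G₀ U U₀ (g * h) = tensorAct k G₀ U U₀ g * tensorAct k G₀ U U₀ h := by
  simp [tensorAct, TensorProduct.map_mul]

/-- `G⁰`: the (pointwise) stabilizer of `k[a]`, `k[a']` and `End_{G₀}(U₀')`, that is, the group of
all triples `(g, g', g₀')` such that `g ⊗ g' ⊗ g₀'` commutes with `k[a]`, `g'` commutes with
`k[a']`, and `g₀'` commutes with `End_{G₀}(U₀')`. -/
def stab [FiniteDimensional k U₀] {ρ₀ : Representation k G₀ U₀} (hρ₀ : IsRegularRep k ρ₀)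
    (e : U) : Subgroup (Ambient k G₀ U U₀) where
  carrier := {g |
    (∀ b ∈ Algebra.adjoin k {endoA k U hρ₀ e}, Commute (tensorAct k G₀ U U₀ g) b) ∧
    (∀ b ∈ Algebra.adjoin k {endoA' k (G₀ := G₀) U}, Commute g.2.1.1 b) ∧
    (∀ b ∈ endAlg k (rho0' k ρ₀), Commute g.2.2.1 b)}
  one_mem' := by
    refine ⟨fun b _ => ?_, fun b _ => ?_, fun b _ => ?_⟩
    · rw [tensorAct_one]; exact Commute.one_left b
    · exact Commute.one_left b
    · exact Commute.one_left b
  mul_mem' {g h} hg hh := by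
    refine ⟨fun b hb => ?_, fun b hb => ?_, fun b hb => ?_⟩
    · rw [tensorAct_mul]; exact (hg.1 b hb).mul_left (hh.1 b hb)
    · exact (hg.2.1 b hb).mul_left (hh.2.1 b hb)
    · exact (hg.2.2 b hb).mul_left (hh.2.2 b hb)
  inv_mem' {g} hg := by
    refine ⟨fun b hb => ?_, fun b hb => ?_, fun b hb => ?_⟩
    · let u : (Module.End k (U ⊗[k] ((U × LieAlg k G₀) ⊗[k] (U₀ × LieAlg k G₀))))ˣ :=
        ⟨tensorAct k G₀ U U₀ g, tensorAct k G₀ U U₀ g⁻¹,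
          by rw [← tensorAct_mul, mul_inv_cancel, tensorAct_one],
          by rw [← tensorAct_mul, inv_mul_cancel, tensorAct_one]⟩
      have hu : Commute (u : Module.End k _) b := hg.1 b hb
      exact hu.units_inv_left
    · exact (hg.2.1 b hb).units_inv_left
    · exact (hg.2.2 b hb).units_inv_left

/-- The homomorphism `G₀ → GL(U) × GL(U') × GL(U₀')` given by the three representations. -/
def embed (ρ₀ : Representation k G₀ U₀) : G₀ →* Ambient k G₀ U U₀ :=
  (Representation.trivial k G₀ U).toHomUnits.prod
    ((rhoU' k U).toHomUnits.prod (rho0' k ρ₀).toHomUnits)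

/-- `T⁰`: the center of `G⁰`, as a subgroup of the ambient group. -/
def T0 [FiniteDimensional k U₀] {ρ₀ : Representation k G₀ U₀} (hρ₀ : IsRegularRep k ρ₀)
    (e : U) : Subgroup (Ambient k G₀ U U₀) :=
  (Subgroup.center (stab k U hρ₀ e)).map (stab k U hρ₀ e).subtype

/-- `T₀'`: the center of `End_{G₀}(U₀')ˣ`, as a subgroup of `GL(U₀')`. -/
def T0' (ρ₀ : Representation k G₀ U₀) :
    Subgroup (LinearMap.GeneralLinearGroup k (U₀ × LieAlg k G₀)) :=
  (Subgroup.center (endAlg k (rho0' k ρ₀))ˣ).map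
    (Units.map (endAlg k (rho0' k ρ₀)).val.toMonoidHom)

/-- `T'`: the subgroup of those elements of `T₀'` that act on `𝔤₀` by a scalar. -/
def T' (ρ₀ : Representation k G₀ U₀) :
    Subgroup (LinearMap.GeneralLinearGroup k (U₀ × LieAlg k G₀)) :=
  T0' k ρ₀ ⊓
    { carrier := {t | ∃ c : kˣ, ∀ x : LieAlg k G₀, t.1 (0, x) = (c : k) • (0, x)}
      one_mem' := ⟨1, fun x => by simp⟩
      mul_mem' := by
        rintro s t ⟨c, hc⟩ ⟨d, hd⟩
        refine ⟨d * c, fun x => ?_⟩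
        change s.1 (t.1 (0, x)) = _
        rw [hd, map_smul, hc, smul_smul, Units.val_mul]
      inv_mem' := by
        rintro t ⟨c, hc⟩
        refine ⟨c⁻¹, fun x => ?_⟩
        have h : (t⁻¹).1 (t.1 (0, x)) = (0, x) := by
          change ((t⁻¹ * t : LinearMap.GeneralLinearGroup k (U₀ × LieAlg k G₀)).1) (0, x) = (0, x)
          rw [inv_mul_cancel]; rfl
        rw [hc, map_smul] at h
        conv_rhs => rw [← h]
        rw [smul_smul, Units.inv_mul, one_smul] }

/-- The group of scalars `𝔾ₘ` in `GL(V)`. -/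
def scalars (V : Type*) [AddCommGroup V] [Module k V] :
    Subgroup (LinearMap.GeneralLinearGroup k V) :=
  (Units.map (algebraMap k (Module.End k V)).toMonoidHom).range

/-- The number of isotypic components of a representation. -/
def numIsotypic {G V : Type*} [Group G] [AddCommGroup V] [Module k V]
    (ρ : Representation k G V) : ℕ :=
  (isotypicComponents (MonoidAlgebra k G) ρ.asModule).ncard

/-- The number of simple factors (simple ideals) of a semisimple Lie algebra. -/
def numSimpleFactors (L : Type*) [LieRing L] [LieAlgebra k L] : ℕ :=
  {I : LieIdeal k L | LieAlgebra.IsSimple k I}.ncard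

end Stabilizer

end

end AlgGrp

/-!
Evaluating on pure tensors shows that an element of `G⁰` has the form `(b, c ⊕ γ, t)`, where `b`
and `c` are scalars, `t` commutes with `End_{G₀}(U₀')`, and `c t ρ₀'ᵈᵉʳ(x) = ρ₀'ᵈᵉʳ(γ x) t`. So
`c⁻¹ γ` is an automorphism of the Lie algebra `𝔤₀`, and `t` intertwines `ρ₀'ᵈᵉʳ` with its twist by
`c⁻¹ γ`. By complete reducibility every subrepresentation of `U₀'` is the image of a projection in
`End_{G₀}(U₀')`, hence is preserved by `t` and equivalent to its twist. Asymmetry makes `c⁻¹ γ`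
inner, so it is `Ad h` for some `h` in `G₀`. Then `t ρ₀'(h)⁻¹` commutes with `𝔤₀`, hence with
`G₀`, and lies in the center of `End_{G₀}(U₀')`.

This center consists of the endomorphisms that are scalar on each isotypic component. The simple
ideals of `𝔤₀` are pairwise inequivalent, so exactly as many components as there are simple
factors meet `𝔤₀`, and `T'` is cut out by the condition that the scalars on these components
agree.

The passage from `𝔤₀` to `G₀` uses formal one-parameter subgroups: for `D` in `𝔤₀`, the
homomorphism `f ↦ ∑ tⁿ / n! (Dⁿ f)(1)` is a point of `G₀` over `k⟦t⟧`. If it satisfies the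
equations of a closed subset of `G₀` and `D ≠ 0`, then `1` is not an isolated point of that
subset; this rules out abelian ideals in `𝔤₀`. If `ad D` is nilpotent, then so is the action of
`D` on every finite-dimensional representation, the sum is finite, and setting `t = 1` gives a
point of `G₀` acting on `𝔤₀` as `exp(ad D)`.
-/

namespace AlgGrp

noncomputable section

attribute [local instance 100] LieRing.ofAssociativeRing

/-! ### Complete reducibility for Lie algebras with trivial radical -/

section Weyl

open LieModule

variable {k L : Type*} [Field k] [LieRing L] [LieAlgebra k L]

section Perfect

variable [CharZero k] [FiniteDimensional k L] [LieAlgebra.HasTrivialRadical k L]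

theorem lie_top_top_eq_top : ⁅(⊤ : LieIdeal k L), (⊤ : LieIdeal k L)⁆ = ⊤ := by
  set I : LieIdeal k L := ⁅(⊤ : LieIdeal k L), (⊤ : LieIdeal k L)⁆
  have hcompl := LieIdeal.isCompl_killingCompl I
  have habelian : IsLieAbelian (I.killingCompl k L) := by
    rw [LieSubmodule.lie_abelian_iff_lie_self_eq_bot, ← le_bot_iff, ← hcompl.inf_eq_bot]
    exact le_inf (LieSubmodule.mono_lie le_top le_top) (LieSubmodule.lie_le_right _ _)
  have hbot : I.killingCompl k L = ⊥ := LieAlgebra.HasTrivialRadical.eq_bot_of_isSolvable _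
  rw [hbot] at hcompl
  exact codisjoint_bot.1 hcompl.codisjoint

theorem eq_top_of_forall_lie_mem {p : Submodule k L} (h : ∀ x y : L, ⁅x, y⁆ ∈ p) :
    p = ⊤ := by
  rw [eq_top_iff, ← LieSubmodule.top_toSubmodule (R := k) (L := L), ← lie_top_top_eq_top,
    LieSubmodule.lieIdeal_oper_eq_linear_span', Submodule.span_le]
  rintro _ ⟨x, -, y, -, rfl⟩
  exact h x y

end Perfect

variable {M : Type*} [AddCommGroup M] [Module k M] [LieRingModule L M] [LieModule k L M]

variable (k M) in
/-- The Casimir operator `∑ bᵢ b'ᵢ` on `M` of two families of elements of `L`. It is of interest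
when the families are bases of an ideal that are dual for an invariant form. -/
def casimir {ι : Type*} [Fintype ι] (b b' : ι → L) : Module.End k M :=
  ∑ i, toEnd k L M (b i) * toEnd k L M (b' i)

theorem casimir_apply {ι : Type*} [Fintype ι] (b b' : ι → L) (m : M) :
    casimir k M b b' m = ∑ i, ⁅b i, ⁅b' i, m⁆⁆ := by
  simp [casimir, LinearMap.sum_apply]

theorem casimir_mem {ι : Type*} [Fintype ι] (b b' : ι → L) {N : LieSubmodule k L M} {m : M}
    (hm : ∀ x : L, ⁅x, m⁆ ∈ N) : casimir k M b b' m ∈ N := by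
  rw [casimir_apply]
  exact Submodule.sum_mem _ fun i _ => N.lie_mem (hm _)

theorem sum_apply_smul_of_dual {ι : Type*} [Fintype ι] [DecidableEq ι] {J : Submodule k L}
    {B : LinearMap.BilinForm k L} {b b' : Module.Basis ι k J}
    (hbb : ∀ i j, B (b i) (b' j) = if i = j then 1 else 0) {y : L} (hy : y ∈ J) :
    ∑ j, B y (b' j) • (b j : L) = y := by
  have hsum : ∑ i, b.repr ⟨y, hy⟩ i • (b i : L) = y := by
    simpa only [map_sum, map_smul, Submodule.subtype_apply] using
      congrArg J.subtype (b.sum_repr ⟨y, hy⟩)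
  have hrepr (j : ι) : B y (b' j) = b.repr ⟨y, hy⟩ j := by
    conv_lhs => rw [← hsum]
    simp [hbb]
  simpa only [hrepr] using hsum

theorem lie_casimir {ι : Type*} [Fintype ι] [DecidableEq ι] {J : LieIdeal k L}
    {B : LinearMap.BilinForm k L} (hB : B.lieInvariant L) {b b' : Module.Basis ι k J}
    (hbb : ∀ i j, B (b i) (b' j) = if i = j then 1 else 0) (x : L) (m : M) :
    ⁅x, casimir k M (fun i => (b i : L)) (fun i => (b' i : L)) m⁆ =
      casimir k M (fun i => (b i : L)) (fun i => (b' i : L)) ⁅x, m⁆ := by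
  have lie_b (i : ι) : ⁅x, (b i : L)⁆ = ∑ j, B ⁅x, (b i : L)⁆ (b' j) • (b j : L) :=
    (sum_apply_smul_of_dual hbb (J.lie_mem (b i).2)).symm
  have lie_b' (i : ι) : ⁅x, (b' i : L)⁆ = -∑ j, B ⁅x, (b j : L)⁆ (b' i) • (b' j : L) := by
    have hflip (i j : ι) : LinearMap.BilinForm.flip B (b' i) (b j) = if i = j then 1 else 0 := by
      simp only [LinearMap.BilinForm.flip_apply, hbb, eq_comm]
    rw [← sum_apply_smul_of_dual hflip (J.lie_mem (b' i).2), ← Finset.sum_neg_distrib]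
    simp only [LinearMap.BilinForm.flip_apply, hB x, neg_smul, neg_neg]
  have leibniz (i : ι) : ⁅x, ⁅(b i : L), ⁅(b' i : L), m⁆⁆⁆ =
      (∑ j, B ⁅x, (b i : L)⁆ (b' j) • ⁅(b j : L), ⁅(b' i : L), m⁆⁆ -
        ∑ j, B ⁅x, (b j : L)⁆ (b' i) • ⁅(b i : L), ⁅(b' j : L), m⁆⁆) +
      ⁅(b i : L), ⁅(b' i : L), ⁅x, m⁆⁆⁆ := by
    have hleft := congrArg (⁅·, ⁅(b' i : L), m⁆⁆) (lie_b i)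
    have hright := congrArg (⁅(b i : L), ⁅·, m⁆⁆) (lie_b' i)
    simp only [sum_lie, lie_sum, smul_lie, lie_smul, neg_lie, lie_neg] at hleft hright
    rw [leibniz_lie x (b i : L), leibniz_lie x (b' i : L), lie_add, hleft, hright, ← add_assoc,
      sub_eq_add_neg]
  simp only [casimir_apply, lie_sum, leibniz, Finset.sum_add_distrib, Finset.sum_sub_distrib]
  rw [Finset.sum_comm, sub_self, zero_add]

theorem trace_casimir {ι : Type*} [Fintype ι] [DecidableEq ι] {b b' : ι → L}
    (hbb : ∀ i j, traceForm k L M (b i) (b' j) = if i = j then 1 else 0) :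
    LinearMap.trace k M (casimir k M b b') = Fintype.card ι := by
  have htrace (i : ι) : LinearMap.trace k M (toEnd k L M (b i) * toEnd k L M (b' i)) = 1 :=
    (hbb i i).trans (if_pos rfl)
  simp [casimir, htrace]

/-- The invariants `M^J` of an ideal `J`, as a submodule over all of `L`. -/
def idealInvariants (J : LieIdeal k L) (M : Type*) [AddCommGroup M] [Module k M]
    [LieRingModule L M] [LieModule k L M] : LieSubmodule k L M where
  __ := (maxTrivSubmodule k J M).toSubmodule
  lie_mem {y m} hm x := by
    change ⁅(x : L), ⁅y, m⁆⁆ = 0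
    have hxm : ⁅(x : L), m⁆ = 0 := hm x
    have hxym : ⁅⁅(x : L), y⁆, m⁆ = 0 := hm ⟨_, lie_mem_left k L J x y x.2⟩
    rw [leibniz_lie, hxym, hxm, lie_zero, add_zero]

omit [LieAlgebra k L] [LieModule k L M] in
theorem isIrreducible_of_isAtom {N : LieSubmodule k L M} (hN : IsAtom N) :
    LieModule.IsIrreducible k L N := by
  have : Nontrivial N := (LieSubmodule.nontrivial_iff_ne_bot k L M).2 hN.1
  refine LieModule.IsIrreducible.mk fun K hK => ?_
  by_contra htop
  have hlt : K.map N.incl < N := LieSubmodule.map_incl_lt_iff_lt_top.2 (lt_top_iff_ne_top.2 htop)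
  refine hK (eq_bot_iff.2 fun n hn => ?_)
  have hn0 : (n : M) ∈ (⊥ : LieSubmodule k L M) := hN.2 _ hlt ▸ LieSubmodule.mem_map_of_mem hn
  exact (LieSubmodule.mem_bot _).2 (Subtype.ext ((LieSubmodule.mem_bot _).1 hn0))

variable [CharZero k] [FiniteDimensional k L]

theorem exists_traceForm_ne_zero [FiniteDimensional k M] [LieModule.IsIrreducible k L M]
    (J : LieIdeal k L) [LieAlgebra.HasTrivialRadical k J] (hM : ¬ IsTrivial J M) :
    ∃ x ∈ J, ∃ y ∈ J, traceForm k L M x y ≠ 0 := by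
  by_contra! hzero
  have htrace : traceForm k J M = 0 := by
    ext ⟨x, hx⟩ ⟨y, hy⟩
    exact hzero x hx y hy
  have hnilpotent : LieModule.IsNilpotent J M := by
    have := isNilpotent_derivedSeries_of_traceForm_eq_zero htrace
    rw [isNilpotent_iff_forall' (R := k)] at this ⊢
    have hperfect : LieAlgebra.derivedSeries k J 1 = ⊤ := lie_top_top_eq_top
    exact fun x => this ⟨x, hperfect ▸ LieSubmodule.mem_top x⟩
  have : Nontrivial M := nontrivial_of_isIrreducible k L M
  have hinvariants : Nontrivial (idealInvariants J M) :=
    nontrivial_max_triv_of_isNilpotent k J M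
  have htop := LieSubmodule.eq_top_of_isIrreducible k L M (idealInvariants J M)
  exact hM ⟨fun x m => (htop ▸ LieSubmodule.mem_top m : m ∈ idealInvariants J M) x⟩

theorem restrict_traceForm_nondegenerate [FiniteDimensional k M] [LieModule.IsIrreducible k L M]
    {J : LieIdeal k L} [LieAlgebra.HasTrivialRadical k J] (hJ : IsAtom J) (hM : ¬ IsTrivial J M) :
    ((traceForm k L M).restrict J.toSubmodule).Nondegenerate := by
  obtain ⟨x, hx, y, hy, hxy⟩ := exists_traceForm_ne_zero (k := k) J hM
  have hinv := traceForm_lieInvariant k L M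
  rw [LinearMap.BilinForm.restrict_nondegenerate_iff_isCompl_orthogonal
      (traceForm_isSymm k L M).isRefl,
    LinearMap.BilinForm.isCompl_orthogonal_iff_disjoint (traceForm_isSymm k L M).isRefl,
    ← LieAlgebra.InvariantForm.orthogonal_toSubmodule _ hinv, LieSubmodule.disjoint_toSubmodule]
  refine hJ.not_le_iff_disjoint.1 fun hle => hxy ?_
  exact (LieAlgebra.InvariantForm.mem_orthogonal _ hinv J y).1 (hle hy) x hx

variable [FiniteDimensional k M] [LieAlgebra.HasTrivialRadical k L]

omit [FiniteDimensional k M] in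
theorem exists_isAtom_not_isTrivial (hM : ¬ IsTrivial L M) :
    ∃ J : LieIdeal k L, IsAtom J ∧ ¬ IsTrivial J M := by
  by_contra! htrivial
  have hker : LieModule.ker k L M = ⊤ := by
    rw [eq_top_iff, ← LieAlgebra.IsSemisimple.sSup_atoms_eq_top (R := k) (L := L)]
    refine sSup_le fun J hJ x hx => (LieModule.mem_ker k L M (x := x)).2 fun m => ?_
    exact (htrivial J hJ).trivial ⟨x, hx⟩ m
  exact hM ⟨fun x => (LieModule.mem_ker k L M (x := x)).1 (hker ▸ LieSubmodule.mem_top x)⟩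

theorem exists_casimir_injOn {N : LieSubmodule k L M} (hN : IsAtom N) (hne : ¬ IsTrivial L N) :
    ∃ c : M →ₗ⁅k,L⁆ M, (∀ m, (∀ x : L, ⁅x, m⁆ ∈ N) → c m ∈ N) ∧ ∀ n ∈ N, c n = 0 → n = 0 := by
  classical
  have := isIrreducible_of_isAtom hN
  obtain ⟨J, hJ, hJN⟩ := exists_isAtom_not_isTrivial (k := k) hne
  have := LieAlgebra.IsSemisimple.isSimple_of_isAtom J hJ
  have hnondeg := restrict_traceForm_nondegenerate hJ hJN
  let b' := Module.finBasis k J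
  let B := (traceForm k L N).restrict J.toSubmodule
  let b := B.dualBasis hnondeg b'
  have hdual (i j) : traceForm k L N (b i) (b' j) = if i = j then 1 else 0 := by
    simp only [← B.apply_dualBasis_left hnondeg b' i j, eq_comm (a := i)]
    rfl
  let c : M →ₗ⁅k,L⁆ M :=
    { casimir k M (fun i => (b i : L)) (fun i => (b' i : L)) with
      map_lie' := fun {x m} => (lie_casimir (traceForm_lieInvariant k L N) hdual x m).symm }
  refine ⟨c, fun m hm => casimir_mem _ _ hm, ?_⟩
  suffices hker : Disjoint N c.ker from fun n hn hcn =>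
    (LieSubmodule.mem_bot n).1 (hker.le_bot ⟨hn, hcn⟩)
  refine hN.not_le_iff_disjoint.1 fun hle => ?_
  have hzero : casimir k N (fun i => (b i : L)) (fun i => (b' i : L)) = 0 := by
    ext n
    have hcn : casimir k M (fun i => (b i : L)) (fun i => (b' i : L)) n = 0 := hle n.2
    rw [casimir_apply] at hcn
    simpa [casimir_apply] using hcn
  have htrace := trace_casimir hdual
  have : Nontrivial J := (LieSubmodule.nontrivial_iff_ne_bot k L L).2 hJ.1
  rw [hzero, map_zero, Fintype.card_fin, eq_comm, Nat.cast_eq_zero] at htrace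
  exact (Module.finrank_pos (R := k) (M := J)).ne' htrace

theorem exists_mem_forall_lie_sub_eq_zero_of_isAtom {N : LieSubmodule k L M} (hN : IsAtom N)
    {m : M} (hm : ∀ x : L, ⁅x, m⁆ ∈ N) : ∃ n ∈ N, ∀ x : L, ⁅x, m - n⁆ = 0 := by
  by_cases htrivial : IsTrivial L N
  · have hlie (x : L) {n : M} (hn : n ∈ N) : ⁅x, n⁆ = 0 :=
      congrArg Subtype.val (htrivial.trivial x ⟨n, hn⟩)
    have hker : LinearMap.ker ((toEnd k L M : L →ₗ[k] Module.End k M).flip m) = ⊤ :=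
      eq_top_of_forall_lie_mem fun x y => by
        change ⁅⁅x, y⁆, m⁆ = 0
        rw [lie_lie, hlie _ (hm y), hlie _ (hm x), sub_zero]
    refine ⟨0, N.zero_mem, fun x => ?_⟩
    rw [sub_zero]
    exact hker.ge (Submodule.mem_top (x := x))
  · obtain ⟨c, hcN, hinj⟩ := exists_casimir_injOn hN htrivial
    have hmaps : ∀ n ∈ N.toSubmodule, (c : M →ₗ[k] M) n ∈ N.toSubmodule :=
      fun n hn => hcN n fun x => N.lie_mem hn
    have hsurj : Function.Surjective ((c : M →ₗ[k] M).restrict hmaps) := by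
      rw [← LinearMap.injective_iff_surjective, injective_iff_map_eq_zero]
      exact fun n hn => Subtype.ext (hinj n n.2 (congrArg Subtype.val hn))
    obtain ⟨⟨n, hn⟩, hnm⟩ := hsurj ⟨c m, hcN m hm⟩
    have hcnm : c n = c m := congrArg Subtype.val hnm
    refine ⟨n, hn, fun x => hinj _ ?_ ?_⟩
    · rw [lie_sub]
      exact N.sub_mem (hm x) (N.lie_mem hn)
    · rw [LieModuleHom.map_lie, map_sub, hcnm, sub_self, lie_zero]

/- This is the vanishing of the first cohomology. An irreducible `N` is handled by a Casimir
operator; in general one first solves the problem in the quotient by an irreducible submodule. -/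
theorem exists_mem_forall_lie_sub_eq_zero (N : LieSubmodule k L M) (m : M)
    (hm : ∀ x : L, ⁅x, m⁆ ∈ N) : ∃ n ∈ N, ∀ x : L, ⁅x, m - n⁆ = 0 := by
  induction hd : Module.finrank k M using Nat.strong_induction_on generalizing M with
  | _ d ih =>
    subst hd
    obtain rfl | ⟨A, hA, hAN⟩ := eq_bot_or_exists_atom_le N
    · exact ⟨0, LieSubmodule.zero_mem _, fun x => by simpa using hm x⟩
    let q := LieSubmodule.Quotient.mk' A
    have hdim : Module.finrank k (M ⧸ A) < Module.finrank k M := by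
      have : Nontrivial A := (LieSubmodule.nontrivial_iff_ne_bot k L M).2 hA.1
      have := Submodule.finrank_quotient_add_finrank A.toSubmodule
      have := Module.finrank_pos (R := k) (M := A)
      change Module.finrank k (M ⧸ A.toSubmodule) < _
      change 0 < Module.finrank k A.toSubmodule at this
      omega
    obtain ⟨_, ⟨n, hn, rfl⟩, hqn⟩ := ih _ hdim (N.map q) (q m)
      (fun x => ⟨⁅x, m⁆, hm x, LieModuleHom.map_lie q x m⟩) rfl
    have hmn (x : L) : ⁅x, m - n⁆ ∈ A := by
      rw [← LieSubmodule.Quotient.mk_eq_zero (N := A)]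
      change q ⁅x, m - n⁆ = 0
      rw [LieModuleHom.map_lie, map_sub]
      exact hqn x
    obtain ⟨a, ha, h⟩ := exists_mem_forall_lie_sub_eq_zero_of_isAtom hA hmn
    exact ⟨n + a, N.add_mem hn (hAN ha), fun x => by rw [← sub_sub, h x]⟩

/-- The linear maps from `M` into `W` that vanish on `W`. Two projections onto `W` differ by
such a map. -/
def homsIntoVanishing (W : LieSubmodule k L M) : LieSubmodule k L (M →ₗ[k] M) where
  carrier := {f | (∀ m, f m ∈ W) ∧ ∀ w ∈ W, f w = 0}
  add_mem' hf hg := ⟨fun m => W.add_mem (hf.1 m) (hg.1 m), fun w hw => by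
    rw [LinearMap.add_apply, hf.2 w hw, hg.2 w hw, add_zero]⟩
  zero_mem' := ⟨fun _ => W.zero_mem, fun _ _ => rfl⟩
  smul_mem' r f hf := ⟨fun m => W.smul_mem r (hf.1 m), fun w hw => by
    rw [LinearMap.smul_apply, hf.2 w hw, smul_zero]⟩
  lie_mem {x f} hf :=
    ⟨fun m => by
      rw [LieHom.lie_apply]
      exact W.sub_mem (W.lie_mem (hf.1 m)) (hf.1 _),
    fun w hw => by
      rw [LieHom.lie_apply, hf.2 w hw, hf.2 _ (W.lie_mem hw), lie_zero, sub_zero]⟩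

theorem exists_lieModuleHom_projection (W : LieSubmodule k L M) :
    ∃ p : M →ₗ⁅k,L⁆ M, (∀ m, p m ∈ W) ∧ ∀ w ∈ W, p w = w := by
  obtain ⟨C, hC⟩ := Submodule.exists_isCompl W.toSubmodule
  let P : M →ₗ[k] M := W.toSubmodule.subtype ∘ₗ W.toSubmodule.projectionOnto C hC
  have hPmem (m : M) : P m ∈ W := (W.toSubmodule.projectionOnto C hC m).2
  have hPid : ∀ w ∈ W, P w = w := fun w hw =>
    congrArg Subtype.val (Submodule.projectionOnto_apply_left hC ⟨w, hw⟩)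
  obtain ⟨f, hf, hinv⟩ := exists_mem_forall_lie_sub_eq_zero (homsIntoVanishing W) P fun x => by
    refine ⟨fun m => ?_, fun w hw => ?_⟩
    · rw [LieHom.lie_apply]
      exact W.sub_mem (W.lie_mem (hPmem m)) (hPmem _)
    · rw [LieHom.lie_apply, hPid w hw, hPid _ (W.lie_mem hw), sub_self]
  refine ⟨{ P - f with map_lie' := fun {x m} => ?_ },
    fun m => W.sub_mem (hPmem m) (hf.1 m), fun w hw => ?_⟩
  · have hxm := LinearMap.congr_fun (hinv x) m
    rw [LieHom.lie_apply, LinearMap.zero_apply, sub_eq_zero] at hxm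
    exact hxm.symm
  · change P w - f w = w
    rw [hPid w hw, hf.2 w hw, sub_zero]

omit [FiniteDimensional k M] in
theorem trace_toEnd_eq_zero (x : L) : LinearMap.trace k M (toEnd k L M x) = 0 := by
  have hker : LinearMap.ker
      (LinearMap.trace k M ∘ₗ (toEnd k L M : L →ₗ[k] Module.End k M)) = ⊤ :=
    eq_top_of_forall_lie_mem fun x y => by simp
  exact hker.ge (Submodule.mem_top (x := x))

/- The generalized eigenspace is a submodule on which `x` has trace `0`, but this trace is also
`μ` times the dimension. -/
theorem maxGenEigenspace_toEnd_eq_bot {x : L} (hx : IsNilpotent (LieAlgebra.ad k L x)) {μ : k}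
    (hμ : μ ≠ 0) : (toEnd k L M x).maxGenEigenspace μ = ⊥ := by
  have hnull (y : L) : y ∈ (toEnd k L L x).maxGenEigenspace 0 := by
    obtain ⟨n, hn⟩ := hx
    rw [Module.End.mem_maxGenEigenspace]
    refine ⟨n, ?_⟩
    rw [zero_smul, sub_zero]
    exact LinearMap.congr_fun hn y
  let W : LieSubmodule k L M :=
    { (toEnd k L M x).maxGenEigenspace μ with
      lie_mem := fun {y m} hm => by
        have hlie := lie_mem_maxGenEigenspace_toEnd (hnull y) hm
        rwa [zero_add] at hlie }
  have hnilpotent : IsNilpotent (toEnd k L W x - algebraMap k (Module.End k W) μ) :=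
    Module.End.isNilpotent_restrict_maxGenEigenspace_sub_algebraMap (toEnd k L M x) μ
  have htrace := (LinearMap.isNilpotent_trace_of_isNilpotent hnilpotent).eq_zero
  rw [map_sub, trace_toEnd_eq_zero, zero_sub, neg_eq_zero, Algebra.algebraMap_eq_smul_one,
    map_smul, LinearMap.trace_one, smul_eq_mul, mul_eq_zero, Nat.cast_eq_zero] at htrace
  exact Submodule.finrank_eq_zero.1 (htrace.resolve_left hμ)

theorem isNilpotent_toEnd_of_isNilpotent_ad [IsAlgClosed k] {x : L}
    (hx : IsNilpotent (LieAlgebra.ad k L x)) : IsNilpotent (toEnd k L M x) := by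
  have htop : (toEnd k L M x).maxGenEigenspace 0 = ⊤ := by
    rw [eq_top_iff, ← Module.End.iSup_maxGenEigenspace_eq_top (toEnd k L M x)]
    refine iSup_le fun μ => ?_
    obtain rfl | hμ := eq_or_ne μ 0
    · exact le_rfl
    · exact (maxGenEigenspace_toEnd_eq_bot hx hμ).le.trans bot_le
  refine ⟨Module.finrank k M, LinearMap.ext fun m => ?_⟩
  have hm : m ∈ (toEnd k L M x).maxGenEigenspace 0 := htop ▸ Submodule.mem_top
  rwa [Module.End.maxGenEigenspace_eq_genEigenspace_finrank, Module.End.mem_genEigenspace_nat,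
    zero_smul, sub_zero] at hm

end Weyl

section LieHom

variable {k L V : Type*} [Field k] [CharZero k] [LieRing L] [LieAlgebra k L]
  [FiniteDimensional k L] [LieAlgebra.HasTrivialRadical k L] [AddCommGroup V] [Module k V]
  [FiniteDimensional k V]

theorem isNilpotent_of_isNilpotent_ad [IsAlgClosed k] (ρ : L →ₗ⁅k⁆ Module.End k V) {x : L}
    (hx : IsNilpotent (LieAlgebra.ad k L x)) : IsNilpotent (ρ x) := by
  let _ : LieRingModule L V := LieRingModule.compLieHom V ρ
  have : LieModule k L V := LieModule.compLieHom V ρ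
  exact isNilpotent_toEnd_of_isNilpotent_ad (M := V) hx

theorem exists_commute_projection (ρ : L →ₗ⁅k⁆ Module.End k V) (W : Submodule k V)
    (hW : ∀ x, ∀ w ∈ W, ρ x w ∈ W) :
    ∃ p : Module.End k V, (∀ x, Commute p (ρ x)) ∧ (∀ v, p v ∈ W) ∧ ∀ w ∈ W, p w = w := by
  let _ : LieRingModule L V := LieRingModule.compLieHom V ρ
  have : LieModule k L V := LieModule.compLieHom V ρ
  obtain ⟨p, hmem, hid⟩ := exists_lieModuleHom_projection (k := k) (L := L) (M := V)
    { W with lie_mem := fun {x w} hw => hW x w hw }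
  exact ⟨p, fun x => LinearMap.ext fun v => p.map_lie x v, hmem, hid⟩

end LieHom

/-! ### The Zariski topology -/

section Zariski

variable {k : Type*} [Field k] {X Y : Type*}

theorem isOpen_nonvanishing (A : Subalgebra k (X → k)) {f : X → k} (hf : f ∈ A) :
    @IsOpen X (zariski A) {x | f x ≠ 0} :=
  TopologicalSpace.isOpen_generateFrom_of_mem ⟨f, hf, rfl⟩

theorem isZariskiClosed_zeroLocus (A : Subalgebra k (X → k)) {S : Set (X → k)}
    (hS : ∀ f ∈ S, f ∈ A) : IsZariskiClosed A {x | ∀ f ∈ S, f x = 0} := by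
  let _ := zariski A
  have hinter : {x | ∀ f ∈ S, f x = 0} = ⋂ f ∈ S, {x | f x ≠ 0}ᶜ := by
    ext x
    simp only [Set.mem_ofPred_eq, Set.mem_iInter, Set.mem_compl_iff, not_not]
  change IsClosed _
  rw [hinter]
  exact isClosed_biInter fun f hf => (isOpen_nonvanishing A (hS f hf)).isClosed_compl

theorem IsRegularMap.continuous {A : Subalgebra k (X → k)} {B : Subalgebra k (Y → k)} {φ : X → Y}
    (h : IsRegularMap A B φ) : @Continuous X Y (zariski A) (zariski B) φ := by
  let _ := zariski A
  rw [continuous_generateFrom_iff]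
  rintro _ ⟨f, hf, rfl⟩
  exact isOpen_nonvanishing A (h f hf)

theorem isTopologicalBasis_zariski (A : Subalgebra k (X → k)) :
    @TopologicalSpace.IsTopologicalBasis X (zariski A) {U | ∃ f ∈ A, U = {x | f x ≠ 0}} := by
  let _ := zariski A
  refine ⟨?_, ?_, rfl⟩
  · rintro _ ⟨f, hf, rfl⟩ _ ⟨g, hg, rfl⟩ x ⟨hfx, hgx⟩
    refine ⟨{x | (f * g) x ≠ 0}, ⟨f * g, A.mul_mem hf hg, rfl⟩, mul_ne_zero hfx hgx, fun y hy => ?_⟩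
    exact ⟨left_ne_zero_of_mul hy, right_ne_zero_of_mul hy⟩
  · rw [Set.sUnion_eq_univ_iff]
    exact fun x => ⟨_, ⟨1, A.one_mem, rfl⟩, one_ne_zero⟩

end Zariski

/-! ### Formal exponentials of derivations -/

section FormalExp

theorem iterate_derivation_mul {R A : Type*} [CommRing R] [CommRing A] [Algebra R A]
    (D : Derivation R A A) (n : ℕ) (a b : A) :
    D^[n] (a * b) =
      ∑ ij ∈ Finset.HasAntidiagonal.antidiagonal n,
        n.choose ij.1 • (D^[ij.1] a * D^[ij.2] b) := by
  induction n with
  | zero => simp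
  | succ n ih =>
    rw [Finset.sum_antidiagonal_choose_succ_nsmul (M := A) (fun i j => D^[i] a * D^[j] b) n]
    simp only [Function.iterate_succ_apply', ih, map_sum, map_nsmul, Derivation.leibniz, smul_add,
      Finset.sum_add_distrib, smul_eq_mul]
    congr 1
    refine Finset.sum_congr rfl fun ⟨i, j⟩ hij => ?_
    rw [n.choose_symm_of_eq_add (Finset.HasAntidiagonal.mem_antidiagonal.1 hij).symm, mul_comm]

theorem inv_factorial_add_mul_choose {k : Type*} [Field k] [CharZero k] (i j : ℕ) :
    ((i + j).factorial : k)⁻¹ * (i + j).choose i = (i.factorial : k)⁻¹ * (j.factorial : k)⁻¹ := by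
  have hne (n : ℕ) : (n.factorial : k) ≠ 0 := Nat.cast_ne_zero.2 n.factorial_ne_zero
  rw [Nat.cast_add_choose, div_eq_mul_inv, inv_mul_cancel_left₀ (hne _), mul_inv]

variable {k A : Type*} [Field k] [CharZero k] [CommRing A] [Algebra k A]

/-- The homomorphism `exp(tD)` followed by a character `χ`, that is, `f ↦ ∑ tⁿ / n! χ (Dⁿ f)`.
For a left-invariant vector field on a group and the evaluation at the identity it is the Taylor
expansion along the formal one-parameter subgroup. -/
def formalExp (D : Derivation k A A) (χ : A →ₐ[k] k) : A →ₐ[k] PowerSeries k where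
  toFun f := PowerSeries.mk fun n => (n.factorial : k)⁻¹ * χ (D^[n] f)
  map_one' := by
    ext (_ | n)
    · simp
    · simp [Function.iterate_succ_apply, iterate_map_zero]
  map_mul' f g := by
    ext n
    simp only [PowerSeries.coeff_mk, PowerSeries.coeff_mul, iterate_derivation_mul, map_sum,
      map_nsmul, map_mul, Finset.mul_sum]
    refine Finset.sum_congr rfl fun ⟨i, j⟩ hij => ?_
    obtain rfl : i + j = n := Finset.HasAntidiagonal.mem_antidiagonal.1 hij
    rw [nsmul_eq_mul, ← mul_assoc, inv_factorial_add_mul_choose]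
    ring
  map_zero' := by
    ext n
    simp [iterate_map_zero]
  map_add' f g := by
    ext n
    simp [iterate_map_add, mul_add]
  commutes' c := by
    ext (_ | n)
    · simp
    · simp [Function.iterate_succ_apply, iterate_map_zero]

theorem coeff_formalExp (D : Derivation k A A) (χ : A →ₐ[k] k) (f : A) (n : ℕ) :
    PowerSeries.coeff n (formalExp D χ f) = (n.factorial : k)⁻¹ * χ (D^[n] f) :=
  PowerSeries.coeff_mk (R := k) n fun n => (n.factorial : k)⁻¹ * χ (D^[n] f)

theorem constantCoeff_formalExp (D : Derivation k A A) (χ : A →ₐ[k] k) (f : A) :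
    PowerSeries.constantCoeff (formalExp D χ f) = χ f := by
  simpa using coeff_formalExp D χ f 0

end FormalExp

section Nullstellensatz

variable {k A : Type*} [Field k] [IsAlgClosed k] [CommRing A] [Algebra k A]
  [Algebra.FiniteType k A]

theorem exists_algHom_ker_eq (m : Ideal A) [m.IsMaximal] :
    ∃ χ : A →ₐ[k] k, ∀ f, χ f = 0 ↔ f ∈ m := by
  let _ := Ideal.Quotient.field m
  have : Module.Finite k (A ⧸ m) := finite_of_finite_type_of_isJacobsonRing k _
  let e : k ≃ₐ[k] (A ⧸ m) := AlgEquiv.ofBijective (Algebra.ofId k _)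
    IsAlgClosed.algebraMap_bijective_of_isIntegral
  refine ⟨(e.symm : (A ⧸ m) →ₐ[k] k).comp (Ideal.Quotient.mkₐ k m), fun f => ?_⟩
  change e.symm (Ideal.Quotient.mk m f) = 0 ↔ _
  rw [EmbeddingLike.map_eq_zero_iff, Ideal.Quotient.eq_zero_iff_mem]

variable (k) in
theorem exists_algHom_of_notMem {I : Ideal A} (hI : I.IsRadical) {f : A} (hf : f ∉ I) :
    ∃ χ : A →ₐ[k] k, (∀ s ∈ I, χ s = 0) ∧ χ f ≠ 0 := by
  have : IsJacobsonRing A := isJacobsonRing_of_finiteType (A := k)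
  rw [← this.out hI, Ideal.jacobson, Submodule.mem_sInf] at hf
  push Not at hf
  obtain ⟨m, ⟨hIm, hm⟩, hfm⟩ := hf
  obtain ⟨χ, hχ⟩ := exists_algHom_ker_eq (k := k) m
  exact ⟨χ, fun s hs => (hχ s).2 (hIm hs), fun h => hfm ((hχ f).1 h)⟩

end Nullstellensatz

/-! ### The tangent space at the identity -/

section Tangent

variable {k : Type*} [Field k] {G : Type*} [Group G] [AffineAlgGroup k G]

instance : Algebra.FiniteType k (coordRing k G) :=
  (Subalgebra.fg_iff_finiteType _).1 AffineAlgGroup.fg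

instance : IsNoetherianRing (coordRing k G) :=
  Algebra.FiniteType.isNoetherianRing k _

variable (k G) in
/-- Evaluation of regular functions at the identity: the counit of the Hopf algebra `k[G]`. -/
def evalOne : coordRing k G →ₐ[k] k :=
  (Pi.evalAlgHom k (fun _ : G => k) 1).comp (coordRing k G).val

theorem evalOne_apply (f : coordRing k G) : evalOne k G f = (f : G → k) 1 := rfl

variable (k G) in
/-- The antipode `f ↦ (x ↦ f x⁻¹)` of the Hopf algebra `k[G]`. -/
def antipode : coordRing k G →ₐ[k] coordRing k G where
  toFun f := ⟨fun x => (f : G → k) x⁻¹, AffineAlgGroup.inv_regular _ f.2⟩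
  map_one' := rfl
  map_mul' _ _ := rfl
  map_zero' := rfl
  map_add' _ _ := rfl
  commutes' _ := rfl

theorem antipode_apply (f : coordRing k G) (x : G) :
    (antipode k G f : G → k) x = (f : G → k) x⁻¹ := rfl

variable (k G) in
/-- The differential at the identity of regular functions, paired with the Lie algebra. -/
def diffOne : coordRing k G →ₗ[k] Module.Dual k (LieAlg k G) :=
  LinearMap.mk₂ k (fun f D => tangent k D f) (fun f g D => map_add (tangent k D) f g)
    (fun c f D => map_smul (tangent k D) c f) (fun f D E => tangent_add k D E f)
    (fun c f D => tangent_smul k c D f)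

theorem diffOne_apply (f : coordRing k G) (D : LieAlg k G) : diffOne k G f D = tangent k D f := rfl

theorem tangent_mul (D : LieAlg k G) (f g : coordRing k G) :
    tangent k D (f * g) = (f : G → k) 1 * tangent k D g + (g : G → k) 1 * tangent k D f := by
  simp only [tangent_apply, Derivation.leibniz, smul_eq_mul, AddMemClass.coe_add, Pi.add_apply,
    MulMemClass.coe_mul, Pi.mul_apply]

theorem tangent_algebraMap (D : LieAlg k G) (c : k) : tangent k D (algebraMap k _ c) = 0 := by
  simp only [tangent_apply, Derivation.map_algebraMap, ZeroMemClass.coe_zero, Pi.zero_apply]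

theorem tangent_lie (D E : LieAlg k G) (f : coordRing k G) :
    tangent k ⁅D, E⁆ f = tangent k D (toDer k G E f) - tangent k E (toDer k G D f) := by
  simp only [tangent_apply, LieHom.map_lie, Derivation.commutator_apply,
    AddSubgroupClass.coe_sub, Pi.sub_apply]

section Comultiplication

/- `∑ aᵢ ⊗ bᵢ` is the comultiplication of `f`. -/
variable {n : ℕ} {f : coordRing k G} {a b : Fin n → coordRing k G}
  (hab : ∀ x y, (f : G → k) (x * y) = ∑ i, (a i : G → k) x * (b i : G → k) y)

include hab

theorem leftTrans_eq_sum (g : G) : leftTrans k g f = ∑ i, (a i : G → k) g • b i := by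
  ext x
  rw [leftTrans_apply, hab]
  simp

theorem rightTrans_eq_sum (g : G) : rightTrans k g f = ∑ i, (b i : G → k) g • a i := by
  ext x
  rw [rightTrans_apply, hab]
  simp [mul_comm]

theorem toDer_eq_sum (D : LieAlg k G) : toDer k G D f = ∑ i, tangent k D (b i) • a i := by
  ext g
  rw [apply_eq_tangent, leftTrans_eq_sum hab, map_sum]
  simp [mul_comm]

theorem coeff_Ad_diffOne (E : LieAlg k G) :
    coeff k (isRegularRep_Ad k) (diffOne k G f) E =
      ∑ i, antipode k G (b i) * toDer k G E (a i) := by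
  ext g
  change tangent k (Ad k g E) f = _
  rw [tangent_apply, Ad_apply, rightTrans_apply, one_mul, rightTrans_eq_sum hab]
  simp [antipode_apply]

end Comultiplication

theorem tangent_antipode (D : LieAlg k G) (f : coordRing k G) :
    tangent k D (antipode k G f) = -tangent k D f := by
  obtain ⟨n, a, b, hab⟩ := mul_sum f.2
  have hconst : ∑ i, a i * antipode k G (b i) = algebraMap k _ ((f : G → k) 1) := by
    ext g
    have hg := hab g g⁻¹
    rw [mul_inv_cancel] at hg
    simpa [antipode_apply] using hg.symm
  have hleft : f = ∑ i, (a i : G → k) 1 • b i := by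
    rw [← leftTrans_eq_sum hab]
    ext x
    rw [leftTrans_apply, one_mul]
  have hright : f = ∑ i, (b i : G → k) 1 • a i := by
    rw [← rightTrans_eq_sum hab, rightTrans_one]
  have htangent := congrArg (tangent k D) hconst
  simp only [map_sum, tangent_mul, antipode_apply, inv_one, Finset.sum_add_distrib,
    tangent_algebraMap] at htangent
  refine eq_neg_of_add_eq_zero_left ?_
  conv_lhs => rw [hleft, map_sum, map_sum, ← hleft, hright, map_sum]
  simpa only [map_smul, smul_eq_mul] using htangent

theorem derived_Ad (D E : LieAlg k G) : derived k (isRegularRep_Ad k) D E = ⁅D, E⁆ := by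
  refine lieAlg_ext k fun f => ?_
  obtain ⟨n, a, b, hab⟩ := mul_sum f.2
  have hright : toDer k G E f = ∑ i, (b i : G → k) 1 • toDer k G E (a i) := by
    conv_lhs => rw [← rightTrans_one k f, rightTrans_eq_sum hab, map_sum]
    simp only [Derivation.map_smul]
  have hderived : tangent k (derived k (isRegularRep_Ad k) D E) f =
      tangent k D (coeff k (isRegularRep_Ad k) (diffOne k G f) E) :=
    dual_derivedFun k _ D E (diffOne k G f)
  rw [hderived, coeff_Ad_diffOne hab, tangent_lie, hright, toDer_eq_sum hab D]
  simp only [map_sum, tangent_mul, tangent_antipode, antipode_apply, inv_one, map_smul,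
    smul_eq_mul, ← tangent_apply, ← Finset.sum_sub_distrib]
  exact Finset.sum_congr rfl fun i _ => by ring

variable {V : Type*} [AddCommGroup V] [Module k V] {ρ : Representation k G V}

theorem coeff_apply (hρ : IsRegularRep k ρ) (l : Module.Dual k V) (v : V) (g : G) :
    (coeff k hρ l v : G → k) g = l (ρ g v) := rfl

theorem iterate_toDer_coeff [FiniteDimensional k V] (hρ : IsRegularRep k ρ) (D : LieAlg k G)
    (l : Module.Dual k V) (v : V) (n : ℕ) :
    (toDer k G D)^[n] (coeff k hρ l v) = coeff k hρ l ((derived k hρ D ^ n) v) := by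
  induction n with
  | zero => rfl
  | succ n ih =>
    rw [Function.iterate_succ_apply', ih, apply_coeff, pow_succ']
    rfl

/- By the Nullstellensatz, a formal one-parameter subgroup that satisfies the equations `S`
satisfies every equation that holds on their zero locus. -/
theorem formalExp_eq_zero [CharZero k] [IsAlgClosed k]
    {D : Derivation k (coordRing k G) (coordRing k G)} {χ : coordRing k G →ₐ[k] k}
    {S : Set (coordRing k G)} (hS : ∀ s ∈ S, formalExp D χ s = 0) {f : coordRing k G}
    (hf : ∀ g : G, (∀ s ∈ S, (s : G → k) g = 0) → (f : G → k) g = 0) : formalExp D χ f = 0 := by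
  by_contra hne
  have hprime : (RingHom.ker (formalExp D χ)).IsPrime := RingHom.ker_isPrime _
  obtain ⟨ψ, hψ, hψf⟩ := exists_algHom_of_notMem k hprime.isRadical hne
  obtain ⟨g, hg⟩ := AffineAlgGroup.exists_point ψ
  exact hψf ((hg f).trans (hf g fun s hs => (hg s).symm.trans (hψ s (hS s hs))))

end Tangent

theorem mem_ker_sq_of_forall_pointDerivation {k A : Type*} [Field k] [CommRing A] [Algebra k A]
    (χ : A →ₐ[k] k) {f : A} (hf : χ f = 0)
    (h : ∀ δ : A →ₗ[k] k, (∀ a b, δ (a * b) = χ a * δ b + χ b * δ a) → δ f = 0) :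
    f ∈ RingHom.ker χ ^ 2 := by
  by_contra hne
  let p : Submodule k A := (RingHom.ker χ ^ 2).restrictScalars k ⊔ (k ∙ (1 : A))
  have hfp : f ∉ p := by
    intro hfp
    obtain ⟨s, hs, _, hc, rfl⟩ := Submodule.mem_sup.1 hfp
    obtain ⟨c, rfl⟩ := Submodule.mem_span_singleton.1 hc
    have hχs : χ s = 0 := Ideal.pow_le_self two_ne_zero hs
    have hc0 : c = 0 := by simpa [hχs] using hf
    rw [hc0, zero_smul, add_zero] at hne
    exact hne hs
  obtain ⟨δ, hδf, hδ⟩ := Submodule.exists_le_ker_of_notMem hfp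
  have hδone : δ 1 = 0 := hδ (Submodule.mem_sup_right (Submodule.mem_span_singleton_self 1))
  have hsub (a : A) : a - algebraMap k A (χ a) ∈ RingHom.ker χ := by simp [RingHom.mem_ker]
  refine hδf (h δ fun a b => ?_)
  have hprod : δ ((a - algebraMap k A (χ a)) * (b - algebraMap k A (χ b))) = 0 :=
    hδ (Submodule.mem_sup_left (by
      rw [Submodule.restrictScalars_mem, sq]
      exact Ideal.mul_mem_mul (hsub a) (hsub b)))
  have hexpand : (a - algebraMap k A (χ a)) * (b - algebraMap k A (χ b)) =
      a * b - χ a • b - χ b • a + (χ a * χ b) • 1 := by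
    simp only [Algebra.smul_def, map_mul]
    ring
  rw [hexpand] at hprod
  simp only [map_add, map_sub, map_smul, hδone, smul_eq_mul, mul_zero, add_zero] at hprod
  linear_combination hprod

/-! ### Ideals stable under the Lie algebra -/

section Euler

/- `E` acts on `𝔪ⁿ / 𝔪ⁿ⁺¹` as an Euler vector field, namely by multiplication by the degree. -/
theorem sub_nsmul_mem_pow_of_sub_mem_sq {R A : Type*} [CommRing R] [CommRing A] [Algebra R A]
    {E : Derivation R A A} {m : Ideal A} (hE : ∀ f ∈ m, E f - f ∈ m ^ 2) (n : ℕ) {f : A}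
    (hf : f ∈ m ^ (n + 1)) : E f - (n + 1) • f ∈ m ^ (n + 2) := by
  induction n generalizing f with
  | zero =>
    rw [zero_add, pow_one] at hf
    simpa only [zero_add, one_smul] using hE f hf
  | succ n ih =>
    rw [pow_succ'] at hf
    induction hf using Submodule.mul_induction_on' with
    | mem_mul_mem a ha b hb =>
      have hleibniz : E (a * b) - (n + 1 + 1) • (a * b) =
          a * (E b - (n + 1) • b) + b * (E a - a) := by
        rw [Derivation.leibniz, smul_eq_mul, smul_eq_mul, nsmul_eq_mul, nsmul_eq_mul]
        push_cast
        ring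
      rw [hleibniz]
      refine Ideal.add_mem _ ?_ ?_
      · rw [show n + 1 + 2 = n + 2 + 1 by ring, pow_succ']
        exact Ideal.mul_mem_mul ha (ih hb)
      · rw [pow_add]
        exact Ideal.mul_mem_mul hb (hE a ha)
    | add a _ b _ ha hb =>
      rw [map_add, smul_add, add_sub_add_comm]
      exact Ideal.add_mem _ ha hb

theorem derivation_sum_apply {R A ι : Type*} [CommRing R] [CommRing A] [Algebra R A] (s : Finset ι)
    (D : ι → Derivation R A A) (f : A) : (∑ i ∈ s, D i) f = ∑ i ∈ s, D i f := by
  rw [← Derivation.coeFnAddMonoidHom_apply, map_sum, Finset.sum_apply]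
  rfl

theorem le_pow_of_derivation_mem {k A ι : Type*} [Field k] [CharZero k] [CommRing A] [Algebra k A]
    [Fintype ι] {m I : Ideal A} {x : ι → A} {D : ι → Derivation k A A} (hx : ∀ i, x i ∈ m)
    (hE : ∀ f ∈ m, (∑ i, x i • D i) f - f ∈ m ^ 2) (hIm : I ≤ m)
    (hD : ∀ i, ∀ f ∈ I, D i f ∈ I) (n : ℕ) : I ≤ m ^ (n + 1) := by
  induction n with
  | zero => rwa [zero_add, pow_one]
  | succ n ih =>
    intro f hf
    have heuler := sub_nsmul_mem_pow_of_sub_mem_sq hE n (ih hf)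
    have hEf : (∑ i, x i • D i) f ∈ m ^ (n + 2) := by
      rw [derivation_sum_apply]
      refine Ideal.sum_mem _ fun i _ => ?_
      rw [Derivation.smul_apply, smul_eq_mul, pow_succ']
      exact Ideal.mul_mem_mul (hx i) (ih (hD i f hf))
    have hsmul : (n + 1) • f ∈ m ^ (n + 2) := by
      simpa only [sub_sub_cancel] using Ideal.sub_mem _ hEf heuler
    have hcast : ((n + 1 : ℕ) : k) ≠ 0 := Nat.cast_ne_zero.2 n.succ_ne_zero
    have hf_eq : f = ((n + 1 : ℕ) : k)⁻¹ • (n + 1) • f := by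
      rw [← Nat.cast_smul_eq_nsmul k (n + 1) f, inv_smul_smul₀ hcast]
    rw [hf_eq]
    exact Submodule.smul_of_tower_mem _ _ hsmul

theorem exists_sub_one_mem_and_mul_eq_zero_of_forall_le_pow {A : Type*} [CommRing A]
    [IsNoetherianRing A] {m I : Ideal A} (h : ∀ n, I ≤ m ^ n) :
    ∃ u, u - 1 ∈ m ∧ ∀ f ∈ I, u * f = 0 := by
  have hle : I ≤ m • I := by
    intro f hf
    have hmem : f ∈ (⨅ n : ℕ, m ^ n • ⊤ : Submodule A A) := by
      simpa only [Submodule.mem_iInf, smul_eq_mul, Ideal.mul_top] using fun n => h n hf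
    obtain ⟨a, ha⟩ := (Ideal.mem_iInf_smul_pow_eq_bot_iff m f).1 hmem
    rw [← ha]
    exact Submodule.smul_mem_smul a.2 hf
  exact Submodule.exists_sub_one_mem_and_smul_eq_zero_of_fg_of_le_smul m I
    (IsNoetherian.noetherian I) hle

variable {k : Type*} [Field k] {G : Type*} [Group G] [AffineAlgGroup k G]

variable (k G) in
/-- The maximal ideal of the identity element. -/
def idealOne : Ideal (coordRing k G) := RingHom.ker (evalOne k G)

theorem mem_idealOne {f : coordRing k G} : f ∈ idealOne k G ↔ (f : G → k) 1 = 0 := Iff.rfl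

theorem sub_algebraMap_mem_idealOne (f : coordRing k G) :
    f - algebraMap k _ ((f : G → k) 1) ∈ idealOne k G := by
  simp [mem_idealOne]

theorem exists_tangent_eq {δ : coordRing k G →ₗ[k] k}
    (hδ : ∀ f g : coordRing k G, δ (f * g) = (f : G → k) 1 * δ g + (g : G → k) 1 * δ f) :
    ∃ D : LieAlg k G, tangent k D = δ := by
  have hmem (f : coordRing k G) : (fun g => δ (leftTrans k g f)) ∈ coordRing k G := by
    obtain ⟨n, a, b, hab⟩ := mul_sum f.2
    have hsum : (fun g => δ (leftTrans k g f)) = ∑ i, δ (b i) • (a i : G → k) := by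
      funext g
      rw [leftTrans_eq_sum hab, map_sum]
      simp [mul_comm]
    rw [hsum]
    exact Subalgebra.sum_mem _ fun i _ => Subalgebra.smul_mem _ (a i).2 _
  let D : Derivation k (coordRing k G) (coordRing k G) := Derivation.mk'
    { toFun := fun f => ⟨fun g => δ (leftTrans k g f), hmem f⟩
      map_add' := fun f g => by ext x; simp
      map_smul' := fun c f => by ext x; simp } (fun f g => by
        ext x
        simp [hδ, leftTrans_apply])
  have hD (f : coordRing k G) (x : G) : (D f : G → k) x = δ (leftTrans k x f) := rfl
  have hinv (h : G) (f : coordRing k G) : D (leftTrans k h f) = leftTrans k h (D f) := by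
    ext x
    rw [leftTrans_apply, hD, hD]
    congr 1
    ext y
    simp only [leftTrans_apply, mul_assoc]
  refine ⟨ofDer k D hinv, LinearMap.ext fun f => ?_⟩
  rw [tangent_apply, toDer_ofDer, hD]
  congr 1
  ext y
  rw [leftTrans_apply, one_mul]

theorem mem_idealOne_sq {f : coordRing k G} (hf : f ∈ idealOne k G) (h : diffOne k G f = 0) :
    f ∈ idealOne k G ^ 2 := by
  refine mem_ker_sq_of_forall_pointDerivation (evalOne k G) hf fun δ hδ => ?_
  obtain ⟨D, rfl⟩ := exists_tangent_eq hδ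
  exact LinearMap.congr_fun h D

theorem diffOne_surjective : Function.Surjective (diffOne k G) := by
  refine (LinearMap.flip_surjective_iff₁ (B := (diffOne k G).flip)).2 fun D E h => ?_
  exact lieAlg_ext k fun f => LinearMap.congr_fun h f

theorem diffOne_algebraMap (c : k) : diffOne k G (algebraMap k _ c) = 0 :=
  LinearMap.ext fun D => tangent_algebraMap D c

/- The `x i` are local coordinates at the identity, dual to a basis of the Lie algebra. -/
variable (k G) in
theorem exists_euler : ∃ (r : ℕ) (x : Fin r → coordRing k G) (D : Fin r → LieAlg k G),
    (∀ i, x i ∈ idealOne k G) ∧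
      ∀ f ∈ idealOne k G, (∑ i, x i • toDer k G (D i)) f - f ∈ idealOne k G ^ 2 := by
  let D := Module.finBasis k (LieAlg k G)
  choose y hy using fun i => diffOne_surjective (D.coord i)
  let x (i) := y i - algebraMap k _ ((y i : G → k) 1)
  have hx (i) : x i ∈ idealOne k G := sub_algebraMap_mem_idealOne (y i)
  have hdx (i) : diffOne k G (x i) = D.coord i := by
    rw [map_sub, diffOne_algebraMap, sub_zero, hy]
  refine ⟨_, x, D, hx, fun f hf => ?_⟩
  have hlinear : f - ∑ i, tangent k (D i) f • x i ∈ idealOne k G ^ 2 := by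
    refine mem_idealOne_sq (Ideal.sub_mem _ hf (Ideal.sum_mem _ fun i _ => ?_)) ?_
    · exact Submodule.smul_of_tower_mem _ _ (hx i)
    · refine D.ext fun j => ?_
      simp [hdx, diffOne_apply, Finsupp.single_apply]
  have hfield : (∑ i, x i • toDer k G (D i)) f - ∑ i, tangent k (D i) f • x i ∈
      idealOne k G ^ 2 := by
    rw [derivation_sum_apply, ← Finset.sum_sub_distrib]
    refine Ideal.sum_mem _ fun i _ => ?_
    have hfactor : (x i • toDer k G (D i)) f - tangent k (D i) f • x i =
        x i * (toDer k G (D i) f - algebraMap k _ ((toDer k G (D i) f : G → k) 1)) := by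
      rw [Derivation.smul_apply, smul_eq_mul, tangent_apply, Algebra.smul_def]
      ring
    rw [hfactor, sq]
    exact Ideal.mul_mem_mul (hx i) (sub_algebraMap_mem_idealOne _)
  simpa only [sub_sub_sub_cancel_right] using Ideal.sub_mem _ hfield hlinear

theorem exists_annihilator_of_toDer_mem [CharZero k] {I : Ideal (coordRing k G)}
    (hI : I ≤ idealOne k G) (hD : ∀ (D : LieAlg k G), ∀ f ∈ I, toDer k G D f ∈ I) :
    ∃ u : coordRing k G, (u : G → k) 1 = 1 ∧ ∀ f ∈ I, u * f = 0 := by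
  obtain ⟨r, x, D, hx, hE⟩ := exists_euler k G
  have hpow (n : ℕ) : I ≤ idealOne k G ^ n :=
    (le_pow_of_derivation_mem hx hE hI (fun i => hD (D i)) n).trans
      (Ideal.pow_le_pow_right n.le_succ)
  obtain ⟨u, hu, huI⟩ := exists_sub_one_mem_and_mul_eq_zero_of_forall_le_pow hpow
  exact ⟨u, sub_eq_zero.1 (mem_idealOne.1 hu), huI⟩

end Euler

/-! ### Connected groups and their derived representations -/

theorem derivation_mem_span {R A : Type*} [CommRing R] [CommRing A] [Algebra R A]
    (D : Derivation R A A) {S : Set A} (hS : ∀ f ∈ S, D f ∈ Ideal.span S) {f : A}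
    (hf : f ∈ Ideal.span S) : D f ∈ Ideal.span S := by
  induction hf using Submodule.span_induction with
  | mem f hf => exact hS f hf
  | zero => rw [map_zero]; exact Ideal.zero_mem _
  | add f g _ _ hf hg => rw [map_add]; exact Ideal.add_mem _ hf hg
  | smul c f hf hDf =>
    rw [smul_eq_mul, Derivation.leibniz]
    exact Ideal.add_mem _ (Ideal.mul_mem_left _ _ hDf) (Ideal.mul_mem_right _ _ hf)

section Connected

variable {k : Type*} [Field k] {G : Type*} [Group G] [AffineAlgGroup k G]

theorem isRegularMap_mul_left (h : G) : IsRegularMap (coordRing k G) (coordRing k G) (h * ·) :=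
  fun _ hf => mul_left_mem h hf

theorem isRegularMap_conj (h : G) :
    IsRegularMap (coordRing k G) (coordRing k G) (fun g => h * g * h⁻¹) :=
  fun _ hf => mul_left_mem h (mul_right_mem h⁻¹ hf)

theorem isZariskiClosed_setOf_forall_eq_zero (S : Set (coordRing k G)) :
    IsZariskiClosed (coordRing k G) {g | ∀ f ∈ S, (f : G → k) g = 0} := by
  have himage : {g | ∀ f ∈ S, (f : G → k) g = 0} = {g | ∀ f ∈ Subtype.val '' S, f g = 0} := by
    ext g
    exact (Set.forall_mem_image (p := fun f : G → k => f g = 0)).symm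
  rw [himage]
  refine isZariskiClosed_zeroLocus _ ?_
  rintro _ ⟨f, -, rfl⟩
  exact f.2

theorem submonoid_eq_top_of_nonvanishing_subset
    (hconn : IsZariskiConnected (coordRing k G) (Set.univ : Set G)) {H : Submonoid G}
    (hH : IsZariskiClosed (coordRing k G) (H : Set G)) {u : coordRing k G}
    (hu : (u : G → k) 1 ≠ 0) (huH : ∀ g, (u : G → k) g ≠ 0 → g ∈ H) : H = ⊤ := by
  let _ := zariski (coordRing k G)
  have : PreconnectedSpace G := ⟨hconn.isPreconnected⟩
  have hopen : IsOpen (H : Set G) := by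
    rw [isOpen_iff_forall_mem_open]
    intro h hh
    refine ⟨{g | (u : G → k) (h⁻¹ * g) ≠ 0}, fun g hg => ?_,
      isOpen_nonvanishing _ (mul_left_mem h⁻¹ u.2), by simpa using hu⟩
    rw [← mul_inv_cancel_left h g]
    exact H.mul_mem hh (huH _ hg)
  exact SetLike.coe_injective (IsClopen.eq_univ ⟨hH, hopen⟩ ⟨1, H.one_mem⟩)

theorem submonoid_eq_top_of_toDer_mem_span [CharZero k]
    (hconn : IsZariskiConnected (coordRing k G) (Set.univ : Set G)) {H : Submonoid G}
    {S : Set (coordRing k G)} (hH : ∀ g, g ∈ H ↔ ∀ f ∈ S, (f : G → k) g = 0)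
    (hS : ∀ (D : LieAlg k G), ∀ f ∈ S, toDer k G D f ∈ Ideal.span S) : H = ⊤ := by
  have hle : Ideal.span S ≤ idealOne k G := Ideal.span_le.2 ((hH 1).1 H.one_mem)
  obtain ⟨u, hu, huS⟩ := exists_annihilator_of_toDer_mem hle fun D _ hf =>
    derivation_mem_span (toDer k G D) (hS D) hf
  refine submonoid_eq_top_of_nonvanishing_subset hconn ?_ (hu ▸ one_ne_zero) fun g hg =>
    (hH g).2 fun f hf => ?_
  · rw [show (H : Set G) = {g | ∀ f ∈ S, (f : G → k) g = 0} from Set.ext hH]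
    exact isZariskiClosed_setOf_forall_eq_zero S
  · have huf := congrFun (congrArg Subtype.val (huS f (Ideal.subset_span hf))) g
    exact (mul_eq_zero.1 huf).resolve_left hg

variable (k) in
theorem subsingleton_of_subsingleton_lieAlg [CharZero k]
    (hconn : IsZariskiConnected (coordRing k G) (Set.univ : Set G)) [Subsingleton (LieAlg k G)] :
    Subsingleton G := by
  have hbot : (⊥ : Submonoid G) = ⊤ := by
    refine submonoid_eq_top_of_toDer_mem_span (S := idealOne k G) hconn (fun g => ?_)
      fun D f _ => ?_
    · refine ⟨fun hg f hf => ?_, fun hg => ?_⟩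
      · rw [Submonoid.mem_bot.1 hg]
        exact hf
      · refine Submonoid.mem_bot.2 (AffineAlgGroup.separates (k := k) g 1 fun f hf => ?_)
        simpa [sub_eq_zero] using hg _ (sub_algebraMap_mem_idealOne ⟨f, hf⟩)
    · rw [Subsingleton.elim D 0, map_zero]
      exact Ideal.zero_mem _
  refine subsingleton_of_forall_eq 1 fun g => Submonoid.mem_bot.1 ?_
  rw [hbot]
  exact Submonoid.mem_top g

variable {V W : Type*} [AddCommGroup V] [Module k V] [FiniteDimensional k V]
  [AddCommGroup W] [Module k W] [FiniteDimensional k W]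
  {ρ : Representation k G V} {σ : Representation k G W}

theorem dual_derived (hρ : IsRegularRep k ρ) (D : LieAlg k G) (l : Module.Dual k V) (v : V) :
    l (derived k hρ D v) = tangent k D (coeff k hρ l v) :=
  dual_derivedFun k hρ D v l

theorem derived_mem_of_map_mem (hρ : IsRegularRep k ρ) {W : Submodule k V}
    (hW : ∀ (g : G), ∀ w ∈ W, ρ g w ∈ W) (D : LieAlg k G) {w : V} (hw : w ∈ W) :
    derived k hρ D w ∈ W := by
  rw [← Subspace.forall_mem_dualAnnihilator_apply_eq_zero_iff]
  intro l hl
  have hcoeff : coeff k hρ l w = 0 := by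
    ext g
    exact (Submodule.mem_dualAnnihilator l).1 hl _ (hW g w hw)
  rw [dual_derived, hcoeff, map_zero]

theorem derived_prod (hρ : IsRegularRep k ρ) (hσ : IsRegularRep k σ) (D : LieAlg k G) (v : V × W) :
    derived k (hρ.prod k hσ) D v = (derived k hρ D v.1, derived k hσ D v.2) := by
  refine dual_ext k fun l => ?_
  have hcoeff : coeff k (hρ.prod k hσ) l v =
      coeff k hρ (l ∘ₗ LinearMap.inl k V W) v.1 + coeff k hσ (l ∘ₗ LinearMap.inr k V W) v.2 := by
    ext g
    simp [coeff_apply, ← map_add]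
  rw [dual_derived, hcoeff, map_add, ← dual_derived, ← dual_derived]
  simp [← map_add]

theorem derived_Ad_apply (hρ : IsRegularRep k ρ) (g : G) (D : LieAlg k G) (v : V) :
    derived k hρ (Ad k g D) (ρ g v) = ρ g (derived k hρ D v) := by
  refine dual_ext k fun l => ?_
  have hcoeff : leftTrans k g (rightTrans k g⁻¹ (coeff k hρ l (ρ g v))) =
      coeff k hρ (l ∘ₗ ρ g) v := by
    ext x
    simp [leftTrans_apply, rightTrans_apply, coeff_apply, mul_assoc]
  rw [dual_derived, tangent_apply, Ad_apply, rightTrans_apply, one_mul, apply_eq_tangent, hcoeff,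
    ← dual_derived, LinearMap.comp_apply]

section CharZero

variable [CharZero k] (hconn : IsZariskiConnected (coordRing k G) (Set.univ : Set G))

include hconn

theorem map_mem_of_derived_mem (hρ : IsRegularRep k ρ) {W : Submodule k V}
    (hW : ∀ (D : LieAlg k G), ∀ w ∈ W, derived k hρ D w ∈ W) (g : G) {w : V} (hw : w ∈ W) :
    ρ g w ∈ W := by
  let H : Submonoid G :=
    { carrier := {g | ∀ w ∈ W, ρ g w ∈ W}
      one_mem' := fun w hw => by rwa [map_one]
      mul_mem' := fun {g h} hg hh w hw => by
        rw [map_mul]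
        exact hg _ (hh w hw) }
  let S : Set (coordRing k G) := {f | ∃ l ∈ W.dualAnnihilator, ∃ w ∈ W, f = coeff k hρ l w}
  have hmem (v : V) : v ∈ W ↔ ∀ l ∈ W.dualAnnihilator, l v = 0 :=
    (Subspace.forall_mem_dualAnnihilator_apply_eq_zero_iff W v).symm
  have htop : H = ⊤ := by
    refine submonoid_eq_top_of_toDer_mem_span (S := S) hconn (fun g => ⟨?_, fun hg w hw => ?_⟩) ?_
    · rintro hg _ ⟨l, hl, w, hw, rfl⟩
      exact (hmem _).1 (hg w hw) l hl
    · exact (hmem _).2 fun l hl => hg _ ⟨l, hl, w, hw, rfl⟩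
    · rintro D _ ⟨l, hl, w, hw, rfl⟩
      rw [apply_coeff]
      exact Ideal.subset_span ⟨l, hl, _, hW D w hw, rfl⟩
  exact (htop ▸ Submonoid.mem_top g : g ∈ H) w hw

/- The graph of `t` is a stable subspace. -/
theorem commute_of_commute_derived (hρ : IsRegularRep k ρ) {t : Module.End k V}
    (ht : ∀ D : LieAlg k G, Commute t (derived k hρ D)) (g : G) : Commute t (ρ g) := by
  refine LinearMap.ext fun v => ?_
  have hgraph := map_mem_of_derived_mem hconn (hρ.prod k hρ) (W := t.graph) (fun D w hw => by
    rw [LinearMap.mem_graph_iff] at hw ⊢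
    rw [derived_prod hρ hρ, hw]
    exact (LinearMap.congr_fun (ht D) w.1).symm) g (w := (v, t v)) ((t.mem_graph_iff _).2 rfl)
  exact ((t.mem_graph_iff _).1 hgraph).symm

end CharZero

end Connected

/-! ### Connected components -/

section Component

variable {k : Type*} [Field k] {X : Type*} {A : Subalgebra k (X → k)}

theorem exists_vanishing_ne_zero {Z : Set X} (hZ : IsZariskiClosed A Z) {x : X} (hx : x ∉ Z) :
    ∃ f ∈ A, (∀ z ∈ Z, f z = 0) ∧ f x ≠ 0 := by
  let _ := zariski A
  obtain ⟨_, ⟨f, hf, rfl⟩, hxf, hfZ⟩ :=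
    (isTopologicalBasis_zariski A).exists_subset_of_mem_open (show x ∈ Zᶜ from hx) hZ.isOpen_compl
  exact ⟨f, hf, fun z hz => by_contra fun h => hfZ h hz, hxf⟩

variable (A) in
/-- The ideal of the regular functions that vanish on a set. -/
def vanishingIdeal (Z : Set X) : Ideal A where
  carrier := {f | ∀ z ∈ Z, (f : X → k) z = 0}
  add_mem' {f g} hf hg z hz := by
    change (f : X → k) z + (g : X → k) z = 0
    rw [hf z hz, hg z hz, add_zero]
  zero_mem' _ _ := rfl
  smul_mem' c f hf z hz := by
    change (c : X → k) z * (f : X → k) z = 0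
    rw [hf z hz, mul_zero]

theorem mem_vanishingIdeal {Z : Set X} {f : A} :
    f ∈ vanishingIdeal A Z ↔ ∀ z ∈ Z, (f : X → k) z = 0 := Iff.rfl

theorem subset_of_vanishingIdeal_le {Z Z' : Set X} (hZ : IsZariskiClosed A Z)
    (h : vanishingIdeal A Z ≤ vanishingIdeal A Z') : Z' ⊆ Z := by
  intro z hz
  by_contra hzZ
  obtain ⟨f, hf, hfZ, hfz⟩ := exists_vanishing_ne_zero hZ hzZ
  exact hfz (mem_vanishingIdeal.1 (h (mem_vanishingIdeal.2 hfZ : (⟨f, hf⟩ : A) ∈ _)) z hz)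

variable (A) in
theorem exists_minimal_isZariskiClosed [IsNoetherianRing A] {P : Set X → Prop}
    (hP : ∀ Z, P Z → IsZariskiClosed A Z) {C : Set X} (hC : P C) :
    ∃ Z, P Z ∧ ∀ Z', P Z' → Z' ⊆ Z → Z ⊆ Z' := by
  obtain ⟨_, ⟨Z, hZ, rfl⟩, hmax⟩ := WellFounded.has_min
    (wellFounded_gt : WellFounded ((· > ·) : Ideal A → Ideal A → Prop))
    (vanishingIdeal A '' {Z | P Z}) ⟨_, C, hC, rfl⟩
  refine ⟨Z, hZ, fun Z' hZ' hsub => subset_of_vanishingIdeal_le (hP Z' hZ') ?_⟩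
  have hle : vanishingIdeal A Z ≤ vanishingIdeal A Z' := fun f hf z hz => hf z (hsub hz)
  exact (not_lt_iff_le_imp_ge.1 (hmax _ ⟨Z', hZ', rfl⟩)) hle

variable (A) in
theorem exists_isZariskiConnected_mem [IsNoetherianRing A] {C : Set X}
    (hC : IsZariskiClosed A C) {x : X} (hx : x ∈ C) :
    ∃ Z ⊆ C, x ∈ Z ∧ IsZariskiClosed A Z ∧ IsZariskiClosed A (C \ Z) ∧ IsZariskiConnected A Z := by
  let _ := zariski A
  obtain ⟨Z, ⟨hZC, hxZ, hZ, hCZ⟩, hmin⟩ := exists_minimal_isZariskiClosed A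
    (P := fun Z => Z ⊆ C ∧ x ∈ Z ∧ IsClosed Z ∧ IsClosed (C \ Z)) (fun _ h => h.2.2.1)
    ⟨subset_rfl, hx, hC, by rw [Set.sdiff_self]; exact isClosed_empty⟩
  have hsub (u v : Set X) (hu : IsClosed u) (hv : IsClosed v) (hZuv : Z ⊆ u ∪ v)
      (huv : Disjoint u v) (hxu : x ∈ u) : Z ⊆ u := by
    have hdiff : C \ (Z ∩ u) = (C \ Z) ∪ (Z ∩ v) := by
      ext y
      have hyuv := @hZuv y
      have hdisj : y ∈ u → y ∉ v := fun hyu => Set.disjoint_left.1 huv hyu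
      have hyC := @hZC y
      simp only [Set.mem_sdiff, Set.mem_inter_iff, Set.mem_union] at hyuv ⊢
      tauto
    have hclosed : IsClosed (C \ (Z ∩ u)) := hdiff ▸ hCZ.union (hZ.inter hv)
    exact (hmin _ ⟨Set.inter_subset_left.trans hZC, ⟨hxZ, hxu⟩, hZ.inter hu, hclosed⟩
      Set.inter_subset_left).trans Set.inter_subset_right
  refine ⟨Z, hZC, hxZ, hZ, hCZ, ⟨x, hxZ⟩, ?_⟩
  rw [isPreconnected_iff_subset_of_fully_disjoint_closed hZ]
  intro u v hu hv hZuv huv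
  rcases hZuv hxZ with hxu | hxv
  · exact Or.inl (hsub u v hu hv hZuv huv hxu)
  · exact Or.inr (hsub v u hv hu (Set.union_comm u v ▸ hZuv) huv.symm hxv)

theorem subset_of_isZariskiConnected {C Z S : Set X} (hZ : IsZariskiClosed A Z)
    (hCZ : IsZariskiClosed A (C \ Z)) (hSC : S ⊆ C) (hS : IsZariskiConnected A S) {x : X}
    (hxS : x ∈ S) (hxZ : x ∈ Z) : S ⊆ Z := by
  let _ := zariski A
  have hcover : S ⊆ Z ∪ C \ Z := by
    rw [Set.union_sdiff_self]
    exact hSC.trans Set.subset_union_right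
  intro y hyS
  by_contra hyZ
  obtain ⟨z, -, hzZ, hzCZ⟩ := isPreconnected_closed_iff.1 hS.isPreconnected Z (C \ Z) hZ hCZ hcover
    ⟨x, hxS, hxZ⟩ ⟨y, hyS, hSC hyS, hyZ⟩
  exact hzCZ.2 hzZ

end Component

/-! ### Semisimplicity of the Lie algebra -/

section Radical

variable {k : Type*} [Field k] {G : Type*} [Group G] [AffineAlgGroup k G]

theorem exists_isolating_one (hG : IsSemisimple k G) {C : Subgroup G} (hn : C.Normal)
    (hC : IsZariskiClosed (coordRing k G) (C : Set G)) (hcomm : ∀ a ∈ C, ∀ b ∈ C, a * b = b * a) :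
    ∃ f : coordRing k G, (f : G → k) 1 ≠ 0 ∧ ∀ c ∈ C, c ≠ 1 → (f : G → k) c = 0 := by
  obtain ⟨Z, hZC, h1Z, hZ, hCZ, hZconn⟩ :=
    exists_isZariskiConnected_mem (coordRing k G) hC C.one_mem
  have hmaps {φ : G → G} (hφ : IsRegularMap (coordRing k G) (coordRing k G) φ)
      (hφC : ∀ c ∈ C, φ c ∈ C) {z : G} (hz : z ∈ Z) (hφz : φ z ∈ Z) : φ '' Z ⊆ Z := by
    have himage : IsZariskiConnected (coordRing k G) (φ '' Z) := by
      let _ := zariski (coordRing k G)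
      exact hZconn.image φ hφ.continuous.continuousOn
    refine subset_of_isZariskiConnected hZ hCZ ?_ himage ⟨z, hz, rfl⟩ hφz
    exact Set.image_subset_iff.2 fun c hc => hφC c (hZC hc)
  have hdiv {a b : G} (ha : a ∈ Z) (hb : b ∈ Z) : a⁻¹ * b ∈ Z :=
    hmaps (isRegularMap_mul_left a⁻¹) (fun _ => C.mul_mem (C.inv_mem (hZC ha))) ha
      (by rwa [inv_mul_cancel]) ⟨b, hb, rfl⟩
  have hinv {a : G} (ha : a ∈ Z) : a⁻¹ ∈ Z := by simpa only [mul_one] using hdiv ha h1Z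
  let N : Subgroup G :=
    { carrier := Z
      one_mem' := h1Z
      mul_mem' := fun ha hb => by simpa only [inv_inv] using hdiv (hinv ha) hb
      inv_mem' := hinv }
  have hN : N = ⊥ := by
    refine hG.radical_trivial N ⟨fun n hnN g => ?_⟩ hZ hZconn ?_
    · exact hmaps (isRegularMap_conj g) (fun c hc => hn.conj_mem c hc g) h1Z (by simpa)
        ⟨n, hnN, rfl⟩
    · exact Group.isSolvable_of_comm fun a b => Subtype.ext (hcomm _ (hZC a.2) _ (hZC b.2))
  obtain ⟨f, hf, hfC, hf1⟩ := exists_vanishing_ne_zero hCZ fun h => h.2 h1Z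
  refine ⟨⟨f, hf⟩, hf1, fun c hc hc1 => hfC c ⟨hc, fun hcZ => hc1 ?_⟩⟩
  exact Subgroup.mem_bot.1 (hN ▸ (show c ∈ N from hcZ))

theorem toDer_iterate_leftTrans (D : LieAlg k G) (h : G) (f : coordRing k G) (n : ℕ) :
    (toDer k G D)^[n] (leftTrans k h f) = leftTrans k h ((toDer k G D)^[n] f) := by
  have hcomm : Function.Commute (toDer k G D) (leftTrans k h) := fun f => toDer_left k D h f
  exact hcomm.iterate_left n f

theorem toDer_iterate_rightTrans {D : LieAlg k G} {h : G} (hD : Ad k h D = D) (f : coordRing k G)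
    (n : ℕ) : (toDer k G D)^[n] (rightTrans k h f) = rightTrans k h ((toDer k G D)^[n] f) := by
  have hcomm : Function.Commute (toDer k G D) (rightTrans k h) := fun f => by
    conv_lhs => rw [← hD, Ad_apply]
    rw [← rightTrans_mul, inv_mul_cancel, rightTrans_one]
  exact hcomm.iterate_left n f

variable {V : Type*} [AddCommGroup V] [Module k V]

theorem map_inv_map_apply {H : Type*} [Group H] (ρ : Representation k H V) (h : H) (v : V) :
    ρ h⁻¹ (ρ h v) = v := by
  rw [← Module.End.mul_apply, ← map_mul, inv_mul_cancel, map_one, Module.End.one_apply]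

/-- The pointwise stabilizer of a set of vectors in a representation. -/
def fixator {H : Type*} [Group H] (ρ : Representation k H V) (s : Set V) : Subgroup H where
  carrier := {h | ∀ v ∈ s, ρ h v = v}
  one_mem' v _ := by rw [map_one, Module.End.one_apply]
  mul_mem' {g h} hg hh v hv := by rw [map_mul, Module.End.mul_apply, hh v hv, hg v hv]
  inv_mem' {g} hg v hv := by
    conv_lhs => rw [← hg v hv]
    rw [map_inv_map_apply]

theorem mem_fixator {H : Type*} [Group H] {ρ : Representation k H V} {s : Set V} {h : H} :
    h ∈ fixator ρ s ↔ ∀ v ∈ s, ρ h v = v := Iff.rfl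

theorem fixator_normal {H : Type*} [Group H] {ρ : Representation k H V} {s : Set V}
    (hs : ∀ (h : H), ∀ v ∈ s, ρ h v ∈ s) : (fixator ρ s).Normal := by
  refine ⟨fun h hh g v hv => ?_⟩
  have hginv := hs g⁻¹ v hv
  rw [map_mul, map_mul, Module.End.mul_apply, Module.End.mul_apply, hh _ hginv]
  simpa only [inv_inv] using map_inv_map_apply ρ g⁻¹ v

/-- Equations for the center of `fixator ρ s`: they say that `g` fixes the vectors in `s` and that
it commutes with all elements of `fixator ρ s`. -/
def fixatorCenterEquations {ρ : Representation k G V} (hρ : IsRegularRep k ρ) (s : Set V) :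
    Set (coordRing k G) :=
  {f | ∃ (l : Module.Dual k V), ∃ v ∈ s, f = coeff k hρ l v - algebraMap k _ (l v)} ∪
    {f | ∃ h ∈ fixator ρ s, ∃ f', f = rightTrans k h f' - leftTrans k h f'}

theorem mem_fixator_inf_centralizer_iff [FiniteDimensional k V] {ρ : Representation k G V}
    (hρ : IsRegularRep k ρ) (s : Set V) (g : G) :
    g ∈ fixator ρ s ⊓ Subgroup.centralizer (fixator ρ s : Set G) ↔
      ∀ f ∈ fixatorCenterEquations hρ s, (f : G → k) g = 0 := by
  constructor
  · rintro ⟨hfix, hcent⟩ _ (⟨l, v, hv, rfl⟩ | ⟨h, hh, f, rfl⟩)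
    · simp [coeff_apply, mem_fixator.1 hfix v hv]
    · simp [rightTrans_apply, leftTrans_apply, Subgroup.mem_centralizer_iff.1 hcent h hh]
  · intro hg
    refine ⟨fun v hv => dual_ext k fun l => ?_, Subgroup.mem_centralizer_iff.2 fun h hh =>
      AffineAlgGroup.separates (k := k) _ _ fun f hf => ?_⟩
    · simpa [coeff_apply, sub_eq_zero] using hg _ (Or.inl ⟨l, v, hv, rfl⟩)
    · have hcomm := hg _ (Or.inr ⟨h, hh, ⟨f, hf⟩, rfl⟩)
      rw [AddSubgroupClass.coe_sub, Pi.sub_apply, sub_eq_zero, rightTrans_apply,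
        leftTrans_apply] at hcomm
      exact hcomm.symm

section CharZero

variable [CharZero k]

theorem formalExp_coeff_of_derived_eq_zero [FiniteDimensional k V] {ρ : Representation k G V}
    (hρ : IsRegularRep k ρ) {D : LieAlg k G} (l : Module.Dual k V) {v : V}
    (hv : derived k hρ D v = 0) :
    formalExp (toDer k G D) (evalOne k G) (coeff k hρ l v) = algebraMap k _ (l v) := by
  ext (_ | n)
  · simp [coeff_formalExp, evalOne_apply, coeff_apply]
  · rw [coeff_formalExp, iterate_toDer_coeff, pow_succ, Module.End.mul_apply, hv, map_zero]
    simp [evalOne_apply, coeff_apply]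

theorem formalExp_rightTrans_eq_leftTrans {D : LieAlg k G} {h : G} (hD : Ad k h D = D)
    (f : coordRing k G) :
    formalExp (toDer k G D) (evalOne k G) (rightTrans k h f) =
      formalExp (toDer k G D) (evalOne k G) (leftTrans k h f) := by
  ext n
  rw [coeff_formalExp, coeff_formalExp, toDer_iterate_leftTrans, toDer_iterate_rightTrans hD,
    evalOne_apply, evalOne_apply, rightTrans_apply, leftTrans_apply, one_mul, mul_one]

theorem formalExp_eq_zero_of_mem_fixatorCenterEquations [FiniteDimensional k V]
    {ρ : Representation k G V} (hρ : IsRegularRep k ρ) {s : Set V} {D : LieAlg k G}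
    (hDs : ∀ v ∈ s, derived k hρ D v = 0) (hD : ∀ h ∈ fixator ρ s, Ad k h D = D)
    {f : coordRing k G} (hf : f ∈ fixatorCenterEquations hρ s) :
    formalExp (toDer k G D) (evalOne k G) f = 0 := by
  rcases hf with ⟨l, v, hv, rfl⟩ | ⟨h, hh, f, rfl⟩
  · rw [map_sub, AlgHom.commutes, formalExp_coeff_of_derived_eq_zero hρ l (hDs v hv), sub_self]
  · rw [map_sub, formalExp_rightTrans_eq_leftTrans (hD h hh), sub_self]

variable [IsAlgClosed k]

/- Every function vanishing at the identity becomes an equation of the one-parameter subgroup after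
multiplication by `f`. -/
theorem eq_zero_of_formalExp_eq_zero {D : LieAlg k G} {S : Set (coordRing k G)}
    (hS : ∀ s ∈ S, formalExp (toDer k G D) (evalOne k G) s = 0) {f : coordRing k G}
    (hf : (f : G → k) 1 ≠ 0)
    (hfS : ∀ g, (∀ s ∈ S, (s : G → k) g = 0) → g ≠ 1 → (f : G → k) g = 0) : D = 0 := by
  have hexp_f : formalExp (toDer k G D) (evalOne k G) f ≠ 0 := fun h => hf (by
    rw [← evalOne_apply, ← constantCoeff_formalExp (toDer k G D), h, map_zero])
  have htangent {u : coordRing k G} (hu : (u : G → k) 1 = 0) : tangent k D u = 0 := by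
    have hprod : formalExp (toDer k G D) (evalOne k G) (u * f) = 0 := by
      refine formalExp_eq_zero hS fun g hg => ?_
      rw [MulMemClass.coe_mul, Pi.mul_apply, mul_eq_zero]
      by_cases hg1 : g = 1
      · exact Or.inl (hg1 ▸ hu)
      · exact Or.inr (hfS g hg hg1)
    have hexp_u := (mul_eq_zero.1 ((map_mul _ u f).symm.trans hprod)).resolve_right hexp_f
    simpa [hexp_u, evalOne_apply, tangent_apply] using
      (coeff_formalExp (toDer k G D) (evalOne k G) u 1).symm
  refine lieAlg_ext k fun u => ?_
  have hu := htangent (mem_idealOne.1 (sub_algebraMap_mem_idealOne u))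
  rw [map_sub, tangent_algebraMap, sub_zero] at hu
  rw [hu, tangent_apply, map_zero]
  rfl

/- The center `C` of the centralizer of an abelian ideal `𝔞` in `G` is a closed commutative normal
subgroup, hence discrete; but it contains the formal one-parameter subgroups of the elements of
`𝔞`. -/
theorem hasTrivialRadical (hG : IsSemisimple k G) :
    LieAlgebra.HasTrivialRadical k (LieAlg k G) := by
  rw [LieAlgebra.hasTrivialRadical_iff_no_abelian_ideals]
  intro 𝔞 h𝔞
  have hstable (g : G) (y : LieAlg k G) (hy : y ∈ 𝔞) : Ad k g y ∈ 𝔞 :=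
    map_mem_of_derived_mem hG.connected (isRegularRep_Ad k) (W := 𝔞.toSubmodule)
      (fun D w hw => by rw [derived_Ad]; exact 𝔞.lie_mem hw) g hy
  let H : Subgroup G := fixator (Ad k) (𝔞 : Set (LieAlg k G))
  let C : Subgroup G := H ⊓ Subgroup.centralizer (H : Set G)
  have hHnormal : H.Normal := fixator_normal hstable
  have hmemC (g : G) := mem_fixator_inf_centralizer_iff (isRegularRep_Ad k) (𝔞 : Set (LieAlg k G)) g
  have hclosed : IsZariskiClosed (coordRing k G) (C : Set G) := by
    rw [show (C : Set G) = _ from Set.ext hmemC]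
    exact isZariskiClosed_setOf_forall_eq_zero _
  have hcomm (a : G) (ha : a ∈ C) (b : G) (hb : b ∈ C) : a * b = b * a :=
    Subgroup.mem_centralizer_iff.1 hb.2 a ha.1
  obtain ⟨f, hf, hfC⟩ := exists_isolating_one hG (C := C) inferInstance hclosed hcomm
  refine (LieSubmodule.eq_bot_iff _).2 fun D hD => ?_
  have hDtriv (y : LieAlg k G) (hy : y ∈ 𝔞) : derived k (isRegularRep_Ad k) D y = 0 := by
    rw [derived_Ad]
    exact congrArg Subtype.val (h𝔞.trivial ⟨D, hD⟩ ⟨y, hy⟩)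
  exact eq_zero_of_formalExp_eq_zero
    (fun s hs => formalExp_eq_zero_of_mem_fixatorCenterEquations _ hDtriv (fun h hh => hh D hD) hs)
    hf fun g hg => hfC g ((hmemC g).2 hg)

end CharZero

end Radical

/-! ### Exponentials of `ad`-nilpotent elements -/

section Translates

variable {k : Type*} [Field k] {G : Type*} [Group G] [AffineAlgGroup k G]

/-- The span of the right translates of a regular function: the smallest subrepresentation of the
right regular representation containing it. -/
def translates (f : coordRing k G) : Submodule k (coordRing k G) :=
  Submodule.span k (Set.range fun g : G => rightTrans k g f)

theorem self_mem_translates (f : coordRing k G) : f ∈ translates f :=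
  Submodule.subset_span ⟨1, rightTrans_one k f⟩

theorem translates_le_comap_rightTrans (f : coordRing k G) (g : G) :
    translates f ≤ (translates f).comap (rightTrans k g).toLinearMap := by
  refine Submodule.span_le.2 ?_
  rintro _ ⟨h, rfl⟩
  exact Submodule.subset_span ⟨g * h, rightTrans_mul k g h f⟩

instance (f : coordRing k G) : FiniteDimensional k (translates f) := by
  obtain ⟨n, a, b, hab⟩ := mul_sum f.2
  have : FiniteDimensional k (Submodule.span k (Set.range a)) :=
    FiniteDimensional.span_of_finite k (Set.finite_range a)
  refine Submodule.finiteDimensional_of_le (S₂ := Submodule.span k (Set.range a))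
    (Submodule.span_le.2 ?_)
  rintro _ ⟨g, rfl⟩
  simp only [rightTrans_eq_sum hab]
  exact Submodule.sum_mem _ fun i _ => Submodule.smul_mem _ _ (Submodule.subset_span ⟨i, rfl⟩)

/-- The representation of `G` by right translations on `translates f`. -/
def translatesRep (f : coordRing k G) : Representation k G (translates f) where
  toFun g := (rightTrans k g).toLinearMap.restrict (translates_le_comap_rightTrans f g)
  map_one' := LinearMap.ext fun h => Subtype.ext (rightTrans_one k h.1)
  map_mul' g g' := LinearMap.ext fun h => Subtype.ext (rightTrans_mul k g g' h.1)

theorem translatesRep_apply (f : coordRing k G) (g : G) (h : translates f) :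
    (translatesRep f g h : coordRing k G) = rightTrans k g h := rfl

theorem isRegularRep_translatesRep (f : coordRing k G) :
    IsRegularRep (V := translates f) k (translatesRep f) := by
  intro l v
  obtain ⟨l', hl'⟩ := LinearMap.exists_extend l
  obtain ⟨n, a, b, hab⟩ := mul_sum v.1.2
  have hcoeff : (fun g => l (translatesRep f g v)) = ∑ i, l' (a i) • (b i : G → k) := by
    funext g
    rw [← hl', LinearMap.comp_apply, Submodule.subtype_apply, translatesRep_apply,
      rightTrans_eq_sum hab, map_sum]
    simp [mul_comm]
  rw [hcoeff]
  exact Subalgebra.sum_mem _ fun i _ => Subalgebra.smul_mem _ (b i).2 _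

theorem derived_translatesRep (f : coordRing k G) (D : LieAlg k G) (h : translates f) :
    (derived k (isRegularRep_translatesRep f) D h : coordRing k G) = toDer k G D h := by
  ext x
  let evalAt : Module.Dual k (translates f) :=
    LinearMap.proj x ∘ₗ (coordRing k G).val.toLinearMap ∘ₗ (translates f).subtype
  calc evalAt (derived k (isRegularRep_translatesRep f) D h)
      = tangent k D (coeff k (isRegularRep_translatesRep f) evalAt h) := dual_derived _ D evalAt h
    _ = (toDer k G D h : G → k) x := (apply_eq_tangent k D h x).symm

theorem derived_translatesRep_pow (f : coordRing k G) (D : LieAlg k G) (h : translates f) (n : ℕ) :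
    ((derived k (isRegularRep_translatesRep f) D ^ n) h : coordRing k G) =
      (toDer k G D)^[n] h := by
  induction n with
  | zero => rfl
  | succ n ih =>
    rw [pow_succ', Module.End.mul_apply, derived_translatesRep, ih, Function.iterate_succ_apply']

end Translates

section Exponential

theorem exists_algHom_eq_sum_of_iterate_eq_zero {k A : Type*} [Field k] [CharZero k] [CommRing A]
    [Algebra k A] (D : Derivation k A A) (hD : ∀ f, ∃ N, D^[N] f = 0) (χ : A →ₐ[k] k) :
    ∃ χ' : A →ₐ[k] k, ∀ f N, D^[N] f = 0 →
      χ' f = ∑ n ∈ Finset.range N, (n.factorial : k)⁻¹ * χ (D^[n] f) := by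
  let ι : Polynomial k →ₐ[k] PowerSeries k := Polynomial.coeToPowerSeries.algHom k
  have hι (p : Polynomial k) : ι p = p := by
    simp [ι, Polynomial.coeToPowerSeries.algHom_apply]
  have hinj : Function.Injective ι := fun p q hpq =>
    Polynomial.coe_injective k (by rw [← hι, ← hι, hpq])
  have htrunc (f : A) (N : ℕ) (hN : D^[N] f = 0) :
      ι (PowerSeries.trunc N (formalExp D χ f)) = formalExp D χ f := by
    ext n
    rw [hι, Polynomial.coeff_coe, PowerSeries.coeff_trunc]
    split_ifs with hn
    · rfl
    · obtain ⟨m, rfl⟩ := Nat.exists_eq_add_of_le' (not_lt.1 hn)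
      rw [coeff_formalExp, Function.iterate_add_apply, hN, iterate_map_zero, map_zero, mul_zero]
  have hrange (f : A) : formalExp D χ f ∈ ι.range := by
    obtain ⟨N, hN⟩ := hD f
    exact ⟨_, htrunc f N hN⟩
  let toPolynomial : A →ₐ[k] Polynomial k :=
    ((AlgEquiv.ofInjective ι hinj).symm : ι.range →ₐ[k] Polynomial k).comp
      ((formalExp D χ).codRestrict ι.range hrange)
  refine ⟨(Polynomial.aeval (1 : k)).comp toPolynomial, fun f N hN => ?_⟩
  have hpoly : toPolynomial f = PowerSeries.trunc N (formalExp D χ f) :=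
    (AlgEquiv.ofInjective ι hinj).symm_apply_eq.2 (Subtype.ext (htrunc f N hN).symm)
  rw [AlgHom.comp_apply, hpoly, Polynomial.aeval_def, PowerSeries.eval₂_trunc_eq_sum_range]
  simp [coeff_formalExp]

variable {k : Type*} [Field k] {G : Type*} [Group G] [AffineAlgGroup k G]

theorem eq_nilExp_derived {V : Type*} [AddCommGroup V] [Module k V] [FiniteDimensional k V]
    {ρ : Representation k G V} (hρ : IsRegularRep k ρ) {D : LieAlg k G}
    (hD : IsNilpotent (derived k hρ D)) {g : G}
    (hg : ∀ f N, (toDer k G D)^[N] f = 0 → (f : G → k) g = ∑ n ∈ Finset.range N,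
      (n.factorial : k)⁻¹ * ((toDer k G D)^[n] f : coordRing k G).1 1) :
    ρ g = nilExp (derived k hρ D) := by
  refine LinearMap.ext fun v => dual_ext k fun l => ?_
  have hzero : (toDer k G D)^[nilpotencyClass (derived k hρ D)] (coeff k hρ l v) = 0 := by
    rw [iterate_toDer_coeff, pow_nilpotencyClass hD]
    ext x
    simp [coeff_apply]
  rw [← coeff_apply hρ, hg _ _ hzero, nilExp, LinearMap.sum_apply, map_sum]
  refine Finset.sum_congr rfl fun n _ => ?_
  rw [iterate_toDer_coeff, coeff_apply, map_one, Module.End.one_apply, LinearMap.smul_apply,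
    map_smul, smul_eq_mul]

variable [CharZero k]

theorem exists_apply_eq_sum_of_iterate_eq_zero {D : LieAlg k G}
    (hD : ∀ f, ∃ N, (toDer k G D)^[N] f = 0) :
    ∃ g : G, ∀ f N, (toDer k G D)^[N] f = 0 →
      (f : G → k) g = ∑ n ∈ Finset.range N,
        (n.factorial : k)⁻¹ * ((toDer k G D)^[n] f : coordRing k G).1 1 := by
  obtain ⟨χ, hχ⟩ := exists_algHom_eq_sum_of_iterate_eq_zero _ hD (evalOne k G)
  obtain ⟨g, hg⟩ := AffineAlgGroup.exists_point χ
  exact ⟨g, fun f N hN => (hg f).symm.trans (hχ f N hN)⟩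

variable [IsAlgClosed k]

theorem exists_iterate_toDer_eq_zero (hG : IsSemisimple k G) {D : LieAlg k G}
    (hD : IsNilpotent (LieAlgebra.ad k (LieAlg k G) D)) (f : coordRing k G) :
    ∃ N, (toDer k G D)^[N] f = 0 := by
  have := hasTrivialRadical hG
  obtain ⟨N, hN⟩ := isNilpotent_of_isNilpotent_ad (V := translates f)
    (derived k (isRegularRep_translatesRep f)) hD
  refine ⟨N, ?_⟩
  rw [← derived_translatesRep_pow f D ⟨f, self_mem_translates f⟩, hN]
  rfl

theorem exists_Ad_eq_nilExp_ad (hG : IsSemisimple k G) {D : LieAlg k G}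
    (hD : IsNilpotent (LieAlgebra.ad k (LieAlg k G) D)) :
    ∃ g : G, Ad k g = nilExp (LieAlgebra.ad k (LieAlg k G) D) := by
  have had : derived k (isRegularRep_Ad k) D = LieAlgebra.ad k (LieAlg k G) D :=
    LinearMap.ext fun E => derived_Ad D E
  obtain ⟨g, hg⟩ := exists_apply_eq_sum_of_iterate_eq_zero (exists_iterate_toDer_eq_zero hG hD)
  rw [← had] at hD ⊢
  exact ⟨g, eq_nilExp_derived _ hD hg⟩

theorem exists_Ad_eq_of_isInnerAut (hG : IsSemisimple k G) {α : LieAlg k G ≃ₗ⁅k⁆ LieAlg k G}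
    (hα : IsInnerAut α) : ∃ g : G, ∀ x, Ad k g x = α x := by
  have hle : Submonoid.closure {φ : Module.End k (LieAlg k G) | ∃ x : LieAlg k G,
      IsNilpotent (LieAlgebra.ad k (LieAlg k G) x) ∧ φ = nilExp (LieAlgebra.ad k (LieAlg k G) x)} ≤
      MonoidHom.mrange (Ad k) := by
    rw [Submonoid.closure_le]
    rintro _ ⟨x, hx, rfl⟩
    exact exists_Ad_eq_nilExp_ad hG hx
  obtain ⟨g, hg⟩ := hle hα
  exact ⟨g, fun x => LinearMap.congr_fun hg x⟩

end Exponential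

/-! ### Tori -/

section Torus

variable {k : Type*} [Field k] {X Y : Type*}

/-- Pullback of functions along a map, as a homomorphism of algebras. -/
def pullback (φ : X → Y) : (Y → k) →ₐ[k] (X → k) :=
  AlgHom.pi fun x => Pi.evalAlgHom k (fun _ => k) (φ x)

theorem map_pullback_eq_iff {A : Subalgebra k (X → k)} {B : Subalgebra k (Y → k)} (e : X ≃ Y) :
    A.map (pullback e.symm) = B ↔ IsRegularMap A B e ∧ IsRegularMap B A e.symm := by
  constructor
  · rintro rfl
    refine ⟨?_, fun f hf => ⟨f, hf, rfl⟩⟩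
    rintro _ ⟨f, hf, rfl⟩
    have hfe : (fun x => pullback e.symm f (e x)) = f :=
      funext fun x => congrArg f (e.symm_apply_apply x)
    exact Set.mem_of_eq_of_mem hfe hf
  · rintro ⟨he, he'⟩
    refine le_antisymm (Subalgebra.map_le.2 he') fun f hf => ⟨_, he f hf, ?_⟩
    exact funext fun y => congrArg f (e.apply_symm_apply y)

theorem prodCoord_eq_sup (A : Subalgebra k (X → k)) (B : Subalgebra k (Y → k)) :
    prodCoord A B = A.map (pullback Prod.fst) ⊔ B.map (pullback Prod.snd) := by
  have hfst : {F : X × Y → k | ∃ f ∈ A, F = fun p => f p.1} =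
      (A.map (pullback Prod.fst) : Subalgebra k (X × Y → k)) :=
    Set.ext fun F => exists_congr fun f => and_congr_right fun _ => eq_comm
  have hsnd : {F : X × Y → k | ∃ f ∈ B, F = fun p => f p.2} =
      (B.map (pullback Prod.snd) : Subalgebra k (X × Y → k)) :=
    Set.ext fun F => exists_congr fun f => and_congr_right fun _ => eq_comm
  rw [prodCoord, hfst, hsnd, Algebra.adjoin_union, Algebra.adjoin_eq, Algebra.adjoin_eq]

theorem coe_mem_torusCoord {r : ℕ} (i : Fin r) :
    (fun t : Fin r → kˣ => (t i : k)) ∈ torusCoord k r :=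
  Algebra.subset_adjoin (Or.inl ⟨i, rfl⟩)

theorem inv_mem_torusCoord {r : ℕ} (i : Fin r) :
    (fun t : Fin r → kˣ => (((t i)⁻¹ : kˣ) : k)) ∈ torusCoord k r :=
  Algebra.subset_adjoin (Or.inr ⟨i, rfl⟩)

theorem torusCoord_le {r : ℕ} {A : Subalgebra k ((Fin r → kˣ) → k)}
    (hcoe : ∀ i, (fun t : Fin r → kˣ => (t i : k)) ∈ A)
    (hinv : ∀ i, (fun t : Fin r → kˣ => (((t i)⁻¹ : kˣ) : k)) ∈ A) : torusCoord k r ≤ A := by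
  refine Algebra.adjoin_le ?_
  rintro _ (⟨i, rfl⟩ | ⟨i, rfl⟩)
  exacts [hcoe i, hinv i]

variable (k) in
/-- The homomorphism of split tori given by a reindexing of the coordinates. -/
def reindexTorus {ι κ : Type*} (q : κ → ι) : (ι → kˣ) →* (κ → kˣ) :=
  MonoidHom.pi fun c => Pi.evalMonoidHom (fun _ => kˣ) (q c)

theorem map_reindexTorus_le {r n : ℕ} (q : Fin r → Fin n) :
    (torusCoord k r).map (pullback (reindexTorus k q)) ≤ torusCoord k n :=
  Subalgebra.map_le.2 <|
    torusCoord_le (fun i => coe_mem_torusCoord (q i)) fun i => inv_mem_torusCoord (q i)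

theorem torusCoord_add (r s : ℕ) :
    torusCoord k (r + s) =
      (torusCoord k r).map (pullback (reindexTorus k (Fin.castAdd s))) ⊔
        (torusCoord k s).map (pullback (reindexTorus k (Fin.natAdd r))) := by
  refine le_antisymm (torusCoord_le (fun i => ?_) fun i => ?_)
    (sup_le (map_reindexTorus_le _) (map_reindexTorus_le _))
  · induction i using Fin.addCases with
    | left i => exact Algebra.mem_sup_left ⟨_, coe_mem_torusCoord i, rfl⟩
    | right i => exact Algebra.mem_sup_right ⟨_, coe_mem_torusCoord i, rfl⟩
  · induction i using Fin.addCases with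
    | left i => exact Algebra.mem_sup_left ⟨_, inv_mem_torusCoord i, rfl⟩
    | right i => exact Algebra.mem_sup_right ⟨_, inv_mem_torusCoord i, rfl⟩

variable {G G' : Type*} [Group G] [Group G'] {A : Subalgebra k (G → k)} {B : Subalgebra k (G' → k)}

theorem isTorusOfRank_iff {H : Subgroup G} {r : ℕ} :
    IsTorusOfRank A H r ↔
      ∃ T : (Fin r → kˣ) →* G, T.range = H ∧ A.map (pullback T) = torusCoord k r := by
  constructor
  · rintro ⟨φ, hφ⟩
    refine ⟨H.subtype.comp φ.symm.toMonoidHom, ?_, ?_⟩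
    · rw [MonoidHom.range_comp, MonoidHom.range_eq_top.2 φ.symm.surjective,
        ← MonoidHom.range_eq_map, Subgroup.range_subtype]
    · rw [← (map_pullback_eq_iff φ.toEquiv).2 hφ, restrictCoord, Subalgebra.map_map]
      rfl
  · rintro ⟨T, rfl, hT⟩
    have hinj : Function.Injective T := fun s t hst => funext fun i => Units.ext <| by
      obtain ⟨F, -, hF⟩ := hT.ge (coe_mem_torusCoord i)
      calc (s i : k) = F (T s) := (congrFun hF s).symm
        _ = F (T t) := congrArg F hst
        _ = t i := congrFun hF t
    refine ⟨(MonoidHom.ofInjective hinj).symm, (map_pullback_eq_iff (Equiv.symm _)).1 ?_⟩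
    rw [← hT, restrictCoord, Subalgebra.map_map]
    rfl

theorem range_prod_reindexTorus {r s : ℕ} (T : (Fin r → kˣ) →* G) (T' : (Fin s → kˣ) →* G') :
    ((T.comp (reindexTorus k (Fin.castAdd s))).prod
      (T'.comp (reindexTorus k (Fin.natAdd r)))).range = T.range.prod T'.range := by
  ext ⟨g, g'⟩
  rw [Subgroup.mem_prod]
  constructor
  · rintro ⟨t, ht⟩
    exact ⟨⟨_, congrArg Prod.fst ht⟩, ⟨_, congrArg Prod.snd ht⟩⟩
  · rintro ⟨⟨t, rfl⟩, ⟨t', rfl⟩⟩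
    exact ⟨Fin.append t t', Prod.ext (congrArg T (funext (Fin.append_left t t')))
      (congrArg T' (funext (Fin.append_right t t')))⟩

theorem IsTorusOfRank.prod {H : Subgroup G} {K : Subgroup G'} {r s : ℕ}
    (hH : IsTorusOfRank A H r) (hK : IsTorusOfRank B K s) :
    IsTorusOfRank (prodCoord A B) (H.prod K) (r + s) := by
  rw [isTorusOfRank_iff] at hH hK ⊢
  obtain ⟨T, rfl, hT⟩ := hH
  obtain ⟨T', rfl, hT'⟩ := hK
  refine ⟨_, range_prod_reindexTorus T T', ?_⟩
  rw [prodCoord_eq_sup, Algebra.map_sup, torusCoord_add, ← hT, ← hT', Subalgebra.map_map,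
    Subalgebra.map_map, Subalgebra.map_map, Subalgebra.map_map]
  rfl

end Torus

section TorusConnected

theorem isZariskiConnected_univ_of_mul_eq_zero {k X : Type*} [Field k] [Nonempty X]
    {A : Subalgebra k (X → k)} (hA : ∀ f ∈ A, ∀ g ∈ A, f * g = 0 → f = 0 ∨ g = 0) :
    IsZariskiConnected A Set.univ := by
  let _ := zariski A
  refine ⟨Set.univ_nonempty, IsPreirreducible.isPreconnected ?_⟩
  rintro U V hU hV ⟨x, -, hx⟩ ⟨y, -, hy⟩
  obtain ⟨_, ⟨f, hf, rfl⟩, hxf, hfU⟩ :=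
    (isTopologicalBasis_zariski A).exists_subset_of_mem_open hx hU
  obtain ⟨_, ⟨g, hg, rfl⟩, hyg, hgV⟩ :=
    (isTopologicalBasis_zariski A).exists_subset_of_mem_open hy hV
  have hfg : f * g ≠ 0 := fun h => (hA f hf g hg h).elim (fun hf => hxf (congrFun hf x))
    fun hg => hyg (congrFun hg y)
  obtain ⟨z, hz⟩ := Function.ne_iff.1 hfg
  exact ⟨z, trivial, hfU (left_ne_zero_of_mul hz), hgV (right_ne_zero_of_mul hz)⟩

variable {k : Type*} [Field k]

theorem exists_mvPolynomial_of_mem_torusCoord {r : ℕ} {f : (Fin r → kˣ) → k}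
    (hf : f ∈ torusCoord k r) : ∃ (N : ℕ) (P : MvPolynomial (Fin r) k),
      ∀ t, f t * (∏ i, (t i : k)) ^ N = MvPolynomial.eval (fun i => (t i : k)) P := by
  classical
  induction hf using Algebra.adjoin_induction with
  | mem f hf =>
    rcases hf with ⟨i, rfl⟩ | ⟨i, rfl⟩
    · exact ⟨0, MvPolynomial.X i, fun t => by simp⟩
    · refine ⟨1, ∏ j ∈ Finset.univ.erase i, MvPolynomial.X j, fun t => ?_⟩
      rw [map_prod, pow_one, ← Finset.mul_prod_erase _ _ (Finset.mem_univ i)]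
      simp
  | algebraMap c => exact ⟨0, MvPolynomial.C c, fun t => by simp⟩
  | add f g _ _ hf hg =>
    obtain ⟨N, P, hP⟩ := hf
    obtain ⟨M, Q, hQ⟩ := hg
    refine ⟨N + M, P * (∏ i, MvPolynomial.X i) ^ M + Q * (∏ i, MvPolynomial.X i) ^ N, fun t => ?_⟩
    simp only [map_add, map_mul, map_pow, map_prod, MvPolynomial.eval_X, ← hP, ← hQ, Pi.add_apply]
    ring
  | mul f g _ _ hf hg =>
    obtain ⟨N, P, hP⟩ := hf
    obtain ⟨M, Q, hQ⟩ := hg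
    refine ⟨N + M, P * Q, fun t => ?_⟩
    simp only [map_mul, ← hP, ← hQ, Pi.mul_apply]
    ring

theorem eq_zero_of_forall_eval_units_eq_zero [Infinite k] {ι : Type*} [Finite ι]
    {P : MvPolynomial ι k} (hP : ∀ t : ι → kˣ, MvPolynomial.eval (fun i => (t i : k)) P = 0) :
    P = 0 := by
  have := Fintype.ofFinite ι
  have hX : ∏ i : ι, (MvPolynomial.X i : MvPolynomial ι k) ≠ 0 :=
    Finset.prod_ne_zero_iff.2 fun i _ => MvPolynomial.X_ne_zero i
  refine (mul_eq_zero.1 (MvPolynomial.funext fun z => ?_)).resolve_right hX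
  rw [map_mul, map_zero, map_prod]
  simp only [MvPolynomial.eval_X]
  by_cases hz : ∀ i, z i ≠ 0
  · exact mul_eq_zero_of_left (hP fun i => Units.mk0 (z i) (hz i)) _
  · push Not at hz
    obtain ⟨i, hi⟩ := hz
    exact mul_eq_zero_of_right _ (Finset.prod_eq_zero (Finset.mem_univ i) hi)

theorem eq_zero_or_eq_zero_of_mem_torusCoord [Infinite k] {r : ℕ} {f g : (Fin r → kˣ) → k}
    (hf : f ∈ torusCoord k r) (hg : g ∈ torusCoord k r) (hfg : f * g = 0) : f = 0 ∨ g = 0 := by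
  obtain ⟨N, P, hP⟩ := exists_mvPolynomial_of_mem_torusCoord hf
  obtain ⟨M, Q, hQ⟩ := exists_mvPolynomial_of_mem_torusCoord hg
  have hprod (t : Fin r → kˣ) (n : ℕ) : (∏ i, (t i : k)) ^ n ≠ 0 :=
    pow_ne_zero _ (Finset.prod_ne_zero_iff.2 fun i _ => (t i).ne_zero)
  have hPQ : P * Q = 0 := eq_zero_of_forall_eval_units_eq_zero fun t => by
    rw [map_mul, ← hP, ← hQ, mul_mul_mul_comm, ← Pi.mul_apply f g, hfg, Pi.zero_apply, zero_mul]
  rcases mul_eq_zero.1 hPQ with rfl | rfl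
  · exact Or.inl (funext fun t => eq_zero_of_ne_zero_of_mul_right_eq_zero (hprod t N)
      ((hP t).trans (map_zero _)))
  · exact Or.inr (funext fun t => eq_zero_of_ne_zero_of_mul_right_eq_zero (hprod t M)
      ((hQ t).trans (map_zero _)))

theorem IsTorusOfRank.isZariskiConnected [Infinite k] {G : Type*} [Group G]
    {A : Subalgebra k (G → k)} {H : Subgroup G} {r : ℕ} (h : IsTorusOfRank A H r) :
    IsZariskiConnected A (H : Set G) := by
  obtain ⟨T, rfl, hT⟩ := isTorusOfRank_iff.1 h
  have hreg : IsRegularMap (torusCoord k r) A T := fun f hf => hT ▸ ⟨f, hf, rfl⟩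
  have hconn : IsZariskiConnected (torusCoord k r) Set.univ :=
    isZariskiConnected_univ_of_mul_eq_zero fun f hf g hg =>
      eq_zero_or_eq_zero_of_mem_torusCoord hf hg
  rw [MonoidHom.coe_range, ← Set.image_univ]
  let _ := zariski A
  let _ := zariski (torusCoord k r)
  exact IsConnected.image hconn T hreg.continuous.continuousOn

end TorusConnected

section Decomposition

theorem linearMap_ext_of_iSup_eq_top {k V W C : Type*} [Semiring k] [AddCommMonoid V] [Module k V]
    [AddCommMonoid W] [Module k W] {M : C → Submodule k V} (hM : ⨆ c, M c = ⊤) {f g : V →ₗ[k] W}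
    (h : ∀ c, ∀ v ∈ M c, f v = g v) : f = g := by
  have hle : ⨆ c, M c ≤ LinearMap.eqLocus f g := iSup_le fun c v hv => h c v hv
  rw [hM] at hle
  exact LinearMap.ext fun v => hle Submodule.mem_top

variable {k V C : Type*} [Field k] [AddCommGroup V] [Module k V] [DecidableEq C]
  (M : C → Submodule k V) [DirectSum.Decomposition M]

theorem end_ext_of_decomposition {f g : Module.End k V} (h : ∀ c, ∀ v ∈ M c, f v = g v) :
    f = g :=
  linearMap_ext_of_iSup_eq_top (DirectSum.Decomposition.isInternal M).submodule_iSup_eq_top h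

/-- The projection of a graded vector space to one of its components, as an endomorphism. -/
def componentProj (c : C) : Module.End k V :=
  (M c).subtype ∘ₗ DirectSum.component k C (fun c => M c) c ∘ₗ
    (DirectSum.decomposeLinearEquiv M : V →ₗ[k] _)

theorem componentProj_of_mem {c : C} {v : V} (hv : v ∈ M c) : componentProj M c v = v :=
  DirectSum.decompose_of_mem_same M hv

theorem componentProj_of_mem_of_ne {c d : C} {v : V} (hv : v ∈ M d) (hdc : d ≠ c) :
    componentProj M c v = 0 :=
  DirectSum.decompose_of_mem_ne M hv hdc

variable [Fintype C]

theorem sum_smul_componentProj_apply (a : C → k) {c : C} {v : V} (hv : v ∈ M c) :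
    (∑ d, a d • componentProj M d) v = a c • v := by
  rw [LinearMap.sum_apply, Finset.sum_eq_single_of_mem c (Finset.mem_univ c), LinearMap.smul_apply,
    componentProj_of_mem M hv]
  intro d _ hdc
  rw [LinearMap.smul_apply, componentProj_of_mem_of_ne M hv hdc.symm, smul_zero]

/-- The endomorphisms of a graded vector space acting by scalars on its components. -/
def scaleComponents : (C → k) →ₐ[k] Module.End k V :=
  AlgHom.ofLinearMap (∑ c, (LinearMap.proj c).smulRight (componentProj M c))
    (end_ext_of_decomposition M fun c v hv => by
      simpa using sum_smul_componentProj_apply M 1 hv)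
    fun a b => end_ext_of_decomposition M fun c v hv => by
      have h (a : C → k) : (∑ d, (LinearMap.proj (R := k) d).smulRight (componentProj M d)) a v =
          a c • v := by
        rw [LinearMap.sum_apply]
        exact sum_smul_componentProj_apply M a hv
      rw [Module.End.mul_apply, h b, map_smul, h a, h, Pi.mul_apply, mul_smul, smul_comm]

theorem scaleComponents_eq_sum (a : C → k) :
    scaleComponents M a = ∑ c, a c • componentProj M c := by
  simp only [scaleComponents, AlgHom.ofLinearMap_apply, LinearMap.sum_apply,
    LinearMap.smulRight_apply, LinearMap.proj_apply]

theorem scaleComponents_apply_of_mem (a : C → k) {c : C} {v : V} (hv : v ∈ M c) :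
    scaleComponents M a v = a c • v := by
  rw [scaleComponents_eq_sum, sum_smul_componentProj_apply M a hv]

theorem apply_scaleComponents_mem {X : Type*} {A : Subalgebra k (X → k)} {F : C → X → k}
    (hF : ∀ c, F c ∈ A) (l : Module.Dual k V) (v : V) :
    (fun x => l (scaleComponents M (fun c => F c x) v)) ∈ A := by
  have heq : (fun x => l (scaleComponents M (fun c => F c x) v)) =
      ∑ c, l (componentProj M c v) • F c := by
    funext x
    simp [scaleComponents_eq_sum, mul_comm]
  rw [heq]
  exact A.sum_mem fun c _ => A.smul_mem (hF c) _

/-- The homomorphism from a split torus to `GL(V)` by which it acts on the component `M c` of a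
graded vector space through its coordinate of index `q c`. -/
def torusAction {ι : Type*} (q : C → ι) : (ι → kˣ) →* LinearMap.GeneralLinearGroup k V :=
  (Units.map (scaleComponents M : (C → k) →* Module.End k V)).comp
    (MulEquiv.piUnits.symm.toMonoidHom.comp (reindexTorus k q))

theorem torusAction_val {ι : Type*} (q : C → ι) (t : ι → kˣ) :
    (torusAction M q t).1 = scaleComponents M fun c => t (q c) := rfl

theorem mem_range_torusAction_iff {ι : Type*} (q : C → ι) {g : LinearMap.GeneralLinearGroup k V} :
    g ∈ (torusAction M q).range ↔
      ∃ a : ι → kˣ, ∀ c, ∀ v ∈ M c, g.1 v = (a (q c) : k) • v := by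
  refine exists_congr fun a =>
    ⟨?_, fun ha => Units.ext (end_ext_of_decomposition M fun c v hv => ?_)⟩
  · rintro rfl c v hv
    rw [torusAction_val, scaleComponents_apply_of_mem M _ hv]
  · rw [torusAction_val, scaleComponents_apply_of_mem M _ hv, ha c v hv]

theorem map_pullback_torusAction {r : ℕ} {q : C → Fin r} (hq : Function.Surjective q)
    (hM : ∀ c, M c ≠ ⊥) :
    (glCoord k V).map (pullback (torusAction M q)) = torusCoord k r := by
  refine le_antisymm (Subalgebra.map_le.2 (Algebra.adjoin_le ?_)) ?_
  · rintro _ (⟨l, v, rfl⟩ | ⟨l, v, rfl⟩)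
    · exact apply_scaleComponents_mem M (fun c => coe_mem_torusCoord (q c)) l v
    · exact apply_scaleComponents_mem M (fun c => inv_mem_torusCoord (q c)) l v
  · have hcoord (i : Fin r) : ∃ (l : Module.Dual k V) (v : V),
        ∀ t : C → k, ∀ s : Fin r → k, (∀ c, t c = s (q c)) → l (scaleComponents M t v) = s i := by
      obtain ⟨c, rfl⟩ := hq i
      obtain ⟨v, hv, hv0⟩ := (Submodule.ne_bot_iff _).1 (hM c)
      obtain ⟨l, hl⟩ := Module.Projective.exists_dual_eq_one k hv0
      refine ⟨l, v, fun t s hts => ?_⟩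
      rw [scaleComponents_apply_of_mem M _ hv, map_smul, hl, smul_eq_mul, mul_one, hts]
    refine torusCoord_le (fun i => ?_) fun i => ?_
    · obtain ⟨l, v, hlv⟩ := hcoord i
      exact ⟨_, Algebra.subset_adjoin (Or.inl ⟨l, v, rfl⟩),
        funext fun t => hlv _ (fun i => t i) fun c => rfl⟩
    · obtain ⟨l, v, hlv⟩ := hcoord i
      exact ⟨_, Algebra.subset_adjoin (Or.inr ⟨l, v, rfl⟩),
        funext fun t => hlv _ (fun i => ((t i)⁻¹ : kˣ)) fun c => rfl⟩

end Decomposition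

section GeneralLinear

variable {k V : Type*} [Field k] [AddCommGroup V] [Module k V]

theorem isTorusOfRank_of_iSupIndep {C : Type*} [Finite C] {M : C → Submodule k V}
    (hind : iSupIndep M) (htop : ⨆ c, M c = ⊤) (hM : ∀ c, M c ≠ ⊥) {r : ℕ} {q : C → Fin r}
    (hq : Function.Surjective q) {H : Subgroup (LinearMap.GeneralLinearGroup k V)}
    (hH : ∀ t, t ∈ H ↔ ∃ a : Fin r → kˣ, ∀ c, ∀ v ∈ M c, t.1 v = (a (q c) : k) • v) :
    IsTorusOfRank (glCoord k V) H r := by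
  classical
  have := Fintype.ofFinite C
  let _ : DirectSum.Decomposition M := DirectSum.IsInternal.chooseDecomposition M
    (DirectSum.isInternal_submodule_of_iSupIndep_of_iSup_eq_top hind htop)
  exact isTorusOfRank_iff.2 ⟨torusAction M q,
    Subgroup.ext fun t => (mem_range_torusAction_iff M q).trans (hH t).symm,
    map_pullback_torusAction M hq hM⟩

theorem mem_scalars_iff {g : LinearMap.GeneralLinearGroup k V} :
    g ∈ scalars k V ↔ ∃ c : kˣ, ∀ v, g.1 v = (c : k) • v := by
  refine exists_congr fun c => ?_
  rw [Units.ext_iff, LinearMap.ext_iff]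
  exact forall_congr' fun v => eq_comm

theorem isTorusOfRank_scalars [Nontrivial V] : IsTorusOfRank (glCoord k V) (scalars k V) 1 := by
  refine isTorusOfRank_of_iSupIndep (M := fun _ : Unit => ⊤) (q := fun _ => 0)
    (iSupIndep_subsingleton _) iSup_const (fun _ => top_ne_bot)
    (fun i => ⟨(), Subsingleton.elim _ _⟩) fun t => mem_scalars_iff.trans ?_
  constructor
  · rintro ⟨c, hc⟩
    exact ⟨fun _ => c, fun _ v _ => hc v⟩
  · rintro ⟨a, ha⟩
    exact ⟨a 0, fun v => ha () v Submodule.mem_top⟩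

end GeneralLinear

/-! ### Isotypic components -/

section Isotypic

variable {k : Type*} [Field k]

theorem exists_eq_smul_of_mem_isotypicComponents {R M : Type*} [Ring R] [Algebra k R]
    [AddCommGroup M] [Module k M] [Module R M] [IsScalarTower k R M] [IsAlgClosed k]
    [FiniteDimensional k M] [IsSemisimpleModule R M] {t : Module.End R M}
    (ht : ∀ s : Module.End R M, Commute t s) {c : Submodule R M}
    (hc : c ∈ isotypicComponents R M) : ∃ a : k, ∀ v ∈ c, t v = a • v := by
  obtain ⟨S, hS, rfl⟩ := hc
  obtain ⟨p, hp⟩ := IsSemisimpleModule.extension_property S.subtype S.injective_subtype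
    (LinearMap.id : S →ₗ[R] S)
  have hpS (w : S) : p w = w := LinearMap.congr_fun hp w
  have : FiniteDimensional k S := inferInstanceAs (FiniteDimensional k (S.restrictScalars k))
  obtain ⟨a, ha⟩ := (IsSimpleModule.algebraMap_end_bijective_of_isAlgClosed k).2
    (p ∘ₗ t ∘ₗ S.subtype)
  have hpt (w : S) : p (t w) = a • w := (LinearMap.congr_fun ha w).symm
  let N : Submodule R M := LinearMap.ker (t - algebraMap k (Module.End R M) a)
  have hN (v : M) : v ∈ N ↔ t v = a • v := by
    rw [LinearMap.mem_ker, LinearMap.sub_apply, sub_eq_zero, Module.algebraMap_end_apply]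
  suffices isotypicComponent R M S ≤ N from ⟨a, fun v hv => (hN v).1 (this hv)⟩
  -- For a copy `m` of `S`, the endomorphism `S → m` moves the scalar from `S` to `m`.
  refine sSup_le ?_
  rintro m ⟨e⟩ v hv
  let s : Module.End R M := m.subtype ∘ₗ e.symm.toLinearMap ∘ₗ p
  have hs (w : M) : s w = e.symm (p w) := rfl
  have hesmul : e.symm (a • e ⟨v, hv⟩) = a • e.symm (e ⟨v, hv⟩) :=
    e.symm.toLinearMap.map_smul_of_tower a _
  have hst := LinearMap.congr_fun (ht s) (e ⟨v, hv⟩)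
  rw [Module.End.mul_apply, Module.End.mul_apply, hs, hs, hpS, hpt, hesmul,
    LinearEquiv.symm_apply_apply] at hst
  exact (hN v).2 hst

theorem ncard_isotypicComponents_of_injective {R M N : Type*} [Ring R] [AddCommGroup M] [Module R M]
    [AddCommGroup N] [Module R N] [IsSemisimpleModule R N] {f : N →ₗ[R] M}
    (hf : Function.Injective f)
    (hN : ∀ S T : Submodule R N, IsAtom S → IsAtom T → Nonempty (S ≃ₗ[R] T) → S = T) :
    {c ∈ isotypicComponents R M | ∃ x, x ≠ 0 ∧ f x ∈ c}.ncard =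
      {S : Submodule R N | IsAtom S}.ncard := by
  let equivMap (S : Submodule R N) : S ≃ₗ[R] S.map f := Submodule.equivMapOfInjective f hf S
  have isSimpleModule_map {S : Submodule R N} (hS : IsAtom S) : IsSimpleModule R (S.map f) :=
    have := isSimpleModule_iff_isAtom.2 hS
    IsSimpleModule.congr (equivMap S).symm
  refine (Set.BijOn.ncard_eq (f := fun S : Submodule R N => isotypicComponent R M (S.map f))
    ⟨fun S hS => ?_, fun S hS T hT hST => ?_, ?_⟩).symm
  · have := isSimpleModule_map hS
    obtain ⟨x, hxS, hx0⟩ := (Submodule.ne_bot_iff S).1 hS.1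
    exact ⟨⟨S.map f, this, rfl⟩, x, hx0,
      (S.map f).le_isotypicComponent (Submodule.mem_map_of_mem hxS)⟩
  · have := isSimpleModule_map hS
    have := isSimpleModule_map hT
    obtain ⟨e⟩ := isIsotypicOfType_submodule_iff.1
      (IsIsotypicOfType.isotypicComponent R M (T.map f)) (S.map f)
      ((S.map f).le_isotypicComponent.trans_eq hST)
    exact hN S T hS hT ⟨(equivMap S).trans (e.trans (equivMap T).symm)⟩
  · rintro c ⟨hc, x, hx0, hxc⟩
    obtain ⟨S, hS, hSc⟩ := (eq_bot_or_exists_atom_le (c.comap f)).resolve_left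
      ((Submodule.ne_bot_iff _).2 ⟨x, hxc, hx0⟩)
    have := isSimpleModule_map hS
    exact ⟨S, hS, (eq_isotypicComponent_of_le hc (Submodule.map_le_iff_le_comap.2 hSc)).symm⟩

theorem exists_end_injOn_of_linearEquiv {R M : Type*} [Ring R] [AddCommGroup M] [Module R M]
    [IsSemisimpleModule R M] {S T : Submodule R M} (e : S ≃ₗ[R] T) :
    ∃ f : Module.End R M, (∀ x ∈ S, f x ∈ T) ∧ Set.InjOn f S := by
  obtain ⟨p, hp⟩ := IsSemisimpleModule.extension_property S.subtype S.injective_subtype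
    e.toLinearMap
  have hpS (x : M) (hx : x ∈ S) : p x = e ⟨x, hx⟩ := LinearMap.congr_fun hp ⟨x, hx⟩
  refine ⟨T.subtype ∘ₗ p, fun x _ => (p x).2, fun x hx y hy hxy => ?_⟩
  have hexy : e ⟨x, hx⟩ = e ⟨y, hy⟩ := hpS x hx ▸ hpS y hy ▸ Subtype.ext hxy
  exact congrArg Subtype.val (e.injective hexy)

variable {G V : Type*} [Group G] [AddCommGroup V] [Module k V] {ρ : Representation k G V}

theorem mem_endAlg_iff {t : Module.End k V} : t ∈ endAlg k ρ ↔ ∀ g, Commute t (ρ g) := by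
  rw [endAlg, Subalgebra.mem_centralizer_iff, Set.forall_mem_range]
  exact forall_congr' fun g => eq_comm

variable (ρ) in
/-- The endomorphisms of a representation are those of the corresponding module over the group
algebra. -/
def endAlgEquiv : endAlg k ρ ≃ₐ[k] Module.End (MonoidAlgebra k G) ρ.asModule :=
  AlgEquiv.trans
    { toFun := fun t => ⟨t.1, mem_endAlg_iff.1 t.2⟩
      invFun := fun f => ⟨f.toLinearMap, mem_endAlg_iff.2 f.isIntertwining'⟩
      left_inv := fun _ => rfl
      right_inv := fun _ => rfl
      map_mul' := fun _ _ => rfl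
      map_add' := fun _ _ => rfl
      commutes' := fun _ => rfl }
    (Representation.IntertwiningMap.equivAlgEnd ρ)

theorem isSemisimpleRepresentation_of_exists_projection
    (h : ∀ σ : Subrepresentation ρ, ∃ p ∈ endAlg k ρ, (∀ v, p v ∈ σ) ∧ ∀ w ∈ σ, p w = w) :
    Representation.IsSemisimpleRepresentation ρ := by
  refine (Representation.isSemisimpleRepresentation_iff_isSemisimpleModule_asModule ρ).2
    ((isSemisimpleModule_iff _ _).2 ⟨fun c => ?_⟩)
  obtain ⟨p, hp, hpc, hpid⟩ := h (Subrepresentation.ofSubmodule' c)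
  exact ⟨_, LinearMap.isCompl_of_proj (f := (endAlgEquiv ρ ⟨p, hp⟩).codRestrict c hpc)
    fun x => Subtype.ext (hpid x.1 x.2)⟩

variable (ρ) in
/-- An isotypic component, taken over the group algebra, as a subspace of the representation. -/
def isotypicSubspace (c : isotypicComponents (MonoidAlgebra k G) ρ.asModule) : Submodule k V :=
  (Subrepresentation.ofSubmodule' c.1).toSubmodule

theorem map_mem_isotypicSubspace (g : G) {c : isotypicComponents (MonoidAlgebra k G) ρ.asModule}
    {v : V} (hv : v ∈ isotypicSubspace ρ c) : ρ g v ∈ isotypicSubspace ρ c :=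
  (Subrepresentation.ofSubmodule' c.1).apply_mem_toSubmodule g hv

theorem isotypicSubspace_ne_bot (c : isotypicComponents (MonoidAlgebra k G) ρ.asModule) :
    isotypicSubspace ρ c ≠ ⊥ := by
  obtain ⟨v, hv, hv0⟩ := (Submodule.ne_bot_iff _).1 (bot_lt_isotypicComponents c.2).ne'
  exact (Submodule.ne_bot_iff _).2 ⟨ρ.asModuleEquiv v, hv, ρ.asModuleEquiv.map_ne_zero_iff.2 hv0⟩

theorem iSupIndep_isotypicSubspace : iSupIndep (isotypicSubspace ρ) := by
  have h := (sSupIndep_iff _).1 (sSupIndep_isotypicComponents (MonoidAlgebra k G) ρ.asModule)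
  refine fun c => (?_ : Disjoint (Submodule.restrictScalars k c.1) (⨆ (d) (_ : d ≠ c), _))
  have hc := (Submodule.disjoint_restrictScalars_iff k).2 (h c)
  simp only [Submodule.restrictScalars_iSup] at hc
  exact hc

theorem iSup_isotypicSubspace [Representation.IsSemisimpleRepresentation ρ] :
    ⨆ c, isotypicSubspace ρ c = ⊤ := by
  have : IsSemisimpleModule (MonoidAlgebra k G) ρ.asModule :=
    Representation.isSemisimpleRepresentation_iff_isSemisimpleModule_asModule ρ |>.1 inferInstance
  have h := congrArg (Submodule.restrictScalars k)
    (sSup_isotypicComponents (MonoidAlgebra k G) ρ.asModule)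
  rw [sSup_eq_iSup', Submodule.restrictScalars_iSup] at h
  exact h

theorem apply_mem_isotypicSubspace {s : Module.End k V} (hs : s ∈ endAlg k ρ)
    {c : isotypicComponents (MonoidAlgebra k G) ρ.asModule} {v : V}
    (hv : v ∈ isotypicSubspace ρ c) : s v ∈ isotypicSubspace ρ c :=
  Submodule.IsFullyInvariant.of_mem_isotypicComponents c.2 (endAlgEquiv ρ ⟨s, hs⟩) hv

theorem mem_center_endAlg_iff [IsAlgClosed k] [FiniteDimensional k V]
    [Representation.IsSemisimpleRepresentation ρ] {t : Module.End k V} :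
    (t ∈ endAlg k ρ ∧ ∀ s ∈ endAlg k ρ, Commute t s) ↔
      ∀ c, ∃ a : k, ∀ v ∈ isotypicSubspace ρ c, t v = a • v := by
  constructor
  · rintro ⟨ht, hcomm⟩ c
    have : IsSemisimpleModule (MonoidAlgebra k G) ρ.asModule :=
      Representation.isSemisimpleRepresentation_iff_isSemisimpleModule_asModule ρ |>.1 inferInstance
    have : FiniteDimensional k ρ.asModule := inferInstance
    refine exists_eq_smul_of_mem_isotypicComponents (t := endAlgEquiv ρ ⟨t, ht⟩) (fun s => ?_) c.2
    obtain ⟨s, rfl⟩ := (endAlgEquiv ρ).surjective s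
    exact Commute.map (Subtype.ext (hcomm s.1 s.2) : Commute ⟨t, ht⟩ s) (endAlgEquiv ρ)
  · intro h
    have hcomm {s : Module.End k V}
        (hs : ∀ c, ∀ v ∈ isotypicSubspace ρ c, s v ∈ isotypicSubspace ρ c) : Commute t s :=
      linearMap_ext_of_iSup_eq_top iSup_isotypicSubspace fun c v hv => by
        obtain ⟨a, ha⟩ := h c
        rw [Module.End.mul_apply, Module.End.mul_apply, ha v hv, ha _ (hs c v hv), map_smul]
    exact ⟨mem_endAlg_iff.2 fun g => hcomm fun c v hv => map_mem_isotypicSubspace g hv,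
      fun s hs => hcomm fun c v hv => apply_mem_isotypicSubspace hs hv⟩

theorem mem_center_units_iff {A : Type*} [Ring A] [Algebra k A] [FiniteDimensional k A] [Infinite k]
    {u : Aˣ} : u ∈ Subgroup.center Aˣ ↔ ∀ a : A, Commute u.1 a := by
  rw [Subgroup.mem_center_iff]
  refine ⟨fun hu a => ?_, fun hu w => Units.ext (hu w).symm⟩
  -- Some translate of `a` by a scalar is invertible.
  obtain ⟨c, hc⟩ := (Module.End.finite_spectrum (Algebra.lmul k A a)).exists_notMem
  rw [spectrum.notMem_iff, ← AlgHom.commutes (Algebra.lmul k A), ← map_sub,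
    Algebra.lmul_isUnit_iff] at hc
  obtain ⟨w, hw⟩ := hc
  have huw : Commute u.1 (algebraMap k A c - a) := hw ▸ (congrArg Units.val (hu w)).symm
  simpa only [sub_sub_cancel] using (Algebra.commute_algebraMap_right c u.1).sub_right huw

theorem mem_map_center_units_endAlg_iff [Infinite k] [FiniteDimensional k V]
    {t : LinearMap.GeneralLinearGroup k V} :
    t ∈ (Subgroup.center (endAlg k ρ)ˣ).map (Units.map (endAlg k ρ).val.toMonoidHom) ↔
      t.1 ∈ endAlg k ρ ∧ ∀ s ∈ endAlg k ρ, Commute t.1 s := by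
  constructor
  · rintro ⟨u, hu, rfl⟩
    exact ⟨u.1.2, fun s hs => congrArg Subtype.val ((mem_center_units_iff (k := k)).1 hu ⟨s, hs⟩)⟩
  · rintro ⟨ht, hcomm⟩
    have htinv : (t⁻¹).1 ∈ endAlg k ρ :=
      mem_endAlg_iff.2 fun g => (mem_endAlg_iff.1 ht g).units_inv_left
    refine ⟨⟨⟨t.1, ht⟩, ⟨(t⁻¹).1, htinv⟩, Subtype.ext t.mul_inv, Subtype.ext t.inv_mul⟩,
      (mem_center_units_iff (k := k)).2 fun s => Subtype.ext (hcomm s.1 s.2), Units.ext rfl⟩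

end Isotypic

/-! ### Simple factors and isotypic components -/

section SimpleFactors

section LieIdeal

variable {R L : Type*} [CommRing R] [LieRing L] [LieAlgebra R L]

theorem isSimple_iff_isAtom [LieAlgebra.IsSemisimple R L] {I : LieIdeal R L} :
    LieAlgebra.IsSimple R I ↔ IsAtom I := by
  refine ⟨fun hI => ⟨?_, fun J hJ => ?_⟩, LieAlgebra.IsSemisimple.isSimple_of_isAtom I⟩
  · rintro rfl
    exact hI.non_abelian inferInstance
  · rcases hI.eq_bot_or_eq_top (J.comap I.incl) with hbot | htop
    · refine eq_bot_iff.2 fun x hx => (LieSubmodule.mem_bot x).2 ?_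
      have hx' : (⟨x, hJ.le hx⟩ : I) ∈ J.comap I.incl := hx
      rw [hbot] at hx'
      exact congrArg Subtype.val ((LieSubmodule.mem_bot _).1 hx')
    · refine absurd (fun x hx => ?_) hJ.not_ge
      exact (htop ▸ LieSubmodule.mem_top _ : (⟨x, hx⟩ : I) ∈ J.comap I.incl)

theorem isLieAbelian_of_injOn_of_disjoint {I J : LieIdeal R L} (hIJ : Disjoint I J)
    {f : Module.End R L} (hf : ∀ x, Commute f (LieAlgebra.ad R L x)) (hmem : ∀ x ∈ I, f x ∈ J)
    (hinj : Set.InjOn f I) : IsLieAbelian I := by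
  refine ⟨fun x y => Subtype.ext (hinj (I.lie_mem y.2) I.zero_mem ?_)⟩
  have hlie : f ⁅x.1, y.1⁆ = ⁅x.1, f y⁆ := LinearMap.congr_fun (hf x.1) y.1
  have hmemInf : f ⁅x.1, y.1⁆ ∈ I ⊓ J :=
    hlie ▸ ⟨lie_mem_left R L I _ _ x.2, J.lie_mem (hmem y y.2)⟩
  rw [hIJ.eq_bot, LieSubmodule.mem_bot] at hmemInf
  exact hmemInf.trans (map_zero f).symm

end LieIdeal

variable {k : Type*} [Field k] {G : Type*} [Group G] [AffineAlgGroup k G]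

theorem commute_derived_of_commute {V : Type*} [AddCommGroup V] [Module k V]
    [FiniteDimensional k V] {ρ : Representation k G V} (hρ : IsRegularRep k ρ) {t : Module.End k V}
    (ht : ∀ g, Commute t (ρ g)) (D : LieAlg k G) : Commute t (derived k hρ D) := by
  refine LinearMap.ext fun v => dual_ext k fun l => ?_
  have hcoeff : coeff k hρ (l ∘ₗ t) v = coeff k hρ l (t v) := by
    ext g
    exact congrArg l (LinearMap.congr_fun (ht g) v)
  exact (dual_derived hρ D (l ∘ₗ t) v).trans ((congrArg _ hcoeff).trans
    (dual_derived hρ D l _).symm)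

variable [CharZero k]

theorem IsRegularRep.isSemisimpleRepresentation [IsAlgClosed k] (hG : IsSemisimple k G)
    {V : Type*} [AddCommGroup V] [Module k V] [FiniteDimensional k V] {ρ : Representation k G V}
    (hρ : IsRegularRep k ρ) : Representation.IsSemisimpleRepresentation ρ := by
  have := hasTrivialRadical hG
  refine isSemisimpleRepresentation_of_exists_projection fun σ => ?_
  obtain ⟨p, hp, hmem, hid⟩ := exists_commute_projection (derived k hρ) σ.toSubmodule
    fun D w hw => derived_mem_of_map_mem hρ σ.apply_mem_toSubmodule D hw
  exact ⟨p, mem_endAlg_iff.2 (commute_of_commute_derived hG.connected hρ hp), hmem, hid⟩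

/-- For a connected group, the ideals of the Lie algebra are the submodules of the adjoint
representation. -/
def idealOrderIso (hconn : IsZariskiConnected (coordRing k G) (Set.univ : Set G)) :
    LieIdeal k (LieAlg k G) ≃o
      Submodule (MonoidAlgebra k G) (Ad k : Representation k G (LieAlg k G)).asModule where
  toFun I := Subrepresentation.asSubmodule
    ⟨I.toSubmodule, fun g _ hx => map_mem_of_derived_mem hconn (isRegularRep_Ad k)
      (fun D w hw => by rw [derived_Ad]; exact I.lie_mem hw) g hx⟩
  invFun N :=
    { (Subrepresentation.ofSubmodule' N).toSubmodule with
      lie_mem := fun {x y} hy => derived_Ad (k := k) x y ▸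
        derived_mem_of_map_mem (isRegularRep_Ad k)
          (Subrepresentation.ofSubmodule' N).apply_mem_toSubmodule x hy }
  left_inv _ := rfl
  right_inv _ := rfl
  map_rel_iff' := Iff.rfl

theorem eq_of_linearEquiv_of_isAtom [IsAlgClosed k] (hG : IsSemisimple k G)
    {S T : Submodule (MonoidAlgebra k G) (Ad k : Representation k G (LieAlg k G)).asModule}
    (hS : IsAtom S) (hT : IsAtom T) (hST : Nonempty (S ≃ₗ[MonoidAlgebra k G] T)) : S = T := by
  by_contra hne
  obtain ⟨e⟩ := hST
  have := hasTrivialRadical hG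
  have : IsSemisimpleModule (MonoidAlgebra k G)
      (Ad k : Representation k G (LieAlg k G)).asModule :=
    (Representation.isSemisimpleRepresentation_iff_isSemisimpleModule_asModule _).1
      ((isRegularRep_Ad k).isSemisimpleRepresentation hG)
  obtain ⟨f, hmem, hinj⟩ := exists_end_injOn_of_linearEquiv e
  obtain ⟨f, rfl⟩ := (endAlgEquiv _).surjective f
  let I := (idealOrderIso hG.connected).symm S
  let J := (idealOrderIso hG.connected).symm T
  have hI : IsAtom I := ((idealOrderIso hG.connected).symm.isAtom_iff S).2 hS
  have hJ : IsAtom J := ((idealOrderIso hG.connected).symm.isAtom_iff T).2 hT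
  have hIJ : Disjoint I J :=
    hI.disjoint_of_ne hJ ((idealOrderIso hG.connected).symm.injective.ne hne)
  have hcomm (x : LieAlg k G) : Commute f.1 (LieAlgebra.ad k (LieAlg k G) x) := by
    have h := commute_derived_of_commute (isRegularRep_Ad k) (mem_endAlg_iff.1 f.2) x
    rwa [show derived k (isRegularRep_Ad k) x = LieAlgebra.ad k _ x from
      LinearMap.ext (derived_Ad x)] at h
  have : IsLieAbelian I := isLieAbelian_of_injOn_of_disjoint hIJ hcomm hmem hinj
  exact hI.1 (LieAlgebra.HasTrivialRadical.eq_bot_of_isSolvable (R := k) I)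

theorem ncard_isAtom_Ad_eq_numSimpleFactors [IsAlgClosed k] (hG : IsSemisimple k G) :
    {S : Submodule (MonoidAlgebra k G) (Ad k : Representation k G (LieAlg k G)).asModule |
      IsAtom S}.ncard = numSimpleFactors k (LieAlg k G) := by
  have := hasTrivialRadical hG
  refine (Set.BijOn.ncard_eq (f := idealOrderIso hG.connected)
    ⟨fun I hI => ?_, (idealOrderIso hG.connected).injective.injOn, fun S hS => ?_⟩).symm
  · exact ((idealOrderIso hG.connected).isAtom_iff I).2 (isSimple_iff_isAtom.1 hI)
  · exact ⟨_, isSimple_iff_isAtom.2 (((idealOrderIso hG.connected).symm.isAtom_iff S).2 hS),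
      (idealOrderIso hG.connected).apply_symm_apply S⟩

end SimpleFactors

section CentralTorus

theorem exists_surjective_fin_collapsing {C : Type*} [Finite C] (S : Set C) :
    ∃ (r : ℕ) (q : C → Fin r), Function.Surjective q ∧
      (∀ c d, q c = q d ↔ c = d ∨ c ∈ S ∧ d ∈ S) ∧ (S.Nonempty → r + S.ncard = 1 + Nat.card C) := by
  classical
  let f (c : C) : Option C := if c ∈ S then none else some c
  have hf (c d : C) : f c = f d ↔ c = d ∨ c ∈ S ∧ d ∈ S := by
    by_cases hc : c ∈ S <;> by_cases hd : d ∈ S <;> simp only [f, hc, hd, if_true, if_false] <;>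
      grind
  let e : Set.range f ≃ Fin (Nat.card (Set.range f)) := Finite.equivFin _
  refine ⟨_, e ∘ Set.rangeFactorization f, e.surjective.comp Set.rangeFactorization_surjective,
    fun c d => ?_, ?_⟩
  · rw [Function.comp_apply, Function.comp_apply, e.apply_eq_iff_eq, Subtype.ext_iff]
    exact hf c d
  · rintro ⟨c₀, hc₀⟩
    have hrange : Set.range f = insert none (some '' Sᶜ) := by
      ext o
      cases o <;> grind
    rw [Nat.card_coe_set_eq, hrange, Set.ncard_insert_of_notMem (by simp),
      Set.ncard_image_of_injective _ (Option.some_injective _), ← Set.ncard_add_ncard_compl S]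
    omega

variable {k : Type*} [Field k]

theorem ne_zero_of_forall_mem_apply_eq_smul {V : Type*} [AddCommGroup V] [Module k V]
    {t : LinearMap.GeneralLinearGroup k V} {W : Submodule k V} (hW : W ≠ ⊥) {a : k}
    (ha : ∀ v ∈ W, t.1 v = a • v) : a ≠ 0 := by
  rintro rfl
  obtain ⟨v, hv, hv0⟩ := (Submodule.ne_bot_iff W).1 hW
  exact hv0 (t.toLinearEquiv.map_eq_zero_iff.1 ((ha v hv).trans (zero_smul k v)))

variable {G₀ : Type*} [Group G₀] [AffineAlgGroup k G₀] {U₀ : Type*} [AddCommGroup U₀] [Module k U₀]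
  {ρ₀ : Representation k G₀ U₀}

/-- The projection of `U₀ ⊕ 𝔤₀` to `𝔤₀`, as an endomorphism. -/
def adjointProj : Module.End k (U₀ × LieAlg k G₀) := LinearMap.inr k _ _ ∘ₗ LinearMap.snd k _ _

theorem adjointProj_apply (v : U₀ × LieAlg k G₀) : adjointProj v = (0, v.2) := rfl

theorem adjointProj_mem_endAlg : adjointProj ∈ endAlg k (rho0' k ρ₀) :=
  mem_endAlg_iff.2 fun g => LinearMap.ext fun _ => Prod.ext (map_zero (ρ₀ g)).symm rfl

variable [IsAlgClosed k]

variable (ρ₀) in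
/-- The isotypic components of `U₀ ⊕ 𝔤₀` that meet `𝔤₀`. -/
def adjointComponents : Set (isotypicComponents (MonoidAlgebra k G₀) (rho0' k ρ₀).asModule) :=
  {c | ∃ x : LieAlg k G₀, x ≠ 0 ∧ (0, x) ∈ isotypicSubspace (rho0' k ρ₀) c}

theorem ncard_adjointComponents [CharZero k] (hG₀ : IsSemisimple k G₀) :
    (adjointComponents ρ₀).ncard = numSimpleFactors k (LieAlg k G₀) := by
  have : IsSemisimpleModule (MonoidAlgebra k G₀)
      (Ad k : Representation k G₀ (LieAlg k G₀)).asModule :=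
    (Representation.isSemisimpleRepresentation_iff_isSemisimpleModule_asModule _).1
      ((isRegularRep_Ad k).isSemisimpleRepresentation hG₀)
  let f := Representation.IntertwiningMap.equivLinearMapAsModule _ _
    (Representation.IntertwiningMap.inr k ρ₀ (Ad k))
  have hf : Function.Injective f := fun x y (hxy : ((0 : U₀), x) = (0, y)) => congrArg Prod.snd hxy
  rw [← ncard_isAtom_Ad_eq_numSimpleFactors hG₀,
    ← ncard_isotypicComponents_of_injective hf fun S T => eq_of_linearEquiv_of_isAtom hG₀,
    ← Set.ncard_image_of_injective _ Subtype.val_injective]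
  congr 1
  ext c
  exact ⟨fun ⟨c, hc, h⟩ => h ▸ ⟨c.2, hc⟩, fun ⟨hc, h⟩ => ⟨⟨c, hc⟩, h, rfl⟩⟩

variable [FiniteDimensional k U₀]

theorem IsRegularRep.isSemisimpleRepresentation_rho0' [CharZero k] (hG₀ : IsSemisimple k G₀)
    (hρ₀ : IsRegularRep k ρ₀) : Representation.IsSemisimpleRepresentation (rho0' k ρ₀) :=
  (hρ₀.prod k (isRegularRep_Ad k)).isSemisimpleRepresentation hG₀

theorem mem_T'_iff {t : LinearMap.GeneralLinearGroup k (U₀ × LieAlg k G₀)} :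
    t ∈ T' k ρ₀ ↔ (t.1 ∈ endAlg k (rho0' k ρ₀) ∧ ∀ s ∈ endAlg k (rho0' k ρ₀), Commute t.1 s) ∧
      ∃ c : kˣ, ∀ x : LieAlg k G₀, t.1 (0, x) = (c : k) • (0, x) :=
  Subgroup.mem_inf.trans (and_congr_left' mem_map_center_units_endAlg_iff)

theorem adjointComponents_nonempty [CharZero k] (hG₀ : IsSemisimple k G₀) (hρ₀ : IsRegularRep k ρ₀)
    [Nontrivial G₀] : (adjointComponents ρ₀).Nonempty := by
  have := hρ₀.isSemisimpleRepresentation_rho0' hG₀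
  by_contra hempty
  have hproj : (adjointProj : Module.End k (U₀ × LieAlg k G₀)) = 0 :=
    linearMap_ext_of_iSup_eq_top iSup_isotypicSubspace fun c v hv => by
      by_contra hne
      exact hempty ⟨c, v.2, fun h0 => hne (Prod.ext rfl h0),
        apply_mem_isotypicSubspace adjointProj_mem_endAlg hv⟩
  have : Subsingleton (LieAlg k G₀) := ⟨fun x y =>
    sub_eq_zero.1 (congrArg Prod.snd (LinearMap.congr_fun hproj ((0 : U₀), x - y)))⟩
  exact not_subsingleton G₀ (subsingleton_of_subsingleton_lieAlg k hG₀.connected)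

theorem mem_T'_iff_isotypicSubspace [CharZero k] (hG₀ : IsSemisimple k G₀)
    (hρ₀ : IsRegularRep k ρ₀) {t : LinearMap.GeneralLinearGroup k (U₀ × LieAlg k G₀)} :
    t ∈ T' k ρ₀ ↔ ∃ b : isotypicComponents (MonoidAlgebra k G₀) (rho0' k ρ₀).asModule → kˣ,
      (∀ c, ∀ v ∈ isotypicSubspace (rho0' k ρ₀) c, t.1 v = (b c : k) • v) ∧
        ∃ μ : kˣ, ∀ c ∈ adjointComponents ρ₀, b c = μ := by
  have := hρ₀.isSemisimpleRepresentation_rho0' hG₀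
  rw [mem_T'_iff, mem_center_endAlg_iff]
  constructor
  · rintro ⟨hscalar, μ, hμ⟩
    choose b hb using hscalar
    refine ⟨fun c => Units.mk0 (b c)
      (ne_zero_of_forall_mem_apply_eq_smul (isotypicSubspace_ne_bot c) (hb c)), hb, μ, ?_⟩
    rintro c ⟨x, hx0, hx⟩
    exact Units.ext (smul_left_injective k hx0 (congrArg Prod.snd ((hb c _ hx).symm.trans (hμ x))))
  · rintro ⟨b, hb, μ, hμ⟩
    have hproj : t.1 ∘ₗ adjointProj = (μ : k) • adjointProj :=
      linearMap_ext_of_iSup_eq_top iSup_isotypicSubspace fun c v hv => by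
        have hmem := apply_mem_isotypicSubspace (adjointProj_mem_endAlg (ρ₀ := ρ₀)) hv
        rw [LinearMap.comp_apply, LinearMap.smul_apply, hb c _ hmem]
        by_cases hv0 : v.2 = 0
        · rw [adjointProj_apply, hv0, Prod.mk_zero_zero, smul_zero, smul_zero]
        · rw [hμ c ⟨v.2, hv0, hmem⟩]
    exact ⟨fun c => ⟨b c, hb c⟩, μ, fun x => LinearMap.congr_fun hproj (0, x)⟩

theorem isTorusOfRank_T' [CharZero k] (hG₀ : IsSemisimple k G₀) (hρ₀ : IsRegularRep k ρ₀) :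
    ∃ r : ℕ, IsTorusOfRank (glCoord k (U₀ × LieAlg k G₀)) (T' k ρ₀) r ∧
      (Nontrivial G₀ →
        (r : ℤ) = 1 + numIsotypic k (rho0' k ρ₀) - numSimpleFactors k (LieAlg k G₀)) := by
  have := hρ₀.isSemisimpleRepresentation_rho0' hG₀
  have : IsSemisimpleModule (MonoidAlgebra k G₀) (rho0' k ρ₀).asModule :=
    (Representation.isSemisimpleRepresentation_iff_isSemisimpleModule_asModule _).1 this
  have : IsNoetherian (MonoidAlgebra k G₀) (rho0' k ρ₀).asModule :=
    isNoetherian_of_tower k (inferInstanceAs (IsNoetherian k (U₀ × LieAlg k G₀)))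
  obtain ⟨r, q, hq, hcollapse, hrank⟩ := exists_surjective_fin_collapsing (adjointComponents ρ₀)
  refine ⟨r, isTorusOfRank_of_iSupIndep iSupIndep_isotypicSubspace iSup_isotypicSubspace
    isotypicSubspace_ne_bot hq fun t => (mem_T'_iff_isotypicSubspace hG₀ hρ₀).trans ?_,
    fun _ => ?_⟩
  · constructor
    · rintro ⟨b, hb, μ, hμ⟩
      have hfactor : Function.FactorsThrough b q := fun c d hcd => by
        rcases (hcollapse c d).1 hcd with rfl | ⟨hc, hd⟩
        · rfl
        · rw [hμ c hc, hμ d hd]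
      obtain ⟨a, rfl⟩ := (Function.factorsThrough_iff b).1 hfactor
      exact ⟨a, hb⟩
    · rintro ⟨a, ha⟩
      refine ⟨a ∘ q, ha, ?_⟩
      rcases (adjointComponents ρ₀).eq_empty_or_nonempty with hempty | ⟨c₀, hc₀⟩
      · exact ⟨1, by simp [hempty]⟩
      · exact ⟨a (q c₀), fun c hc => congrArg a ((hcollapse c c₀).2 (Or.inr ⟨hc, hc₀⟩))⟩
  · have hcard := hrank (adjointComponents_nonempty hG₀ hρ₀)
    rw [ncard_adjointComponents hG₀, Nat.card_coe_set_eq] at hcard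
    rw [numIsotypic]
    omega

end CentralTorus

/-! ### The stabilizer -/

section Stabilizer

section TensorProduct

variable {k V W : Type*} [Field k] [AddCommGroup V] [Module k V] [AddCommGroup W] [Module k W]

theorem tmul_right_injective {v : V} (hv : v ≠ 0) :
    Function.Injective (v ⊗ₜ[k] · : W → V ⊗[k] W) := by
  obtain ⟨f, hf⟩ := Module.Projective.exists_dual_eq_one k hv
  refine Function.LeftInverse.injective (g := TensorProduct.lid k W ∘ f.rTensor W) fun w => ?_
  rw [Function.comp_apply, LinearMap.rTensor_tmul, hf, TensorProduct.lid_tmul, one_smul]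

theorem exists_units_smul_eq_of_tmul_eq_tmul {γ δ : V →ₗ[k] W} (hγ : Function.Injective γ)
    (hδ : Function.Injective δ) (h : ∀ x y, γ y ⊗ₜ[k] δ x = δ y ⊗ₜ[k] γ x) :
    ∃ l : kˣ, ∀ x, δ x = (l : k) • γ x := by
  rcases subsingleton_or_nontrivial V with hV | hV
  · exact ⟨1, fun x => by rw [Subsingleton.elim x 0, map_zero, map_zero, smul_zero]⟩
  obtain ⟨y, hy⟩ := exists_ne (0 : V)
  obtain ⟨f, hf⟩ := Module.Projective.exists_dual_eq_one k ((map_ne_zero_iff γ hγ).2 hy)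
  have hsmul (x : V) : δ x = f (δ y) • γ x := by
    simpa [hf] using congrArg (TensorProduct.lid k W ∘ f.rTensor W) (h x y)
  refine ⟨Units.mk0 (f (δ y)) fun hzero => hy (hδ ?_), hsmul⟩
  rw [hsmul, hzero, zero_smul, map_zero]

theorem exists_prodMap_eq_of_commute {g : Module.End k (V × W)}
    (hg : Commute g (LinearMap.inl k V W ∘ₗ LinearMap.fst k V W)) :
    ∃ p γ, g = LinearMap.prodMap p γ := by
  have hfst (u : V × W) : g (u.1, 0) = ((g u).1, 0) := LinearMap.congr_fun hg u
  refine ⟨LinearMap.fst k V W ∘ₗ g ∘ₗ LinearMap.inl k V W,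
    LinearMap.snd k V W ∘ₗ g ∘ₗ LinearMap.inr k V W, LinearMap.ext fun u => ?_⟩
  have hinl : (g (u.1, 0)).2 = 0 := congrArg Prod.snd (hfst u)
  have hu : g u = g (u.1, 0) + g (0, u.2) := by rw [← map_add]; simp
  exact Prod.ext (congrArg Prod.fst (hfst u)).symm
    (by simpa [hinl] using congrArg Prod.snd hu)

theorem commute_adjoin_singleton_iff {A : Type*} [Ring A] [Algebra k A] {a t : A} :
    (∀ b ∈ Algebra.adjoin k {a}, Commute t b) ↔ Commute t a :=
  ⟨fun h => h a (Algebra.self_mem_adjoin_singleton k a),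
    fun h _ hb => Algebra.commute_of_mem_adjoin_singleton_of_commute hb h⟩

theorem mem_scalars_of_finrank_eq_one (hV : Module.finrank k V = 1)
    (t : LinearMap.GeneralLinearGroup k V) : t ∈ scalars k V := by
  obtain ⟨c, hc, -⟩ := t.1.existsUnique_eq_smul_id_of_finrank_eq_one hV
  have : Nontrivial V := Module.nontrivial_of_finrank_eq_succ hV
  refine mem_scalars_iff.2 ⟨Units.mk0 c (ne_zero_of_forall_mem_apply_eq_smul (t := t) (W := ⊤)
    top_ne_bot fun v _ => ?_), fun v => ?_⟩
  all_goals exact LinearMap.congr_fun hc v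

end TensorProduct

variable {k : Type*} [Field k] {G₀ : Type*} [Group G₀] [AffineAlgGroup k G₀]
  {U : Type*} [AddCommGroup U] [Module k U]
  {U₀ : Type*} [AddCommGroup U₀] [Module k U₀] {ρ₀ : Representation k G₀ U₀}

theorem apply_inr_eq_of_commute {t : Module.End k (U₀ × LieAlg k G₀)}
    (ht : ∀ s ∈ endAlg k (rho0' k ρ₀), Commute t s) (v : U₀ × LieAlg k G₀) :
    t (0, v.2) = (0, (t v).2) :=
  LinearMap.congr_fun (ht _ adjointProj_mem_endAlg) v

theorem tensorAct_tmul (g : Ambient k G₀ U U₀) (x : U) (u : U × LieAlg k G₀)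
    (v : U₀ × LieAlg k G₀) :
    tensorAct k G₀ U U₀ g (x ⊗ₜ (u ⊗ₜ v)) = g.1.1 x ⊗ₜ (g.2.1.1 u ⊗ₜ g.2.2.1 v) := rfl

variable [FiniteDimensional k U₀] {hρ₀ : IsRegularRep k ρ₀} {e : U}

theorem endoA_tmul (x : U) (u : U × LieAlg k G₀) (v : U₀ × LieAlg k G₀) :
    endoA k U hρ₀ e (x ⊗ₜ (u ⊗ₜ v)) =
      x ⊗ₜ (((0, v.2) : U × LieAlg k G₀) ⊗ₜ[k] ((0, u.2) : U₀ × LieAlg k G₀) +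
        ((e, 0) : U × LieAlg k G₀) ⊗ₜ[k] rho0'der k hρ₀ u.2 v) := by
  simp [endoA]

theorem mem_stab_iff {g : Ambient k G₀ U U₀} : g ∈ stab k U hρ₀ e ↔
    Commute (tensorAct k G₀ U U₀ g) (endoA k U hρ₀ e) ∧
      Commute g.2.1.1 (endoA' k (G₀ := G₀) U) ∧
      ∀ b ∈ endAlg k (rho0' k ρ₀), Commute g.2.2.1 b := by
  rw [← commute_adjoin_singleton_iff (k := k), ← commute_adjoin_singleton_iff (k := k)]
  rfl

theorem commute_tensorAct_endoA_iff (he : e ≠ 0) {g : Ambient k G₀ U U₀} {c : k}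
    {γ : Module.End k (LieAlg k G₀)} (hg' : ∀ u, g.2.1.1 u = (c • u.1, γ u.2)) :
    Commute (tensorAct k G₀ U U₀ g) (endoA k U hρ₀ e) ↔
      ∀ x v, ((0, γ v.2) : U × LieAlg k G₀) ⊗ₜ[k] g.2.2.1 (0, x) +
          ((c • e, 0) : U × LieAlg k G₀) ⊗ₜ[k] g.2.2.1 (rho0'der k hρ₀ x v) =
        ((0, (g.2.2.1 v).2) : U × LieAlg k G₀) ⊗ₜ[k] ((0, γ x) : U₀ × LieAlg k G₀) +
          ((e, 0) : U × LieAlg k G₀) ⊗ₜ[k] rho0'der k hρ₀ (γ x) (g.2.2.1 v) := by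
  have hleft (y : U) (u : U × LieAlg k G₀) (v : U₀ × LieAlg k G₀) :
      (tensorAct k G₀ U U₀ g * endoA k U hρ₀ e) (y ⊗ₜ (u ⊗ₜ v)) =
        g.1.1 y ⊗ₜ (((0, γ v.2) : U × LieAlg k G₀) ⊗ₜ[k] g.2.2.1 (0, u.2) +
          ((c • e, 0) : U × LieAlg k G₀) ⊗ₜ[k] g.2.2.1 (rho0'der k hρ₀ u.2 v)) := by
    simp only [Module.End.mul_apply, endoA_tmul, TensorProduct.tmul_add, map_add, tensorAct_tmul,
      hg', smul_zero, map_zero]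
  have hright (y : U) (u : U × LieAlg k G₀) (v : U₀ × LieAlg k G₀) :
      (endoA k U hρ₀ e * tensorAct k G₀ U U₀ g) (y ⊗ₜ (u ⊗ₜ v)) =
        g.1.1 y ⊗ₜ (((0, (g.2.2.1 v).2) : U × LieAlg k G₀) ⊗ₜ[k]
            ((0, γ u.2) : U₀ × LieAlg k G₀) +
          ((e, 0) : U × LieAlg k G₀) ⊗ₜ[k] rho0'der k hρ₀ (γ u.2) (g.2.2.1 v)) := by
    rw [Module.End.mul_apply, tensorAct_tmul, endoA_tmul, hg']
  have hge : g.1.1 e ≠ 0 := g.1.toLinearEquiv.map_ne_zero_iff.2 he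
  refine ⟨fun h x v => tmul_right_injective (k := k) hge ?_,
    fun h => TensorProduct.ext_threefold' ?_⟩
  · exact (hleft e (0, x) v).symm.trans
      ((LinearMap.congr_fun h _).trans (hright e (0, x) v))
  · intro y u v
    rw [hleft, hright, h]

variable (hρ₀) in
/-- The normal form of an element of `G⁰`: it acts on `U' = U ⊕ 𝔤₀` by `c ⊕ γ`, on the summand `𝔤₀`
of `U₀'` by `l • γ`, and its action on `U₀'` intertwines `c • ρ₀'ᵈᵉʳ` with `ρ₀'ᵈᵉʳ ∘ γ`. -/
structure HasMultipliers (g : Ambient k G₀ U U₀) (c l : kˣ)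
    (γ : LieAlg k G₀ ≃ₗ[k] LieAlg k G₀) : Prop where
  apply_prod : ∀ u, g.2.1.1 u = ((c : k) • u.1, γ u.2)
  apply_snd : ∀ v, (g.2.2.1 v).2 = (l : k) • γ v.2
  smul_map_der : ∀ x v,
    (c : k) • g.2.2.1 (rho0'der k hρ₀ x v) = rho0'der k hρ₀ (γ x) (g.2.2.1 v)
  commute_endAlg : ∀ b ∈ endAlg k (rho0' k ρ₀), Commute g.2.2.1 b

theorem HasMultipliers.mem_stab (he : e ≠ 0) {g : Ambient k G₀ U U₀} {c l : kˣ}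
    {γ : LieAlg k G₀ ≃ₗ[k] LieAlg k G₀} (h : HasMultipliers hρ₀ g c l γ) :
    g ∈ stab k U hρ₀ e := by
  refine mem_stab_iff.2 ⟨(commute_tensorAct_endoA_iff he h.apply_prod).2 fun x v => ?_,
    LinearMap.ext fun u => ?_, h.commute_endAlg⟩
  · have hinr : g.2.2.1 (0, x) = (l : k) • (0, γ x) := by
      rw [apply_inr_eq_of_commute h.commute_endAlg (0, x), h.apply_snd, Prod.smul_mk, smul_zero]
    have hc : (((c : k) • e, 0) : U × LieAlg k G₀) = (c : k) • (e, 0) := by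
      rw [Prod.smul_mk, smul_zero]
    have hl : ((0, (l : k) • γ v.2) : U × LieAlg k G₀) = (l : k) • (0, γ v.2) := by
      rw [Prod.smul_mk, smul_zero]
    rw [LinearEquiv.coe_coe, hinr, h.apply_snd, hc, hl, TensorProduct.smul_tmul,
      TensorProduct.smul_tmul, h.smul_map_der]
  · simp [endoA', h.apply_prod]

theorem exists_prod_eq_of_commute_endoA' (hU : Module.finrank k U = 1)
    {g : LinearMap.GeneralLinearGroup k (U × LieAlg k G₀)}
    (hg : Commute g.1 (endoA' k (G₀ := G₀) U)) :
    ∃ (c : kˣ) (γ : LieAlg k G₀ ≃ₗ[k] LieAlg k G₀), ∀ u, g.1 u = ((c : k) • u.1, γ u.2) := by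
  obtain ⟨p, γ, hpγ⟩ := exists_prodMap_eq_of_commute hg
  have hinj : Function.Injective (p.prodMap γ) := hpγ ▸ g.toLinearEquiv.injective
  obtain ⟨hp, hγ⟩ := Prod.map_injective.1 hinj
  have : FiniteDimensional k U := Module.finite_of_finrank_eq_succ hU
  obtain ⟨c, hc⟩ := mem_scalars_iff.1 (mem_scalars_of_finrank_eq_one hU
    (LinearMap.GeneralLinearGroup.ofLinearEquiv (LinearEquiv.ofInjectiveEndo p hp)))
  exact ⟨c, LinearEquiv.ofInjectiveEndo γ hγ, fun u =>
    (LinearMap.congr_fun hpγ u).trans (Prod.ext (hc u.1) rfl)⟩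

theorem exists_hasMultipliers_of_mem_stab (hU : Module.finrank k U = 1) (he : e ≠ 0)
    {g : Ambient k G₀ U U₀} (hg : g ∈ stab k U hρ₀ e) :
    ∃ c l γ, HasMultipliers hρ₀ g c l γ := by
  obtain ⟨hA, hA', hcomm⟩ := mem_stab_iff.1 hg
  obtain ⟨c, γ, hg'⟩ := exists_prod_eq_of_commute_endoA' hU hA'
  have htensor := (commute_tensorAct_endoA_iff (γ := γ) he hg').1 hA
  obtain ⟨f, hf⟩ := Module.Projective.exists_dual_eq_one k he
  let δ : Module.End k (LieAlg k G₀) :=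
    LinearMap.snd k U₀ _ ∘ₗ g.2.2.1 ∘ₗ LinearMap.inr k U₀ _
  have hδ (v : U₀ × LieAlg k G₀) : g.2.2.1 (0, v.2) = (0, δ v.2) :=
    apply_inr_eq_of_commute hcomm (0, v.2)
  have hδinj : Function.Injective δ := fun x y hxy =>
    congrArg Prod.snd (g.2.2.toLinearEquiv.injective (a₁ := (0, x)) (a₂ := (0, y))
      ((hδ (0, x)).trans (hxy ▸ (hδ (0, y)).symm)))
  obtain ⟨l, hl⟩ := exists_units_smul_eq_of_tmul_eq_tmul (γ := γ.toLinearMap) γ.injective hδinj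
    fun x y => by
      simpa [δ] using congrArg (TensorProduct.map (LinearMap.snd k U (LieAlg k G₀))
        (LinearMap.snd k U₀ (LieAlg k G₀))) (htensor x (0, y))
  refine ⟨c, l, γ, hg', fun v => ?_, fun x v => ?_, hcomm⟩
  · rw [← congrArg Prod.snd (apply_inr_eq_of_commute hcomm v)]
    exact hl v.2
  · simpa [hf] using congrArg (TensorProduct.lid k _ ∘ LinearMap.rTensor _
      (f ∘ₗ LinearMap.fst k U (LieAlg k G₀))) (htensor x v)

end Stabilizer

/-! ### The structure of the stabilizer -/

section Structure

variable {k : Type*} [Field k] {G₀ : Type*} [Group G₀]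
  [AffineAlgGroup k G₀] {U : Type*} [AddCommGroup U] [Module k U]
  {U₀ : Type*} [AddCommGroup U₀] [Module k U₀] {ρ₀ : Representation k G₀ U₀}

variable (k U ρ₀) in
/-- The group `𝔾ₘ × 𝔾ₘ × T'`. -/
def scalarsProdT' : Subgroup (Ambient k G₀ U U₀) :=
  (scalars k U).prod ((scalars k (U × LieAlg k G₀)).prod (T' k ρ₀))

variable [FiniteDimensional k U₀] {hρ₀ : IsRegularRep k ρ₀} {e : U}

theorem rho0'der_Ad_apply (g : G₀) (x : LieAlg k G₀) (v : U₀ × LieAlg k G₀) :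
    rho0'der k hρ₀ (Ad k g x) (rho0' k ρ₀ g v) = rho0' k ρ₀ g (rho0'der k hρ₀ x v) :=
  derived_Ad_apply (hρ₀.prod k (isRegularRep_Ad k)) g x v

theorem embed_mem_stab (he : e ≠ 0) (h : G₀) : embed k U ρ₀ h ∈ stab k U hρ₀ e :=
  HasMultipliers.mem_stab he (c := 1) (l := 1)
    (γ := LinearMap.GeneralLinearGroup.toLinearEquiv ((Ad k).toHomUnits h))
    { apply_prod := fun u => Prod.ext (one_smul k u.1).symm rfl
      apply_snd := fun _ => (one_smul k _).symm
      smul_map_der := fun x v => (one_smul k _).trans (rho0'der_Ad_apply h x v).symm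
      commute_endAlg := fun _ hb => (mem_endAlg_iff.1 hb h).symm }

theorem rho0'der_apply (x : LieAlg k G₀) (v : U₀ × LieAlg k G₀) :
    rho0'der k hρ₀ x v = (derived k hρ₀ x v.1, ⁅x, v.2⁆) :=
  (derived_prod hρ₀ (isRegularRep_Ad k) x v).trans (congrArg _ (derived_Ad x v.2))

variable [IsAlgClosed k]

theorem scalarsProdT'_le_stab (he : e ≠ 0) : scalarsProdT' k U ρ₀ ≤ stab k U hρ₀ e := by
  rintro g ⟨-, hg', ht⟩
  obtain ⟨c, hc⟩ := mem_scalars_iff.1 hg'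
  obtain ⟨⟨hend, hcomm⟩, μ, hμ⟩ := mem_T'_iff.1 ht
  refine HasMultipliers.mem_stab he (c := c) (l := c⁻¹ * μ) (γ := LinearEquiv.smulOfUnit c)
    ⟨hc, fun v => ?_, fun x v => ?_, hcomm⟩
  · have hsnd : (0, (g.2.2.1 v).2) = (μ : k) • ((0, v.2) : U₀ × LieAlg k G₀) :=
      (apply_inr_eq_of_commute hcomm v).symm.trans (hμ v.2)
    calc (g.2.2.1 v).2 = μ • v.2 := congrArg Prod.snd hsnd
      _ = (c⁻¹ * μ) • c • v.2 := by rw [smul_smul, mul_right_comm, inv_mul_cancel, one_mul]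
  · calc (c : k) • g.2.2.1 (rho0'der k hρ₀ x v) = (c : k) • rho0'der k hρ₀ x (g.2.2.1 v) :=
          congrArg _ (LinearMap.congr_fun (commute_derived_of_commute
            (hρ₀.prod k (isRegularRep_Ad k)) (mem_endAlg_iff.1 hend) x) v)
      _ = rho0'der k hρ₀ ((c : k) • x) (g.2.2.1 v) := by rw [map_smul, LinearMap.smul_apply]

theorem commute_of_mem_scalarsProdT' {z g : Ambient k G₀ U U₀} (hz : z ∈ scalarsProdT' k U ρ₀)
    (hg : g ∈ stab k U hρ₀ e) : Commute z g := by
  obtain ⟨⟨c, hc⟩, ⟨c', hc'⟩, ht⟩ := hz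
  refine Prod.commute_iff.2 ⟨?_, Prod.commute_iff.2 ⟨?_, ?_⟩⟩
  · exact Units.ext (hc ▸ Algebra.commutes (c : k) g.1.1)
  · exact Units.ext (hc' ▸ Algebra.commutes (c' : k) g.2.1.1)
  · exact Units.ext ((mem_stab_iff.1 hg).2.2 _ (mem_T'_iff.1 ht).1.1).symm

variable [CharZero k]

theorem rho0'der_injective (hG₀ : IsSemisimple k G₀) : Function.Injective (rho0'der k hρ₀) := by
  have := hasTrivialRadical hG₀
  refine (injective_iff_map_eq_zero _).2 fun x hx => ?_
  have hker : x ∈ (LieAlgebra.ad k (LieAlg k G₀)).ker := by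
    refine LieHom.mem_ker.2 (LinearMap.ext fun y => ?_)
    exact congrArg Prod.snd ((rho0'der_apply x (0, y)).symm.trans (LinearMap.congr_fun hx (0, y)))
  rw [LieAlgebra.ad_ker_eq_bot_of_hasTrivialRadical] at hker
  exact (LieSubmodule.mem_bot x).1 hker

theorem mem_scalarsProdT'_of_mem_endAlg (hG₀ : IsSemisimple k G₀) (hU : Module.finrank k U = 1)
    (he : e ≠ 0) {g : Ambient k G₀ U U₀} (hg : g ∈ stab k U hρ₀ e)
    (hend : g.2.2.1 ∈ endAlg k (rho0' k ρ₀)) : g ∈ scalarsProdT' k U ρ₀ := by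
  obtain ⟨c, l, γ, h⟩ := exists_hasMultipliers_of_mem_stab hU he hg
  have hγ (x : LieAlg k G₀) : γ x = (c : k) • x := by
    refine rho0'der_injective (hρ₀ := hρ₀) hG₀ (LinearMap.ext fun w => ?_)
    obtain ⟨v, rfl⟩ := g.2.2.toLinearEquiv.surjective w
    rw [map_smul]
    exact (h.smul_map_der x v).symm.trans (congrArg _ (LinearMap.congr_fun
      (commute_derived_of_commute (hρ₀.prod k (isRegularRep_Ad k)) (mem_endAlg_iff.1 hend) x) v))
  refine ⟨mem_scalars_of_finrank_eq_one hU _, mem_scalars_iff.2 ⟨c, fun u => ?_⟩,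
    mem_T'_iff.2 ⟨⟨hend, h.commute_endAlg⟩, l * c, fun x => ?_⟩⟩
  · rw [h.apply_prod, hγ]
    rfl
  · rw [apply_inr_eq_of_commute h.commute_endAlg (0, x), h.apply_snd, hγ, smul_smul, Prod.smul_mk,
      smul_zero, Units.val_mul]

theorem T0_eq (hG₀ : IsSemisimple k G₀) (hU : Module.finrank k U = 1) (he : e ≠ 0) :
    T0 k U hρ₀ e = scalarsProdT' k U ρ₀ := by
  ext z
  constructor
  · rintro ⟨⟨z, hz⟩, hcenter, rfl⟩
    refine mem_scalarsProdT'_of_mem_endAlg hG₀ hU he hz (mem_endAlg_iff.2 fun h => ?_)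
    have hcomm := Subgroup.mem_center_iff.1 hcenter ⟨_, embed_mem_stab he h⟩
    exact (congrArg (fun g => g.1.2.2.1) hcomm).symm
  · intro hz
    exact ⟨⟨z, scalarsProdT'_le_stab he hz⟩, Subgroup.mem_center_iff.2 fun g =>
      Subtype.ext (commute_of_mem_scalarsProdT' hz g.2).eq.symm, rfl⟩

/-- The linear automorphism `γ` of `𝔤₀` as an automorphism of Lie algebras, when conjugation by `t`
takes `ρ₀'ᵈᵉʳ x` to `ρ₀'ᵈᵉʳ (γ x)`. -/
def lieEquivOfIntertwines (hG₀ : IsSemisimple k G₀) (γ : LieAlg k G₀ ≃ₗ[k] LieAlg k G₀)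
    (t : LinearMap.GeneralLinearGroup k (U₀ × LieAlg k G₀))
    (h : ∀ x v, t.1 (rho0'der k hρ₀ x v) = rho0'der k hρ₀ (γ x) (t.1 v)) :
    LieAlg k G₀ ≃ₗ⁅k⁆ LieAlg k G₀ :=
  { γ with
    map_lie' := fun {x y} => by
      refine rho0'der_injective (hρ₀ := hρ₀) hG₀ (LinearMap.ext fun w => ?_)
      obtain ⟨v, rfl⟩ := t.toLinearEquiv.surjective w
      change rho0'der k hρ₀ (γ ⁅x, y⁆) (t.1 v) = rho0'der k hρ₀ ⁅γ x, γ y⁆ (t.1 v)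
      rw [← h, LieHom.map_lie, LieHom.map_lie]
      simp only [Ring.lie_def, LinearMap.sub_apply, Module.End.mul_apply, map_sub, h] }

theorem isInnerAut_of_intertwines (hG₀ : IsSemisimple k G₀)
    (hasymm : IsAsymmetrical (rho0'der k hρ₀)) {α : LieAlg k G₀ ≃ₗ⁅k⁆ LieAlg k G₀}
    {t : LinearMap.GeneralLinearGroup k (U₀ × LieAlg k G₀)}
    (hcomm : ∀ b ∈ endAlg k (rho0' k ρ₀), Commute t.1 b)
    (h : ∀ x v, t.1 (rho0'der k hρ₀ x v) = rho0'der k hρ₀ (α x) (t.1 v)) : IsInnerAut α := by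
  by_contra hα
  obtain ⟨W, hW, hno⟩ := hasymm α hα
  have := hasTrivialRadical hG₀
  obtain ⟨p, hp, hpmem, hpid⟩ := exists_commute_projection (rho0'der k hρ₀) W hW
  have hpend : p ∈ endAlg k (rho0' k ρ₀) := mem_endAlg_iff.2
    (commute_of_commute_derived hG₀.connected (hρ₀.prod k (isRegularRep_Ad k)) hp)
  have htW (w : U₀ × LieAlg k G₀) (hw : w ∈ W) : t.1 w ∈ W := by
    have hpt : t.1 (p w) = p (t.1 w) := LinearMap.congr_fun (hcomm p hpend) w
    rw [hpid w hw] at hpt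
    exact hpt ▸ hpmem _
  refine hno ⟨LinearEquiv.ofInjectiveEndo (t.1.restrict htW) fun v w hvw => ?_,
    fun x w => Subtype.ext (h x w)⟩
  exact Subtype.ext (t.toLinearEquiv.injective (congrArg Subtype.val hvw))

theorem exists_Ad_eq_of_hasMultipliers (hG₀ : IsSemisimple k G₀)
    (hasymm : IsAsymmetrical (rho0'der k hρ₀)) {g : Ambient k G₀ U U₀} {c l : kˣ}
    {γ : LieAlg k G₀ ≃ₗ[k] LieAlg k G₀} (hg : HasMultipliers hρ₀ g c l γ) :
    ∃ h : G₀, ∀ x v, g.2.2.1 (rho0'der k hρ₀ x v) = rho0'der k hρ₀ (Ad k h x) (g.2.2.1 v) := by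
  have htwist (x : LieAlg k G₀) (v : U₀ × LieAlg k G₀) : g.2.2.1 (rho0'der k hρ₀ x v) =
      rho0'der k hρ₀ (γ.trans (LinearEquiv.smulOfUnit c⁻¹) x) (g.2.2.1 v) := by
    change _ = rho0'der k hρ₀ (((c⁻¹ : kˣ) : k) • γ x) (g.2.2.1 v)
    rw [map_smul, LinearMap.smul_apply, ← hg.smul_map_der, smul_smul, Units.inv_mul, one_smul]
  obtain ⟨h, hh⟩ := exists_Ad_eq_of_isInnerAut hG₀ (isInnerAut_of_intertwines hG₀ hasymm
    (α := lieEquivOfIntertwines hG₀ _ g.2.2 htwist) hg.commute_endAlg htwist)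
  exact ⟨h, fun x v => hh x ▸ htwist x v⟩

theorem exists_mul_embed_mem_scalarsProdT' (hG₀ : IsSemisimple k G₀)
    (hasymm : IsAsymmetrical (rho0'der k hρ₀)) (hU : Module.finrank k U = 1) (he : e ≠ 0)
    {g : Ambient k G₀ U U₀} (hg : g ∈ stab k U hρ₀ e) :
    ∃ h : G₀, g * embed k U ρ₀ h ∈ scalarsProdT' k U ρ₀ := by
  obtain ⟨c, l, γ, hmul⟩ := exists_hasMultipliers_of_mem_stab hU he hg
  obtain ⟨h, hh⟩ := exists_Ad_eq_of_hasMultipliers hG₀ hasymm hmul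
  have hder (x : LieAlg k G₀) :
      Commute (g * embed k U ρ₀ h⁻¹).2.2.1 (rho0'der k hρ₀ x) := by
    refine LinearMap.ext fun v => ?_
    change g.2.2.1 (rho0' k ρ₀ h⁻¹ (rho0'der k hρ₀ x v)) =
      rho0'der k hρ₀ x (g.2.2.1 (rho0' k ρ₀ h⁻¹ v))
    rw [← rho0'der_Ad_apply, hh, (Ad k).self_inv_apply h x]
  exact ⟨h⁻¹, mem_scalarsProdT'_of_mem_endAlg hG₀ hU he (mul_mem hg (embed_mem_stab he h⁻¹))
    (mem_endAlg_iff.2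
      (commute_of_commute_derived hG₀.connected (hρ₀.prod k (isRegularRep_Ad k)) hder))⟩

theorem T0_mul_range_embed (hG₀ : IsSemisimple k G₀) (hasymm : IsAsymmetrical (rho0'der k hρ₀))
    (hU : Module.finrank k U = 1) (he : e ≠ 0) :
    (T0 k U hρ₀ e : Set (Ambient k G₀ U U₀)) * (embed k U ρ₀).range = stab k U hρ₀ e := by
  rw [T0_eq hG₀ hU he]
  refine Set.Subset.antisymm ?_ fun g hg => ?_
  · rintro _ ⟨z, hz, _, ⟨h, rfl⟩, rfl⟩
    exact mul_mem (scalarsProdT'_le_stab he hz) (embed_mem_stab he h)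
  · obtain ⟨h, hz⟩ := exists_mul_embed_mem_scalarsProdT' hG₀ hasymm hU he hg
    exact ⟨_, hz, _, ⟨h⁻¹, rfl⟩, by rw [map_inv]; exact mul_inv_cancel_right g _⟩

theorem isTorusOfRank_T0 (hG₀ : IsSemisimple k G₀) (hU : Module.finrank k U = 1) (he : e ≠ 0)
    {r : ℕ} (hr : IsTorusOfRank (glCoord k (U₀ × LieAlg k G₀)) (T' k ρ₀) r) :
    IsTorusOfRank (ambientCoord k G₀ U U₀) (T0 k U hρ₀ e) (1 + (1 + r)) := by
  have : Nontrivial U := ⟨e, 0, he⟩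
  rw [T0_eq hG₀ hU he]
  exact isTorusOfRank_scalars.prod (isTorusOfRank_scalars.prod hr)

end Structure

end

end AlgGrp

theorem mainTheorem12_general {k : Type*} [Field k] [IsAlgClosed k] [CharZero k]
    {G₀ : Type*} [Group G₀] [AlgGrp.AffineAlgGroup k G₀] (hG₀ : AlgGrp.IsSemisimple k G₀)
    {U₀ : Type*} [AddCommGroup U₀] [Module k U₀] [FiniteDimensional k U₀]
    (ρ₀ : Representation k G₀ U₀) (hρ₀ : AlgGrp.IsRegularRep k ρ₀)
    {U : Type*} [AddCommGroup U] [Module k U] (hU : Module.finrank k U = 1)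
    (e : U) (he : e ≠ 0) :
    (AlgGrp.IsAsymmetrical (AlgGrp.rho0'der k hρ₀) →
      (AlgGrp.T0 k U hρ₀ e : Set (AlgGrp.Ambient k G₀ U U₀)) * (AlgGrp.embed k U ρ₀).range =
        AlgGrp.stab k U hρ₀ e) ∧
    (AlgGrp.T0 k U hρ₀ e =
      (AlgGrp.scalars k U).prod
        ((AlgGrp.scalars k (U × AlgGrp.LieAlg k G₀)).prod (AlgGrp.T' k ρ₀))) ∧
    AlgGrp.IsZariskiConnected (AlgGrp.ambientCoord k G₀ U U₀)
      (AlgGrp.T0 k U hρ₀ e : Set (AlgGrp.Ambient k G₀ U U₀)) ∧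
    (∃ r : ℕ, AlgGrp.IsTorusOfRank (AlgGrp.glCoord k (U₀ × AlgGrp.LieAlg k G₀))
      (AlgGrp.T' k ρ₀) r) ∧
    (∃ r : ℕ, AlgGrp.IsTorusOfRank (AlgGrp.ambientCoord k G₀ U U₀) (AlgGrp.T0 k U hρ₀ e) r ∧
      (Nontrivial G₀ →
        (r : ℤ) = 3 + AlgGrp.numIsotypic k (AlgGrp.rho0' k ρ₀) -
          AlgGrp.numSimpleFactors k (AlgGrp.LieAlg k G₀))) := by
  obtain ⟨r, hr, hrank⟩ := AlgGrp.isTorusOfRank_T' hG₀ hρ₀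
  have htorus := AlgGrp.isTorusOfRank_T0 (hρ₀ := hρ₀) hG₀ hU he hr
  refine ⟨fun hasymm => AlgGrp.T0_mul_range_embed hG₀ hasymm hU he, AlgGrp.T0_eq hG₀ hU he,
    htorus.isZariskiConnected, ⟨r, hr⟩, 1 + (1 + r), htorus, fun hnontrivial => ?_⟩
  have := hrank hnontrivial
  push_cast
  linarith

theorem mainTheorem12 {k : Type*} [Field k] [IsAlgClosed k] [CharZero k]
    {G₀ : Type*} [Group G₀] [AlgGrp.AffineAlgGroup k G₀] (hG₀ : AlgGrp.IsSemisimple k G₀)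
    {U₀ : Type*} [AddCommGroup U₀] [Module k U₀] [FiniteDimensional k U₀]
    (ρ₀ : Representation k G₀ U₀) (hρ₀ : AlgGrp.IsRegularRep k ρ₀)
    (hfaithful : Function.Injective (AlgGrp.rho0' k ρ₀))
    (hasymm : AlgGrp.IsAsymmetrical (AlgGrp.rho0'der k hρ₀))
    {U : Type*} [AddCommGroup U] [Module k U] (hU : Module.finrank k U = 1)
    (e : U) (he : e ≠ 0) :
    -- `T⁰ G₀ = G⁰`
    ((AlgGrp.T0 k U hρ₀ e : Set (AlgGrp.Ambient k G₀ U U₀)) * (AlgGrp.embed k U ρ₀).range =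
      AlgGrp.stab k U hρ₀ e) ∧
    -- `T⁰ = 𝔾ₘ × 𝔾ₘ × T'`
    (AlgGrp.T0 k U hρ₀ e =
      (AlgGrp.scalars k U).prod
        ((AlgGrp.scalars k (U × AlgGrp.LieAlg k G₀)).prod (AlgGrp.T' k ρ₀))) ∧
    -- `T⁰` is connected
    AlgGrp.IsZariskiConnected (AlgGrp.ambientCoord k G₀ U U₀)
      (AlgGrp.T0 k U hρ₀ e : Set (AlgGrp.Ambient k G₀ U U₀)) ∧
    -- `T'` is a torus
    (∃ r : ℕ, AlgGrp.IsTorusOfRank (AlgGrp.glCoord k (U₀ × AlgGrp.LieAlg k G₀))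
      (AlgGrp.T' k ρ₀) r) ∧
    -- `T⁰` is a torus, and its rank is as stated
    (∃ r : ℕ, AlgGrp.IsTorusOfRank (AlgGrp.ambientCoord k G₀ U U₀) (AlgGrp.T0 k U hρ₀ e) r ∧
      (Nontrivial G₀ →
        (r : ℤ) = 3 + AlgGrp.numIsotypic k (AlgGrp.rho0' k ρ₀) -
          AlgGrp.numSimpleFactors k (AlgGrp.LieAlg k G₀))) := by
  exact (mainTheorem12_general hG₀ ρ₀ hρ₀ hU e he).imp_left fun h => h hasymm
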